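/- Let $(\Sigma,g)$ be an oriented smooth Riemannian surface with Levi-Civita connection $\nabla$ and rotation $j$ by $+\pi/2$, and let $\pi:T\Sigma\to\Sigma$ be its tangent bundle. For a tangent vector $X$ of $T\Sigma$ write $PX=d\pi(X)$ and let $KX$ be the connection map ($KX=\nabla_{p'(0)}V$ if $X$ is the velocity at $0$ of the curve $(p(s),V(s))$), so that $X\simeq(PX,KX)$ identifies $TT\Sigma$ with $T\Sigma\oplus T\Sigma$. Put $\Omega(X,Y)=g(KX,PY)-g(PX,KY)$, $\mathbb J=j\oplus j$ and $\mathbb G(X,Y)=\Omega(\mathbb JX,Y)$, a pseudo-Riemannian metric of signature $(2,2)$. Let $L$ be a smooth surface in $T\Sigma$, given by a smooth immersion $F:L\to T\Sigma$ of a smooth $2$-manifold, which is Lagrangian ($F^*\Omega=0$), non-null (the induced metric $F^*\mathbb G$ is everywhere non-degenerate) and minimal (its mean curvature vector with respect to $\mathbb G$ vanishes identically). Say that $L$ is an affine normal bundle over a geodesic near $q\in L$ if there are smooth coordinates $(s,t)$ of $L$ around $q$ in which $$F(s,t)=\bigl(\gamma(s),\ a(s)\,\gamma'(s)+t\,\vec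 n(s)\bigr),$$ where $\gamma$ is a unit speed geodesic of $(\Sigma,g)$, $\vec n$ is a unit normal along $\gamma$ and $a$ is a smooth real function. Then: 1. for every $q\in L$, either (i) $L$ is an affine normal bundle over a geodesic near $q$, or (ii) $\pi(F(q))$ lies in the closure of the set of points of $\Sigma$ that have a neighbourhood on which $g$ is flat; 2. if the rank of $d(\pi\circ F)$ is constant on $L$, then either (i) $L$ is an affine normal bundle over a geodesic near each of its points, or (ii) $g$ is flat on a neighbourhood of $\pi(F(q))$ for every $q\in L$. -/

import Mathlib

open Set Filter Topology
open scoped Manifold ContDiff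

noncomputable section

namespace TangentSurface

/-- The model plane. -/
abbrev Plane : Type := EuclideanSpace ℝ (Fin 2)

/-- The standard basis of the plane. -/
def planeBasis : Module.Basis (Fin 2) ℝ Plane :=
  (EuclideanSpace.basisFun (Fin 2) ℝ).toBasis

/-- The standard basis of the product of two planes (the model of the tangent bundle). -/
def planeProdBasis : Module.Basis (Fin 2 ⊕ Fin 2) ℝ (Plane × Plane) :=
  planeBasis.prod planeBasis

/-! ### Pseudo-Riemannian geometry on an open subset of a vector space

A pseudo-metric on (an open subset of) a finite-dimensional space `V` is given by its values
`G x u v`; `b` is a basis of `V`. -/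

section Coordinates

variable {V : Type*} [NormedAddCommGroup V] [NormedSpace ℝ V]
  {ι : Type*} [Fintype ι] [DecidableEq ι]

/-- The matrix `G_{ij}` of the pseudo-metric at `x`. -/
def gramMatrix (b : Module.Basis ι ℝ V) (G : V → V → V → ℝ) (x : V) : Matrix ι ι ℝ :=
  Matrix.of fun i j => G x (b i) (b j)

/-- The Christoffel symbols of the Levi-Civita connection of `G`, as a bilinear map:
`Γ(u, v) = ½ G^{kl} (∂_u G(v, b_l) + ∂_v G(u, b_l) - ∂_{b_l} G(u, v)) b_k`. -/
def christoffel (b : Module.Basis ι ℝ V) (G : V → V → V → ℝ) (x u v : V) : V :=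
  ∑ k, (∑ l, (1 / 2 : ℝ) * (gramMatrix b G x)⁻¹ k l *
    (fderiv ℝ (fun y => G y v (b l)) x u + fderiv ℝ (fun y => G y u (b l)) x v
      - fderiv ℝ (fun y => G y u v) x (b l))) • b k

/-- The curvature tensor `R(u, v) w` of the Levi-Civita connection of `G`. -/
def curvatureTensor (b : Module.Basis ι ℝ V) (G : V → V → V → ℝ) (x u v w : V) : V :=
  fderiv ℝ (fun y => christoffel b G y v w) x u - fderiv ℝ (fun y => christoffel b G y u w) x v
    + christoffel b G x u (christoffel b G x v w) - christoffel b G x v (christoffel b G x u w)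

/-- The metric induced by `G` on the plane through the map `f`. -/
def inducedMetric (G : V → V → V → ℝ) (f : Plane → V) (x u v : Plane) : ℝ :=
  G (f x) (fderiv ℝ f x u) (fderiv ℝ f x v)

/-- The covariant derivative `D_{∂_u f} ∂_v f` along the map `f`, where `D` is the Levi-Civita
connection of `G`. -/
def covariantHessian (b : Module.Basis ι ℝ V) (G : V → V → V → ℝ) (f : Plane → V)
    (x u v : Plane) : V :=
  fderiv ℝ (fun y => fderiv ℝ f y v) x u
    + christoffel b G (f x) (fderiv ℝ f x u) (fderiv ℝ f x v)

/-- The `G`-normal component of the vector `W` with respect to the tangent plane of `f` at `x`. -/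
def normalPart (G : V → V → V → ℝ) (f : Plane → V) (x : Plane) (W : V) : V :=
  W - ∑ k, ∑ l, ((gramMatrix planeBasis (inducedMetric G f) x)⁻¹ k l *
    G (f x) W (fderiv ℝ f x (planeBasis k))) • fderiv ℝ f x (planeBasis l)

/-- The second fundamental form of the parametrized surface `f`. -/
def secondFundamentalForm (b : Module.Basis ι ℝ V) (G : V → V → V → ℝ) (f : Plane → V)
    (x u v : Plane) : V :=
  normalPart G f x (covariantHessian b G f x u v)

/-- The mean curvature vector of the parametrized surface `f`: half of the trace, with respect to
the induced metric, of the second fundamental form. -/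
def meanCurvature (b : Module.Basis ι ℝ V) (G : V → V → V → ℝ) (f : Plane → V)
    (x : Plane) : V :=
  (1 / 2 : ℝ) • ∑ i, ∑ j, (gramMatrix planeBasis (inducedMetric G f) x)⁻¹ i j •
    secondFundamentalForm b G f x (planeBasis i) (planeBasis j)

end Coordinates

/-! ### Oriented Riemannian surfaces -/

section Surface

variable {S : Type*} [TopologicalSpace S] [ChartedSpace Plane S] [IsManifold (𝓡 2) ∞ S]

/-- A smooth Riemannian metric on the surface `S`. -/
abbrev SurfaceMetric (S : Type*) [TopologicalSpace S] [ChartedSpace Plane S]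
    [IsManifold (𝓡 2) ∞ S] :=
  Bundle.ContMDiffRiemannianMetric (𝓡 2) ∞ Plane (fun p : S => TangentSpace (𝓡 2) p)

/-- An orientation of the surface `S`: a smooth atlas of `S` all of whose coordinate changes
preserve the orientation. -/
structure OrientedAtlas (S : Type*) [TopologicalSpace S] [ChartedSpace Plane S] where
  charts : Set (OpenPartialHomeomorph S Plane)
  smooth : charts ⊆ IsManifold.maximalAtlas (𝓡 2) ∞ S
  cover : ∀ p : S, ∃ φ ∈ charts, p ∈ φ.source
  oriented : ∀ φ ∈ charts, ∀ φ' ∈ charts, ∀ x ∈ φ.target, φ.symm x ∈ φ'.source →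
    0 < (fderiv ℝ (φ' ∘ φ.symm) x).det

/-- The metric `g` in the chart `φ`. -/
def metricIn (g : SurfaceMetric S) (φ : OpenPartialHomeomorph S Plane) (x u v : Plane) : ℝ :=
  g.inner (φ.symm x) (mfderiv (𝓡 2) (𝓡 2) φ.symm x u) (mfderiv (𝓡 2) (𝓡 2) φ.symm x v)

/-- The Levi-Civita connection `∇` of `g` in the chart `φ` (its Christoffel symbols). -/
def connectionIn (g : SurfaceMetric S) (φ : OpenPartialHomeomorph S Plane) (x u v : Plane) :
    Plane :=
  christoffel planeBasis (metricIn g φ) x u v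

/-- The complex structure `j` of the oriented surface, i.e. the rotation by `+π/2` for the
metric `g`, in the positively oriented chart `φ`. -/
def rotationIn (g : SurfaceMetric S) (φ : OpenPartialHomeomorph S Plane) (x v : Plane) : Plane :=
  (Real.sqrt (gramMatrix planeBasis (metricIn g φ) x).det)⁻¹ •
    !₂[-(gramMatrix planeBasis (metricIn g φ) x 0 1) * v 0
        - gramMatrix planeBasis (metricIn g φ) x 1 1 * v 1,
       gramMatrix planeBasis (metricIn g φ) x 0 0 * v 0
        + gramMatrix planeBasis (metricIn g φ) x 0 1 * v 1]

/-- The metric `g` is flat at `p`: its curvature tensor vanishes there. -/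
def IsFlatAt (g : SurfaceMetric S) (o : OrientedAtlas S) (p : S) : Prop :=
  ∀ φ ∈ o.charts, p ∈ φ.source → ∀ u v w : Plane,
    curvatureTensor planeBasis (metricIn g φ) (φ p) u v w = 0

/-- The metric `g` is flat on a neighbourhood of `p`. -/
def IsFlatNear (g : SurfaceMetric S) (o : OrientedAtlas S) (p : S) : Prop :=
  ∀ᶠ p' in 𝓝 p, IsFlatAt g o p'

/-- The velocity vector of a curve. -/
def velocity (γ : ℝ → S) (s : ℝ) : TangentSpace (𝓡 2) (γ s) :=
  mfderiv 𝓘(ℝ, ℝ) (𝓡 2) γ s (1 : ℝ)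

/-- `γ` is a smooth geodesic, parametrized by arc length, on the open set `J` of parameters:
`∇_{γ'} γ' = 0`. -/
structure IsUnitSpeedGeodesicOn (g : SurfaceMetric S) (o : OrientedAtlas S) (γ : ℝ → S)
    (J : Set ℝ) : Prop where
  smooth : ContMDiffOn 𝓘(ℝ, ℝ) (𝓡 2) ∞ γ J
  unit_speed : ∀ s ∈ J, g.inner (γ s) (velocity γ s) (velocity γ s) = 1
  geodesic : ∀ s ∈ J, ∀ φ ∈ o.charts, γ s ∈ φ.source →
    deriv (deriv (φ ∘ γ)) s
      + connectionIn g φ (φ (γ s)) (deriv (φ ∘ γ) s) (deriv (φ ∘ γ) s) = 0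

/-! ### The structures of the tangent bundle

A chart `φ` of the surface induces the chart `tangentChart φ` of its tangent bundle. All tensors
below are written in that chart, at the point `z = (x, y)`; a tangent vector at `z` is a pair
`X = (X.1, X.2)`, and `X.1` is its image `P X` under the differential of the projection. -/

/-- The chart of the tangent bundle induced by the chart `φ`. -/
def tangentChart (φ : OpenPartialHomeomorph S Plane) (z : TangentBundle (𝓡 2) S) :
    Plane × Plane :=
  (φ z.proj, mfderiv (𝓡 2) (𝓡 2) φ z.proj z.snd)

/-- The connection map `K`: if `X` is the velocity of a curve `(p, V)` in the tangent bundle,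
then `K X = ∇_{p'} V`. -/
def connectionMap (g : SurfaceMetric S) (φ : OpenPartialHomeomorph S Plane)
    (z X : Plane × Plane) : Plane :=
  X.2 + connectionIn g φ z.1 X.1 z.2

/-- The symplectic form `Ω(X, Y) = g(K X, P Y) - g(P X, K Y)`. -/
def symplecticForm (g : SurfaceMetric S) (φ : OpenPartialHomeomorph S Plane)
    (z X Y : Plane × Plane) : ℝ :=
  metricIn g φ z.1 (connectionMap g φ z X) Y.1 - metricIn g φ z.1 X.1 (connectionMap g φ z Y)

/-- The complex structure `𝕁 = j ⊕ j`: `𝕁 X` is the vector with `P (𝕁 X) = j (P X)` and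
`K (𝕁 X) = j (K X)`. -/
def complexStructure (g : SurfaceMetric S) (φ : OpenPartialHomeomorph S Plane)
    (z X : Plane × Plane) : Plane × Plane :=
  (rotationIn g φ z.1 X.1,
    rotationIn g φ z.1 (connectionMap g φ z X)
      - connectionIn g φ z.1 (rotationIn g φ z.1 X.1) z.2)

/-- The neutral metric `𝔾(X, Y) = Ω(𝕁 X, Y)`. -/
def neutralMetric (g : SurfaceMetric S) (φ : OpenPartialHomeomorph S Plane)
    (z X Y : Plane × Plane) : ℝ :=
  symplecticForm g φ z (complexStructure g φ z X) Y

/-! ### Immersed surfaces in the tangent bundle -/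

variable {M : Type*} [TopologicalSpace M] [ChartedSpace Plane M] [IsManifold (𝓡 2) ∞ M]

/-- The expression of `F : M → TS` in a chart `ψ` of `M` and the chart of the tangent bundle
induced by `φ`. -/
def localExpr (F : M → TangentBundle (𝓡 2) S) (ψ : OpenPartialHomeomorph M Plane)
    (φ : OpenPartialHomeomorph S Plane) : Plane → Plane × Plane :=
  fun x => tangentChart φ (F (ψ.symm x))

/-- `F` is a smooth immersion of the surface `M` into the tangent bundle. -/
structure IsSmoothImmersion (F : M → TangentBundle (𝓡 2) S) : Prop where
  smooth : ContMDiff (𝓡 2) (𝓡 2).tangent ∞ F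
  injective : ∀ q, Function.Injective (mfderiv (𝓡 2) (𝓡 2).tangent F q)

/-- The symplectic form `Ω` vanishes on the surface. -/
def IsLagrangian (g : SurfaceMetric S) (o : OrientedAtlas S)
    (F : M → TangentBundle (𝓡 2) S) : Prop :=
  ∀ ψ ∈ IsManifold.maximalAtlas (𝓡 2) ∞ M, ∀ φ ∈ o.charts, ∀ q ∈ ψ.source,
    (F q).proj ∈ φ.source → ∀ u v : Plane,
      symplecticForm g φ (localExpr F ψ φ (ψ q))
        (fderiv ℝ (localExpr F ψ φ) (ψ q) u) (fderiv ℝ (localExpr F ψ φ) (ψ q) v) = 0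

/-- The metric induced by `𝔾` on the surface is everywhere non-degenerate. -/
def IsNonNull (g : SurfaceMetric S) (o : OrientedAtlas S)
    (F : M → TangentBundle (𝓡 2) S) : Prop :=
  ∀ ψ ∈ IsManifold.maximalAtlas (𝓡 2) ∞ M, ∀ φ ∈ o.charts, ∀ q ∈ ψ.source,
    (F q).proj ∈ φ.source → ∀ u : Plane,
      (∀ v : Plane, inducedMetric (neutralMetric g φ) (localExpr F ψ φ) (ψ q) u v = 0) → u = 0

/-- The mean curvature vector of the surface with respect to `𝔾` vanishes. -/
def IsMinimal (g : SurfaceMetric S) (o : OrientedAtlas S)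
    (F : M → TangentBundle (𝓡 2) S) : Prop :=
  ∀ ψ ∈ IsManifold.maximalAtlas (𝓡 2) ∞ M, ∀ φ ∈ o.charts, ∀ q ∈ ψ.source,
    (F q).proj ∈ φ.source →
      meanCurvature planeProdBasis (neutralMetric g φ) (localExpr F ψ φ) (ψ q) = 0

/-- The rank at `q` of the projection of the surface to the base. -/
def projectionRank (F : M → TangentBundle (𝓡 2) S) (q : M) : ℕ :=
  Module.finrank ℝ (LinearMap.range
    (mfderiv (𝓡 2) (𝓡 2) (fun q' => (F q').proj) q : Plane →L[ℝ] Plane).toLinearMap)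

/-- Near `q` the surface is an affine normal bundle over a geodesic: in suitable smooth local
coordinates `(s, t)` of `M` around `q`, it is the map
`(s, t) ↦ (γ(s), a(s) γ'(s) + t n(s))`, where `γ` is a unit speed geodesic, `n` is a unit normal
vector field along `γ` and `a` is a smooth function. -/
def IsAffineNormalBundleNear (g : SurfaceMetric S) (o : OrientedAtlas S)
    (F : M → TangentBundle (𝓡 2) S) (q : M) : Prop :=
  ∃ ψ ∈ IsManifold.maximalAtlas (𝓡 2) ∞ M, q ∈ ψ.source ∧
    ∃ (s₀ s₁ : ℝ) (γ : ℝ → S) (a : ℝ → ℝ) (n : (s : ℝ) → TangentSpace (𝓡 2) (γ s)),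
      IsUnitSpeedGeodesicOn g o γ (Ioo s₀ s₁) ∧
      ContDiffOn ℝ ∞ a (Ioo s₀ s₁) ∧
      (∀ s ∈ Ioo s₀ s₁, g.inner (γ s) (n s) (n s) = 1 ∧
        g.inner (γ s) (n s) (velocity γ s) = 0) ∧
      ∀ x ∈ ψ.target, x 0 ∈ Ioo s₀ s₁ ∧
        F (ψ.symm x) = ⟨γ (x 0), a (x 0) • velocity γ (x 0) + x 1 • n (x 0)⟩

end Surface

end TangentSurface

end

/-! In a chart, take a unitary complex coframe ζ of g with connection form ω, so that dζ = -iω∧ζ and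
dω is a curvature function times the area form. On the tangent bundle, X ↦ (ζ(PX), ζ(KX)) is a
complex coframe in which Ω and 𝔾 are the real part and minus the imaginary part of one constant
skew-Hermitian form. There the Levi-Civita connection of 𝔾 is a lower triangular matrix with both
diagonal entries iω (`tangentCoframe_christoffel`), so its trace 2iω comes from the base.

Let Θ be the complex area of the coordinate frame of L. It vanishes nowhere because L is Lagrangian
and non-null. The second fundamental form of a Lagrangian surface is totally symmetric, so the trace
expressing the mean curvature is the covariant variation of arg Θ. Minimality thus gives d(arg Θ) =
-2 p*ω with p = π ∘ F (`im_fderiv_surfaceArea`).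

Taking the exterior derivative, p*(dω) = 0: the curvature vanishes at p(q) as soon as p has rank 2
at q (`structureCurvature_eq_zero`). Since p is then open at q, g is flat on a neighbourhood of p(q)
(`isFlatNear_of_projectionRank`).

If p has rank 2 nowhere near q, its rank there is 1, since rank 0 would force Θ = 0. So p is locally
a regular curve (`exists_straightening`), and the Lagrangian condition makes each fiber of p move
along the normal of the curve (`exists_normal_coordinates`). In these coordinates Θ = ±iξ² with ξ =
ζ(γ'), and the same angle formula becomes the geodesic equation (`geodesic_of_affine`).

The two alternatives are whether rank 2 occurs arbitrarily near q or not; constancy of the rank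
makes the choice global. -/

noncomputable section

namespace TangentSurface

/-! ### Smoothness of the metric and of the surface in charts -/

section ManifoldFacts

variable {S : Type*} [TopologicalSpace S] [ChartedSpace Plane S] [IsManifold (𝓡 2) ∞ S]

@[simp] lemma planeBasis_apply (i j : Fin 2) : (planeBasis i : Plane) j = if j = i then 1 else 0 := by
  simp [planeBasis]

lemma eq_sum_planeBasis (u : Plane) : u = u 0 • planeBasis 0 + u 1 • planeBasis 1 := by
  ext i; fin_cases i <;> simp

lemma mdifferentiable_of_mem_maximalAtlas {φ : OpenPartialHomeomorph S Plane}
    (hφ : φ ∈ IsManifold.maximalAtlas (𝓡 2) ∞ S) : φ.MDifferentiable (𝓡 2) (𝓡 2) :=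
  ⟨(contMDiffOn_of_mem_maximalAtlas hφ).mdifferentiableOn (by simp),
    (contMDiffOn_symm_of_mem_maximalAtlas hφ).mdifferentiableOn (by simp)⟩

variable (g : SurfaceMetric S) (φ : OpenPartialHomeomorph S Plane)

lemma metricIn_comm (x u v : Plane) : metricIn g φ x u v = metricIn g φ x v u :=
  g.symm _ _ _

lemma metricIn_eq (x u v : Plane) : metricIn g φ x u v =
    u 0 * v 0 * metricIn g φ x (planeBasis 0) (planeBasis 0)
    + (u 0 * v 1 + u 1 * v 0) * metricIn g φ x (planeBasis 0) (planeBasis 1)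
    + u 1 * v 1 * metricIn g φ x (planeBasis 1) (planeBasis 1) := by
  have h10 := metricIn_comm g φ x (planeBasis 1) (planeBasis 0)
  set L : Plane →L[ℝ] _ := mfderiv (𝓡 2) (𝓡 2) φ.symm x
  have hu : L u = u 0 • L (planeBasis 0) + u 1 • L (planeBasis 1) := by
    conv_lhs => rw [eq_sum_planeBasis u, map_add, map_smul, map_smul]
  have hv : L v = v 0 • L (planeBasis 0) + v 1 • L (planeBasis 1) := by
    conv_lhs => rw [eq_sum_planeBasis v, map_add, map_smul, map_smul]
  change g.inner (φ.symm x) (L (planeBasis 1)) (L (planeBasis 0)) =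
    g.inner (φ.symm x) (L (planeBasis 0)) (L (planeBasis 1)) at h10
  change g.inner (φ.symm x) (L u) (L v) =
    u 0 * v 0 * g.inner (φ.symm x) (L (planeBasis 0)) (L (planeBasis 0))
    + (u 0 * v 1 + u 1 * v 0) * g.inner (φ.symm x) (L (planeBasis 0)) (L (planeBasis 1))
    + u 1 * v 1 * g.inner (φ.symm x) (L (planeBasis 1)) (L (planeBasis 1))
  rw [hu, hv]
  simp only [map_add, map_smul, add_apply, smul_apply,
    smul_eq_mul, h10]
  ring

variable {g φ}

lemma metricIn_pos (hφ : φ ∈ IsManifold.maximalAtlas (𝓡 2) ∞ S) {x : Plane} (hx : x ∈ φ.target)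
    {u : Plane} (hu : u ≠ 0) : 0 < metricIn g φ x u u := by
  refine g.pos _ _ fun h => hu ?_
  have h1 := (mdifferentiable_of_mem_maximalAtlas hφ).symm.mfderiv_injective (x := x) (by simpa)
  exact h1 (h.trans (map_zero _).symm)

/-- Brings inner products of vectors given on S into the chart, where the coframe computations take
place. -/
lemma metricIn_mfderiv (hφ : φ ∈ IsManifold.maximalAtlas (𝓡 2) ∞ S) {p : S} (hp : p ∈ φ.source)
    (u v : TangentSpace (𝓡 2) p) :
    metricIn g φ (φ p) (mfderiv (𝓡 2) (𝓡 2) φ p u) (mfderiv (𝓡 2) (𝓡 2) φ p v) =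
      g.inner p u v := by
  have h := (mdifferentiable_of_mem_maximalAtlas hφ).symm_comp_deriv hp
  have hu : ∀ w : TangentSpace (𝓡 2) p,
      mfderiv (𝓡 2) (𝓡 2) φ.symm (φ p) (mfderiv (𝓡 2) (𝓡 2) φ p w) = w :=
    fun w => DFunLike.congr_fun h w
  -- The point φ⁻¹(φ(p)) equals p only propositionally, so the base point and both vectors are
  -- replaced together.
  have key : ∀ p' : S, p' = p → ∀ a b a' b' : Plane, a = a' → b = b' →
      g.inner p' a b = g.inner p a' b' := by rintro _ rfl a b _ _ rfl rfl; rfl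
  exact key _ (φ.left_inv hp) _ _ _ _ (hu u) (hu v)

lemma contDiffOn_metricIn (hφ : φ ∈ IsManifold.maximalAtlas (𝓡 2) ∞ S) (u v : Plane) :
    ContDiffOn ℝ ∞ (fun x => metricIn g φ x u v) φ.target := by
  have hs := contMDiffOn_symm_of_mem_maximalAtlas hφ
  -- Coordinate vector fields are smooth sections: the tangent map of φ⁻¹ applied to constant
  -- fields. The bundle metric is then evaluated on two of them.
  have hsec : ∀ w : Plane, ContMDiffOn (𝓡 2) (𝓡 2).tangent ∞
      (fun x : Plane => (⟨φ.symm x, mfderiv (𝓡 2) (𝓡 2) φ.symm x w⟩ : TangentBundle (𝓡 2) S))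
      φ.target := by
    intro w
    have h1 := hs.contMDiffOn_tangentMapWithin (m := ∞) (by simp) φ.open_target.uniqueMDiffOn
    have h2 : ContMDiffOn (𝓡 2) (𝓡 2).tangent ∞
        (fun x : Plane => (⟨x, w⟩ : TangentBundle (𝓡 2) Plane)) φ.target :=
      contMDiffOn_vectorSpace_iff_contDiffOn.2 contDiffOn_const
    refine (h1.comp h2 fun x hx => hx).congr fun x hx => ?_
    simp [tangentMapWithin, mfderivWithin_of_isOpen φ.open_target hx]
  have h3 := ContMDiffOn.clm_bundle_apply₂ (F₁ := Plane) (F₂ := Plane) (F₃ := ℝ)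
    (E₁ := fun p : S => TangentSpace (𝓡 2) p) (E₂ := fun p : S => TangentSpace (𝓡 2) p)
    (E₃ := Bundle.Trivial S ℝ)
    (g.contMDiff.comp_contMDiffOn hs) (hsec u) (hsec v)
  intro x hx
  have h4 := h3 x hx
  rw [Bundle.contMDiffWithinAt_totalSpace] at h4
  exact h4.2.contDiffWithinAt

variable {M : Type*} [TopologicalSpace M] [ChartedSpace Plane M] [IsManifold (𝓡 2) ∞ M]
  {F : M → TangentBundle (𝓡 2) S} {ψ : OpenPartialHomeomorph M Plane}

lemma contMDiffOn_tangentChart (hφ : φ ∈ IsManifold.maximalAtlas (𝓡 2) ∞ S) :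
    ContMDiffOn (𝓡 2).tangent 𝓘(ℝ, Plane × Plane) ∞ (tangentChart (S := S) φ)
      ((fun z : TangentBundle (𝓡 2) S => z.proj) ⁻¹' φ.source) := by
  have hs := contMDiffOn_of_mem_maximalAtlas hφ
  have h1 := hs.contMDiffOn_tangentMapWithin (m := ∞) (by simp) φ.open_source.uniqueMDiffOn
  have h2 := (contMDiff_snd_tangentBundle_modelSpace (n := ∞) Plane (𝓡 2)).comp_contMDiffOn h1
  have h3 : ContMDiffOn (𝓡 2).tangent (𝓡 2) ∞ (fun z : TangentBundle (𝓡 2) S => φ z.proj)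
      ((fun z : TangentBundle (𝓡 2) S => z.proj) ⁻¹' φ.source) :=
    hs.comp (Bundle.contMDiff_proj _).contMDiffOn fun x hx => hx
  refine (h3.prodMk_space h2).congr fun z hz => ?_
  change _ = (φ z.proj, mfderivWithin (𝓡 2) (𝓡 2) φ φ.source z.proj z.snd)
  rw [mfderivWithin_of_isOpen φ.open_source hz]
  rfl

lemma contDiffAt_localExpr (hF : ContMDiff (𝓡 2) (𝓡 2).tangent ∞ F)
    (hφ : φ ∈ IsManifold.maximalAtlas (𝓡 2) ∞ S) (hψ : ψ ∈ IsManifold.maximalAtlas (𝓡 2) ∞ M)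
    {x : Plane} (hx : x ∈ ψ.target) (hx' : (F (ψ.symm x)).proj ∈ φ.source) :
    ContDiffAt ℝ ∞ (localExpr F ψ φ) x := by
  have h1 : ContMDiffAt (𝓡 2).tangent 𝓘(ℝ, Plane × Plane) ∞ (tangentChart (S := S) φ)
      (F (ψ.symm x)) := (contMDiffOn_tangentChart hφ).contMDiffAt
    ((φ.open_source.preimage (FiberBundle.continuous_proj Plane
      (fun p : S => TangentSpace (𝓡 2) p))).mem_nhds hx')
  have h2 : ContMDiffAt (𝓡 2) (𝓡 2) ∞ ψ.symm x := contMDiffAt_symm_of_mem_maximalAtlas hψ hx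
  exact (h1.comp x (hF.contMDiffAt.comp x h2)).contDiffAt

end ManifoldFacts

/-! ### Levi-Civita connection in a moving coframe -/

section Coframe

variable {V : Type*} [NormedAddCommGroup V] [NormedSpace ℝ V]
  {ι : Type*} [Fintype ι] [DecidableEq ι]
  {W : Type*} [NormedAddCommGroup W] [NormedSpace ℝ W]

/-- The Christoffel symbols are determined by the Koszul formula. -/
lemma christoffel_eq_of_koszul (b : Module.Basis ι ℝ V) {G : V → V → V → ℝ} {x : V}
    (hsum : ∀ (c : ι → ℝ) (v : V), G x (∑ i, c i • b i) v = ∑ i, c i * G x (b i) v)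
    (hsymm : ∀ u v, G x u v = G x v u)
    (hnd : ∀ u, (∀ i, G x u (b i) = 0) → u = 0) {u v C : V}
    (hC : ∀ l, G x C (b l) = (1 / 2 : ℝ) * (fderiv ℝ (fun y => G y v (b l)) x u
      + fderiv ℝ (fun y => G y u (b l)) x v - fderiv ℝ (fun y => G y u v) x (b l))) :
    christoffel b G x u v = C := by
  have hdet : IsUnit (gramMatrix b G x).det := by
    rw [isUnit_iff_ne_zero]
    intro h0
    -- A kernel vector of the Gram matrix would give a vector orthogonal to the whole basis.
    obtain ⟨c, hc0, hc⟩ := Matrix.exists_vecMul_eq_zero_iff.2 h0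
    have hz : ∑ i, c i • b i = 0 := hnd _ fun j => by
      rw [hsum]
      exact congrFun hc j
    exact hc0 (funext fun i => Fintype.linearIndependent_iff.1 b.linearIndependent c hz i)
  have hGC : ∀ l, G x C (b l) = ∑ m, gramMatrix b G x l m * b.repr C m := by
    intro l
    conv_lhs => rw [← b.sum_repr C]
    rw [hsum]
    refine Finset.sum_congr rfl fun m _ => ?_
    rw [mul_comm, hsymm]
    rfl
  have hk : ∀ k, ∑ l, (gramMatrix b G x)⁻¹ k l * G x C (b l) = b.repr C k := by
    intro k
    have h1 : ((gramMatrix b G x)⁻¹ * gramMatrix b G x).mulVec (b.repr C) = b.repr C := by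
      rw [Matrix.nonsing_inv_mul _ hdet, Matrix.one_mulVec]
    rw [← Matrix.mulVec_mulVec] at h1
    have h2 := congrFun h1 k
    rw [← h2]
    simp only [Matrix.mulVec, dotProduct, hGC]
  conv_rhs => rw [← b.sum_repr C]
  unfold christoffel
  refine Finset.sum_congr rfl fun k _ => ?_
  congr 1
  rw [← hk k]
  refine Finset.sum_congr rfl fun l _ => ?_
  rw [hC l]
  ring

/-- The Levi-Civita connection of a metric which is constant in a moving coframe `Z`, in terms of
a torsion-free metric connection matrix `A`. -/
lemma coframe_christoffel (b : Module.Basis ι ℝ V) {G : V → V → V → ℝ} {x : V}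
    {Z : V → V →L[ℝ] W} (hZ : DifferentiableAt ℝ Z x) (B : W →L[ℝ] W →L[ℝ] ℝ)
    (hBsymm : ∀ a a', B a a' = B a' a)
    (hG : ∀ᶠ y in 𝓝 x, ∀ u v, G y u v = B (Z y u) (Z y v))
    (hnd : ∀ a, (∀ a', B a a' = 0) → a = 0)
    (hinj : Function.Injective (Z x)) (hsurj : Function.Surjective (Z x))
    (A : V → W → W) (hskew : ∀ u a a', B (A u a) a' + B a (A u a') = 0)
    (htor : ∀ u v, fderiv ℝ Z x u v + A u (Z x v) = fderiv ℝ Z x v u + A v (Z x u)) (u v : V) :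
    Z x (christoffel b G x u v) = fderiv ℝ Z x u v + A u (Z x v) := by
  have hGx := hG.self_of_nhds
  have hder : ∀ v w u, fderiv ℝ (fun y => G y v w) x u =
      B (fderiv ℝ Z x u v) (Z x w) + B (Z x v) (fderiv ℝ Z x u w) := by
    intro v w u
    have h1 : (fun y => G y v w) =ᶠ[𝓝 x] fun y => B (Z y v) (Z y w) := hG.mono fun y hy => hy v w
    rw [h1.fderiv_eq]
    have hv : HasFDerivAt (fun y => Z y v) ((fderiv ℝ Z x).flip v) x := by
      simpa using hZ.hasFDerivAt.clm_apply (hasFDerivAt_const v x)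
    have hw : HasFDerivAt (fun y => Z y w) ((fderiv ℝ Z x).flip w) x := by
      simpa using hZ.hasFDerivAt.clm_apply (hasFDerivAt_const w x)
    have h2 := (B.hasFDerivAt.comp x hv).clm_apply hw
    have h3 : fderiv ℝ (fun y => B (Z y v) (Z y w)) x = _ := h2.fderiv
    rw [h3]
    simp [add_comm]
  -- Skewness of A allows the plain derivative of the coframe to be replaced by the covariant one
  -- without changing the value.
  have hder' : ∀ v w u, fderiv ℝ (fun y => G y v w) x u =
      B (fderiv ℝ Z x u v + A u (Z x v)) (Z x w)
        + B (fderiv ℝ Z x u w + A u (Z x w)) (Z x v) := by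
    intro v w u
    have := hskew u (Z x v) (Z x w)
    rw [hder, map_add, map_add, add_apply, add_apply,
      hBsymm (fderiv ℝ Z x u w), hBsymm (A u (Z x w))]
    linarith
  obtain ⟨C, hC⟩ := hsurj (fderiv ℝ Z x u v + A u (Z x v))
  rw [← hC]
  congr 1
  apply christoffel_eq_of_koszul
  · intro c w
    simp [hGx, map_sum]
  · intro u v
    rw [hGx, hGx, hBsymm]
  · intro u hu
    have : Z x u = 0 := by
      apply hnd
      intro a'
      obtain ⟨w, rfl⟩ := hsurj a'
      rw [← b.sum_repr w]
      simp only [map_sum, map_smul]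
      refine Finset.sum_eq_zero fun i _ => ?_
      rw [← hGx, hu i, smul_zero]
    exact hinj (this.trans (map_zero _).symm)
  · intro l
    -- Six terms appear; torsion-freeness makes four of them cancel in pairs and identifies the
    -- other two with each other, which accounts for the factor 1/2 in Koszul's formula.
    rw [hder', hder', hder', hGx, hC, htor v u, htor (b l) u, htor (b l) v]
    ring

end Coframe

/-! ### Unitary coframe and connection form of the surface -/

section SurfaceCoframe

variable {S : Type*} [TopologicalSpace S] [ChartedSpace Plane S] [IsManifold (𝓡 2) ∞ S]

/-- A complex-valued unitary coframe of the metric `g` in the chart `φ`. -/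
def coframe (g : SurfaceMetric S) (φ : OpenPartialHomeomorph S Plane) (x : Plane) :
    Plane →L[ℝ] ℂ :=
  (EuclideanSpace.proj (𝕜 := ℝ) (0 : Fin 2)).smulRight
      (((√(metricIn g φ x (planeBasis 0) (planeBasis 0)) : ℝ)) : ℂ)
    + (EuclideanSpace.proj (𝕜 := ℝ) (1 : Fin 2)).smulRight
      (((metricIn g φ x (planeBasis 0) (planeBasis 1)
          / √(metricIn g φ x (planeBasis 0) (planeBasis 0)) : ℝ) : ℂ)
        + ((√(gramMatrix planeBasis (metricIn g φ) x).det
          / √(metricIn g φ x (planeBasis 0) (planeBasis 0)) : ℝ) : ℂ) * Complex.I)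

/-- The connection form of the unitary coframe. -/
def connectionForm (g : SurfaceMetric S) (φ : OpenPartialHomeomorph S Plane) (x : Plane) :
    Plane →L[ℝ] ℝ :=
  ∑ k : Fin 2, ((((fderiv ℝ (coframe g φ) x (planeBasis 0) (planeBasis 1)
      - fderiv ℝ (coframe g φ) x (planeBasis 1) (planeBasis 0)) * Complex.I
      * (starRingEnd ℂ) (coframe g φ x (planeBasis k))).im
      / (coframe g φ x (planeBasis 1) * (starRingEnd ℂ) (coframe g φ x (planeBasis 0))).im) •
    EuclideanSpace.proj (𝕜 := ℝ) k)

variable {g : SurfaceMetric S} {φ : OpenPartialHomeomorph S Plane} {x : Plane}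

lemma det_gramMatrix_metricIn (x : Plane) : (gramMatrix planeBasis (metricIn g φ) x).det =
    metricIn g φ x (planeBasis 0) (planeBasis 0) * metricIn g φ x (planeBasis 1) (planeBasis 1)
      - metricIn g φ x (planeBasis 0) (planeBasis 1) ^ 2 := by
  rw [Matrix.det_fin_two]
  simp only [gramMatrix, Matrix.of_apply]
  rw [metricIn_comm g φ x (planeBasis 1) (planeBasis 0)]
  ring

lemma planeBasis_ne_zero (i : Fin 2) : (planeBasis i : Plane) ≠ 0 := planeBasis.ne_zero i

lemma det_gramMatrix_metricIn_pos (hφ : φ ∈ IsManifold.maximalAtlas (𝓡 2) ∞ S)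
    (hx : x ∈ φ.target) : 0 < (gramMatrix planeBasis (metricIn g φ) x).det := by
  have hE := metricIn_pos (g := g) hφ hx (planeBasis_ne_zero 0)
  have h := metricIn_eq g φ x !₂[-metricIn g φ x (planeBasis 0) (planeBasis 1),
    metricIn g φ x (planeBasis 0) (planeBasis 0)] !₂[-metricIn g φ x (planeBasis 0) (planeBasis 1),
    metricIn g φ x (planeBasis 0) (planeBasis 0)]
  have hpos := metricIn_pos (g := g) hφ hx
    (u := !₂[-metricIn g φ x (planeBasis 0) (planeBasis 1),
      metricIn g φ x (planeBasis 0) (planeBasis 0)])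
    (fun h0 => by simpa [hE.ne'] using congrArg (fun v : Plane => v 1) h0)
  rw [det_gramMatrix_metricIn]
  simp at h
  nlinarith

lemma coframe_apply (v : Plane) : coframe g φ x v =
    ((v 0 * √(metricIn g φ x (planeBasis 0) (planeBasis 0))
      + v 1 * (metricIn g φ x (planeBasis 0) (planeBasis 1)
        / √(metricIn g φ x (planeBasis 0) (planeBasis 0))) : ℝ) : ℂ)
      + ((v 1 * (√(gramMatrix planeBasis (metricIn g φ) x).det
          / √(metricIn g φ x (planeBasis 0) (planeBasis 0))) : ℝ) : ℂ) * Complex.I := by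
  simp [coframe]
  ring

lemma coframe_re (v : Plane) : (coframe g φ x v).re =
    v 0 * √(metricIn g φ x (planeBasis 0) (planeBasis 0))
      + v 1 * (metricIn g φ x (planeBasis 0) (planeBasis 1)
        / √(metricIn g φ x (planeBasis 0) (planeBasis 0))) := by
  rw [coframe_apply]; simp only [Complex.add_re, Complex.re_ofReal_mul, Complex.ofReal_re, Complex.I_re]; ring

lemma coframe_im (v : Plane) : (coframe g φ x v).im =
    v 1 * (√(gramMatrix planeBasis (metricIn g φ) x).det
          / √(metricIn g φ x (planeBasis 0) (planeBasis 0))) := by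
  rw [coframe_apply]; simp only [Complex.add_im, Complex.im_ofReal_mul, Complex.ofReal_im, Complex.I_im]; ring

/-- The coframe is Gram–Schmidt applied to the coordinate basis: ζ(∂₀) = √E is real, and ζ(∂₁) has
real part f/√E and imaginary part √D/√E, where E, f, G are the metric coefficients and D = EG - f².
-/
lemma metricIn_eq_coframe (hφ : φ ∈ IsManifold.maximalAtlas (𝓡 2) ∞ S) (hx : x ∈ φ.target)
    (u v : Plane) : metricIn g φ x u v =
      (coframe g φ x u).re * (coframe g φ x v).re + (coframe g φ x u).im * (coframe g φ x v).im := by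
  have hE := metricIn_pos (g := g) hφ hx (planeBasis_ne_zero 0)
  have hD := det_gramMatrix_metricIn_pos (g := g) hφ hx
  have h1 := Real.sq_sqrt hE.le
  have h2 := Real.sq_sqrt hD.le
  have h3 := det_gramMatrix_metricIn (g := g) (φ := φ) x
  have h4 := Real.sqrt_pos.2 hE
  rw [metricIn_eq, coframe_re, coframe_re, coframe_im, coframe_im]
  set E := metricIn g φ x (planeBasis 0) (planeBasis 0)
  set e := √E
  set D := (gramMatrix planeBasis (metricIn g φ) x).det
  set d := √D
  set f := metricIn g φ x (planeBasis 0) (planeBasis 1)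
  set G := metricIn g φ x (planeBasis 1) (planeBasis 1)
  have h5 : G = (d ^ 2 + f ^ 2) / e ^ 2 := by
    rw [h2, h1, h3, eq_div_iff hE.ne']; ring
  rw [h5, ← h1]
  field_simp
  ring

lemma coframe_eq_zero (hφ : φ ∈ IsManifold.maximalAtlas (𝓡 2) ∞ S) (hx : x ∈ φ.target)
    {u : Plane} (hu : coframe g φ x u = 0) : u = 0 := by
  by_contra h
  have := metricIn_pos (g := g) hφ hx h
  rw [metricIn_eq_coframe hφ hx, hu] at this
  simp at this

lemma coframe_injective (hφ : φ ∈ IsManifold.maximalAtlas (𝓡 2) ∞ S) (hx : x ∈ φ.target) :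
    Function.Injective (coframe g φ x) :=
  (injective_iff_map_eq_zero _).2 fun _ => coframe_eq_zero hφ hx

lemma coframe_surjective (hφ : φ ∈ IsManifold.maximalAtlas (𝓡 2) ∞ S) (hx : x ∈ φ.target) :
    Function.Surjective (coframe g φ x) :=
  (LinearMap.injective_iff_surjective_of_finrank_eq_finrank
    (f := (coframe g φ x).toLinearMap) (by simp)).1 (coframe_injective hφ hx)

/-- The sign of the rotation matches multiplication by +i because Im ζ(∂₁) is positive. -/
lemma coframe_rotationIn (hφ : φ ∈ IsManifold.maximalAtlas (𝓡 2) ∞ S) (hx : x ∈ φ.target)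
    (v : Plane) : coframe g φ x (rotationIn g φ x v) = Complex.I * coframe g φ x v := by
  have hE := metricIn_pos (g := g) hφ hx (planeBasis_ne_zero 0)
  have hD := det_gramMatrix_metricIn_pos (g := g) hφ hx
  have h1 := Real.sq_sqrt hE.le
  have h2 := Real.sq_sqrt hD.le
  have h3 := det_gramMatrix_metricIn (g := g) (φ := φ) x
  have h4 := Real.sqrt_pos.2 hE
  have h4' := Real.sqrt_pos.2 hD
  have hr0 : rotationIn g φ x v 0 = (√(gramMatrix planeBasis (metricIn g φ) x).det)⁻¹ *
      (-metricIn g φ x (planeBasis 0) (planeBasis 1) * v 0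
        - metricIn g φ x (planeBasis 1) (planeBasis 1) * v 1) := rfl
  have hr1 : rotationIn g φ x v 1 = (√(gramMatrix planeBasis (metricIn g φ) x).det)⁻¹ *
      (metricIn g φ x (planeBasis 0) (planeBasis 0) * v 0
        + metricIn g φ x (planeBasis 0) (planeBasis 1) * v 1) := rfl
  apply Complex.ext
  · rw [coframe_re, hr0, hr1, Complex.I_mul_re, coframe_im]
    set E := metricIn g φ x (planeBasis 0) (planeBasis 0)
    set e := √E
    set D := (gramMatrix planeBasis (metricIn g φ) x).det
    set d := √D
    set f := metricIn g φ x (planeBasis 0) (planeBasis 1)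
    set G := metricIn g φ x (planeBasis 1) (planeBasis 1)
    have h5 : G = (d ^ 2 + f ^ 2) / e ^ 2 := by
      rw [h2, h1, h3, eq_div_iff hE.ne']; ring
    rw [h5, ← h1]
    field_simp
    ring
  · rw [coframe_im, hr1, Complex.I_mul_im, coframe_re]
    set E := metricIn g φ x (planeBasis 0) (planeBasis 0)
    set e := √E
    set D := (gramMatrix planeBasis (metricIn g φ) x).det
    set d := √D
    set f := metricIn g φ x (planeBasis 0) (planeBasis 1)
    rw [← h1]
    field_simp

lemma contDiffOn_coframe (hφ : φ ∈ IsManifold.maximalAtlas (𝓡 2) ∞ S) :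
    ContDiffOn ℝ ∞ (coframe g φ) φ.target := by
  have hE : ContDiffOn ℝ ∞ (fun x => √(metricIn g φ x (planeBasis 0) (planeBasis 0))) φ.target :=
    (contDiffOn_metricIn hφ _ _).sqrt fun x hx => (metricIn_pos hφ hx (planeBasis_ne_zero 0)).ne'
  have hE0 : ∀ x ∈ φ.target, √(metricIn g φ x (planeBasis 0) (planeBasis 0)) ≠ 0 := fun x hx =>
    (Real.sqrt_pos.2 (metricIn_pos hφ hx (planeBasis_ne_zero 0))).ne'
  have hF := contDiffOn_metricIn (g := g) hφ (planeBasis 0) (planeBasis 1)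
  have hD : ContDiffOn ℝ ∞ (fun x => √(gramMatrix planeBasis (metricIn g φ) x).det) φ.target := by
    refine ContDiffOn.sqrt ?_ fun x hx => (det_gramMatrix_metricIn_pos hφ hx).ne'
    simp only [det_gramMatrix_metricIn]
    exact ((contDiffOn_metricIn hφ _ _).mul (contDiffOn_metricIn hφ _ _)).sub (hF.pow 2)
  have hof : ∀ {f : Plane → ℝ}, ContDiffOn ℝ ∞ f φ.target →
      ContDiffOn ℝ ∞ (fun x => (f x : ℂ)) φ.target := fun h =>
    Complex.ofRealCLM.contDiff.comp_contDiffOn h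
  unfold coframe
  refine ContDiffOn.add ?_ ?_
  · exact contDiffOn_const.smulRight (hof hE)
  · exact contDiffOn_const.smulRight ((hof (hF.div hE hE0)).add
      ((hof (hD.div hE hE0)).mul contDiffOn_const))

/-- The number in question is the area density √D. It is the denominator in both `connectionForm`
and `structureCurvature`. -/
lemma coframe_area_ne_zero (hφ : φ ∈ IsManifold.maximalAtlas (𝓡 2) ∞ S) (hx : x ∈ φ.target) :
    (coframe g φ x (planeBasis 1)
      * (starRingEnd ℂ) (coframe g φ x (planeBasis 0))).im ≠ 0 := by
  have hE := metricIn_pos (g := g) hφ hx (planeBasis_ne_zero 0)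
  have hD := det_gramMatrix_metricIn_pos (g := g) hφ hx
  have h4 := Real.sqrt_pos.2 hE
  have h4' := Real.sqrt_pos.2 hD
  simp only [Complex.mul_im, Complex.conj_re, Complex.conj_im, coframe_re, coframe_im]
  simp [h4.ne', h4'.ne']

lemma contDiffOn_connectionForm (hφ : φ ∈ IsManifold.maximalAtlas (𝓡 2) ∞ S) :
    ContDiffOn ℝ ∞ (connectionForm g φ) φ.target := by
  have h1 := contDiffOn_coframe (g := g) hφ
  have h2 : ContDiffOn ℝ ∞ (fderiv ℝ (coframe g φ)) φ.target :=
    h1.fderiv_of_isOpen φ.open_target (by simp)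
  have hd : ∀ u v : Plane, ContDiffOn ℝ ∞ (fun x => fderiv ℝ (coframe g φ) x u v) φ.target :=
    fun u v => (h2.clm_apply contDiffOn_const).clm_apply contDiffOn_const
  have hz : ∀ u : Plane, ContDiffOn ℝ ∞ (fun x => coframe g φ x u) φ.target :=
    fun u => h1.clm_apply contDiffOn_const
  have hc : ∀ {f : Plane → ℂ}, ContDiffOn ℝ ∞ f φ.target →
      ContDiffOn ℝ ∞ (fun x => (starRingEnd ℂ) (f x)) φ.target := fun h =>
    Complex.conjCLE.contDiff.comp_contDiffOn h
  have hi : ∀ {f : Plane → ℂ}, ContDiffOn ℝ ∞ f φ.target →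
      ContDiffOn ℝ ∞ (fun x => (f x).im) φ.target := fun h =>
    Complex.imCLM.contDiff.comp_contDiffOn h
  unfold connectionForm
  refine ContDiffOn.sum fun k _ => ContDiffOn.fun_smul ?_ contDiffOn_const
  exact (hi ((((hd _ _).sub (hd _ _)).mul contDiffOn_const).mul (hc (hz _)))).div
    (hi ((hz _).mul (hc (hz _)))) fun x hx => coframe_area_ne_zero hφ hx

/-- The first structure equation. -/
lemma coframe_structure (hφ : φ ∈ IsManifold.maximalAtlas (𝓡 2) ∞ S) (hx : x ∈ φ.target)
    (u v : Plane) :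
    fderiv ℝ (coframe g φ) x u v + Complex.I * connectionForm g φ x u * coframe g φ x v =
      fderiv ℝ (coframe g φ) x v u + Complex.I * connectionForm g φ x v * coframe g φ x u := by
  have ha := coframe_area_ne_zero (g := g) hφ hx
  have hω : ∀ k : Fin 2, connectionForm g φ x (planeBasis k) =
      ((fderiv ℝ (coframe g φ) x (planeBasis 0) (planeBasis 1)
      - fderiv ℝ (coframe g φ) x (planeBasis 1) (planeBasis 0)) * Complex.I
      * (starRingEnd ℂ) (coframe g φ x (planeBasis k))).im
      / (coframe g φ x (planeBasis 1) * (starRingEnd ℂ) (coframe g φ x (planeBasis 0))).im := by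
    intro k
    fin_cases k <;> simp [connectionForm]
  -- One complex equation for the two real unknowns ω(∂₀), ω(∂₁). Multiplying it by the conjugate of
  -- ζ(∂ₖ) and taking imaginary parts isolates ω(∂ₖ), which is how `connectionForm` was defined.
  have key : connectionForm g φ x (planeBasis 0) * coframe g φ x (planeBasis 1)
      - connectionForm g φ x (planeBasis 1) * coframe g φ x (planeBasis 0) =
      (fderiv ℝ (coframe g φ) x (planeBasis 0) (planeBasis 1)
      - fderiv ℝ (coframe g φ) x (planeBasis 1) (planeBasis 0)) * Complex.I := by
    rw [hω, hω]
    generalize (fderiv ℝ (coframe g φ) x (planeBasis 0) (planeBasis 1)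
      - fderiv ℝ (coframe g φ) x (planeBasis 1) (planeBasis 0)) * Complex.I = t
    generalize coframe g φ x (planeBasis 0) = z0 at *
    generalize coframe g φ x (planeBasis 1) = z1 at *
    simp only [Complex.mul_im, Complex.conj_re, Complex.conj_im] at ha ⊢
    set a := z1.re * -z0.im + z1.im * z0.re with ha'
    apply Complex.ext <;> simp only [Complex.sub_re, Complex.sub_im, Complex.re_ofReal_mul,
      Complex.im_ofReal_mul] <;> field_simp <;> rw [ha'] <;> ring
  have hI : Complex.I * Complex.I = -1 := Complex.I_mul_I
  rw [eq_sum_planeBasis u, eq_sum_planeBasis v]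
  simp only [map_add, map_smul, add_apply, smul_apply, smul_eq_mul, Complex.real_smul]
  push_cast
  linear_combination ((u 0 : ℂ) * v 1 - u 1 * v 0) * Complex.I * key + ((u 0 : ℂ) * v 1 - u 1 * v 0) *
    (fderiv ℝ (coframe g φ) x (planeBasis 0) (planeBasis 1)
      - fderiv ℝ (coframe g φ) x (planeBasis 1) (planeBasis 0)) * hI

/-- The Levi-Civita connection of the surface in the unitary coframe. -/
lemma coframe_connectionIn (hφ : φ ∈ IsManifold.maximalAtlas (𝓡 2) ∞ S) (hx : x ∈ φ.target)
    (u v : Plane) : coframe g φ x (connectionIn g φ x u v) =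
      fderiv ℝ (coframe g φ) x u v + Complex.I * connectionForm g φ x u * coframe g φ x v := by
  -- The metric is the Euclidean inner product of ℂ in this coframe, and multiplication by iω is
  -- skew for it.
  refine coframe_christoffel planeBasis (W := ℂ)
    (((contDiffOn_coframe hφ).contDiffAt (φ.open_target.mem_nhds hx)).differentiableAt (by simp))
    (innerSL ℝ) (fun a a' => real_inner_comm a' a) ?_ ?_ (coframe_injective hφ hx)
    (coframe_surjective hφ hx) (fun u z => Complex.I * connectionForm g φ x u * z) ?_
    (fun u v => coframe_structure hφ hx u v) u v
  · filter_upwards [φ.open_target.mem_nhds hx] with y hy u v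
    rw [metricIn_eq_coframe hφ hy, innerSL_apply_apply, Complex.inner]
    simp
    ring
  · intro a ha
    exact inner_self_eq_zero.1 (ha a)
  · intro u a a'
    rw [innerSL_apply_apply, innerSL_apply_apply, Complex.inner, Complex.inner]
    simp
    ring

end SurfaceCoframe

/-! ### Complex coframe, neutral metric and its connection on the tangent bundle -/

section TangentCoframe

variable {S : Type*} [TopologicalSpace S] [ChartedSpace Plane S] [IsManifold (𝓡 2) ∞ S]

/-- The Gauss curvature (up to sign), read off the second structure equation
`dω = K ζ ∧ ζ̄`. -/
def structureCurvature (g : SurfaceMetric S) (φ : OpenPartialHomeomorph S Plane) (x : Plane) : ℝ :=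
  (fderiv ℝ (connectionForm g φ) x (planeBasis 0) (planeBasis 1)
    - fderiv ℝ (connectionForm g φ) x (planeBasis 1) (planeBasis 0))
    / (coframe g φ x (planeBasis 1) * (starRingEnd ℂ) (coframe g φ x (planeBasis 0))).im

/-- The complex coordinate along the fibers of the tangent bundle. -/
def fiberCoordinate (g : SurfaceMetric S) (φ : OpenPartialHomeomorph S Plane)
    (z : Plane × Plane) : ℂ :=
  coframe g φ z.1 z.2

/-- The complex coframe `X ↦ (P X, K X)` of the tangent bundle. -/
def tangentCoframe (g : SurfaceMetric S) (φ : OpenPartialHomeomorph S Plane)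
    (z : Plane × Plane) : Plane × Plane →L[ℝ] ℂ × ℂ :=
  ((coframe g φ z.1).comp (ContinuousLinearMap.fst ℝ Plane Plane)).prod
    (fderiv ℝ (fiberCoordinate g φ) z
      + ((connectionForm g φ z.1).comp (ContinuousLinearMap.fst ℝ Plane Plane)).smulRight
        (Complex.I * fiberCoordinate g φ z))

/-- The hermitian form on `ℂ × ℂ` whose real part is the model symplectic form. -/
def modelForm (a b : ℂ × ℂ) : ℂ := a.2 * (starRingEnd ℂ) b.1 - a.1 * (starRingEnd ℂ) b.2

/-- The connection matrix of the neutral metric in the coframe `tangentCoframe`. -/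
def tangentConnection (g : SurfaceMetric S) (φ : OpenPartialHomeomorph S Plane)
    (z X : Plane × Plane) (a : ℂ × ℂ) : ℂ × ℂ :=
  (Complex.I * connectionForm g φ z.1 X.1 * a.1,
    Complex.I * connectionForm g φ z.1 X.1 * a.2
      - (structureCurvature g φ z.1
        * (coframe g φ z.1 X.1 * (starRingEnd ℂ) (fiberCoordinate g φ z)).re : ℝ) * a.1)

variable {g : SurfaceMetric S} {φ : OpenPartialHomeomorph S Plane} {x : Plane} {z : Plane × Plane}

lemma minSmoothness_two_le_infty : minSmoothness ℝ 2 ≤ (∞ : ℕ∞ω) := by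
  rw [minSmoothness_of_isRCLikeNormedField]
  exact ENat.LEInfty.out

/-- The second structure equation. -/
lemma fderiv_connectionForm_sub (hφ : φ ∈ IsManifold.maximalAtlas (𝓡 2) ∞ S) (hx : x ∈ φ.target)
    (u v : Plane) : fderiv ℝ (connectionForm g φ) x u v - fderiv ℝ (connectionForm g φ) x v u =
      structureCurvature g φ x * (coframe g φ x v * (starRingEnd ℂ) (coframe g φ x u)).im := by
  have ha := coframe_area_ne_zero (g := g) hφ hx
  have h : structureCurvature g φ x *
      (coframe g φ x (planeBasis 1) * (starRingEnd ℂ) (coframe g φ x (planeBasis 0))).im =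
      fderiv ℝ (connectionForm g φ) x (planeBasis 0) (planeBasis 1)
        - fderiv ℝ (connectionForm g φ) x (planeBasis 1) (planeBasis 0) :=
    div_mul_cancel₀ _ ha
  rw [eq_sum_planeBasis u, eq_sum_planeBasis v]
  simp only [map_add, map_smul, add_apply, smul_apply, smul_eq_mul, Complex.mul_im,
    Complex.conj_re, Complex.conj_im, Complex.add_re, Complex.add_im, Complex.real_smul,
    Complex.mul_re, Complex.ofReal_re, Complex.ofReal_im] at h ⊢
  linear_combination -(u 0 * v 1 - u 1 * v 0) * h

lemma contDiffAt_coframe (hφ : φ ∈ IsManifold.maximalAtlas (𝓡 2) ∞ S) (hx : x ∈ φ.target) :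
    ContDiffAt ℝ ∞ (coframe g φ) x :=
  (contDiffOn_coframe hφ).contDiffAt (φ.open_target.mem_nhds hx)

lemma contDiffAt_connectionForm (hφ : φ ∈ IsManifold.maximalAtlas (𝓡 2) ∞ S)
    (hx : x ∈ φ.target) : ContDiffAt ℝ ∞ (connectionForm g φ) x :=
  (contDiffOn_connectionForm hφ).contDiffAt (φ.open_target.mem_nhds hx)

lemma contDiffAt_fiberCoordinate (hφ : φ ∈ IsManifold.maximalAtlas (𝓡 2) ∞ S)
    (hz : z.1 ∈ φ.target) : ContDiffAt ℝ ∞ (fiberCoordinate g φ) z :=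
  ((contDiffAt_coframe hφ hz).comp z contDiffAt_fst).clm_apply contDiffAt_snd

lemma contDiffAt_tangentCoframe (hφ : φ ∈ IsManifold.maximalAtlas (𝓡 2) ∞ S)
    (hz : z.1 ∈ φ.target) : ContDiffAt ℝ ∞ (tangentCoframe g φ) z := by
  have h1 := contDiffAt_fiberCoordinate (g := g) hφ hz
  have h2 : ContDiffAt ℝ ∞ (fderiv ℝ (fiberCoordinate g φ)) z := h1.fderiv_right (by simp)
  have h3 : ContDiffAt ℝ ∞ (fun z : Plane × Plane => coframe g φ z.1) z :=
    (contDiffAt_coframe hφ hz).comp z contDiffAt_fst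
  have h4 : ContDiffAt ℝ ∞ (fun z : Plane × Plane => connectionForm g φ z.1) z :=
    (contDiffAt_connectionForm hφ hz).comp z contDiffAt_fst
  have h5 : tangentCoframe g φ = fun z =>
      (ContinuousLinearMap.inl ℝ ℂ ℂ).comp
        ((coframe g φ z.1).comp (ContinuousLinearMap.fst ℝ Plane Plane))
      + (ContinuousLinearMap.inr ℝ ℂ ℂ).comp (fderiv ℝ (fiberCoordinate g φ) z
      + ((connectionForm g φ z.1).comp (ContinuousLinearMap.fst ℝ Plane Plane)).smulRight
        (Complex.I * fiberCoordinate g φ z)) := by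
    funext z
    refine ContinuousLinearMap.ext fun X => ?_
    simp only [tangentCoframe, ContinuousLinearMap.prod_apply, add_apply,
      ContinuousLinearMap.comp_apply, ContinuousLinearMap.inl_apply, ContinuousLinearMap.inr_apply]
    simp
  rw [h5]
  exact (contDiffAt_const.clm_comp (h3.clm_comp contDiffAt_const)).add
    (contDiffAt_const.clm_comp
      (h2.add ((h4.clm_comp contDiffAt_const).smulRight (contDiffAt_const.mul h1))))

lemma fderiv_fiberCoordinate (hφ : φ ∈ IsManifold.maximalAtlas (𝓡 2) ∞ S)
    (hz : z.1 ∈ φ.target) (X : Plane × Plane) : fderiv ℝ (fiberCoordinate g φ) z X =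
      coframe g φ z.1 X.2 + fderiv ℝ (coframe g φ) z.1 X.1 z.2 := by
  have h1 : HasFDerivAt (fun z : Plane × Plane => coframe g φ z.1) _ z :=
    ((contDiffAt_coframe (g := g) hφ hz).differentiableAt (by simp)).hasFDerivAt.comp z
      hasFDerivAt_fst
  have h2 : HasFDerivAt (fiberCoordinate g φ) _ z := h1.clm_apply hasFDerivAt_snd
  rw [h2.fderiv]
  simp

lemma tangentCoframe_fst (X : Plane × Plane) : (tangentCoframe g φ z X).1 = coframe g φ z.1 X.1 :=
  rfl

lemma tangentCoframe_snd' (X : Plane × Plane) : (tangentCoframe g φ z X).2 =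
    fderiv ℝ (fiberCoordinate g φ) z X
      + Complex.I * connectionForm g φ z.1 X.1 * fiberCoordinate g φ z := by
  simp [tangentCoframe]
  ring

/-- The second component was defined as dη + iωη so that its derivatives are accessible; here it is
identified with ζ(KX) through the formula for ∇ in the coframe. -/
lemma tangentCoframe_snd (hφ : φ ∈ IsManifold.maximalAtlas (𝓡 2) ∞ S) (hz : z.1 ∈ φ.target)
    (X : Plane × Plane) :
    (tangentCoframe g φ z X).2 = coframe g φ z.1 (connectionMap g φ z X) := by
  rw [tangentCoframe_snd', fderiv_fiberCoordinate hφ hz, connectionMap, map_add,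
    coframe_connectionIn hφ hz, fiberCoordinate]
  ring

lemma symplecticForm_eq (hφ : φ ∈ IsManifold.maximalAtlas (𝓡 2) ∞ S) (hz : z.1 ∈ φ.target)
    (X Y : Plane × Plane) : symplecticForm g φ z X Y =
      (modelForm (tangentCoframe g φ z X) (tangentCoframe g φ z Y)).re := by
  simp only [symplecticForm, modelForm, tangentCoframe_snd hφ hz, tangentCoframe_fst,
    metricIn_eq_coframe hφ hz, Complex.sub_re, Complex.mul_re, Complex.conj_re, Complex.conj_im]
  ring

lemma tangentCoframe_complexStructure (hφ : φ ∈ IsManifold.maximalAtlas (𝓡 2) ∞ S)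
    (hz : z.1 ∈ φ.target) (X : Plane × Plane) :
    tangentCoframe g φ z (complexStructure g φ z X) = Complex.I • tangentCoframe g φ z X := by
  refine Prod.ext ?_ ?_
  · exact coframe_rotationIn hφ hz _
  · rw [Prod.smul_snd, tangentCoframe_snd hφ hz, tangentCoframe_snd hφ hz, smul_eq_mul,
      ← coframe_rotationIn hφ hz]
    congr 1
    simp [connectionMap, complexStructure]

/-- 𝕁 acts as multiplication by i on the coframe and the model form is complex linear in its first
slot, so Re becomes -Im. -/
lemma neutralMetric_eq (hφ : φ ∈ IsManifold.maximalAtlas (𝓡 2) ∞ S) (hz : z.1 ∈ φ.target)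
    (X Y : Plane × Plane) : neutralMetric g φ z X Y =
      -(modelForm (tangentCoframe g φ z X) (tangentCoframe g φ z Y)).im := by
  rw [neutralMetric, symplecticForm_eq hφ hz, tangentCoframe_complexStructure hφ hz]
  simp [modelForm]
  ring

lemma tangentCoframe_injective (hφ : φ ∈ IsManifold.maximalAtlas (𝓡 2) ∞ S)
    (hz : z.1 ∈ φ.target) : Function.Injective (tangentCoframe g φ z) := by
  refine (injective_iff_map_eq_zero _).2 fun X hX => ?_
  have h1 : X.1 = 0 := coframe_eq_zero hφ hz (congrArg Prod.fst hX)
  have h2 : (tangentCoframe g φ z X).2 = 0 := congrArg Prod.snd hX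
  rw [tangentCoframe_snd', fderiv_fiberCoordinate hφ hz, h1] at h2
  simp at h2
  exact Prod.ext h1 (coframe_eq_zero hφ hz h2)

lemma tangentCoframe_surjective (hφ : φ ∈ IsManifold.maximalAtlas (𝓡 2) ∞ S)
    (hz : z.1 ∈ φ.target) : Function.Surjective (tangentCoframe g φ z) :=
  (LinearMap.injective_iff_surjective_of_finrank_eq_finrank
    (f := (tangentCoframe g φ z).toLinearMap) (by simp)).1 (tangentCoframe_injective hφ hz)

lemma fderiv_tangentCoframe (hφ : φ ∈ IsManifold.maximalAtlas (𝓡 2) ∞ S)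
    (hz : z.1 ∈ φ.target) (X Y : Plane × Plane) : fderiv ℝ (tangentCoframe g φ) z X Y =
      (fderiv ℝ (coframe g φ) z.1 X.1 Y.1,
        fderiv ℝ (fderiv ℝ (fiberCoordinate g φ)) z X Y
          + Complex.I * fderiv ℝ (connectionForm g φ) z.1 X.1 Y.1 * fiberCoordinate g φ z
          + Complex.I * connectionForm g φ z.1 Y.1 * fderiv ℝ (fiberCoordinate g φ) z X) := by
  have h1 : HasFDerivAt (fun z : Plane × Plane => coframe g φ z.1) _ z :=
    ((contDiffAt_coframe (g := g) hφ hz).differentiableAt (by simp)).hasFDerivAt.comp z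
      hasFDerivAt_fst
  have h2 : HasFDerivAt (fun z : Plane × Plane => connectionForm g φ z.1) _ z :=
    ((contDiffAt_connectionForm (g := g) hφ hz).differentiableAt (by simp)).hasFDerivAt.comp z
      hasFDerivAt_fst
  have hη := contDiffAt_fiberCoordinate (g := g) hφ hz
  have h3 := (hη.differentiableAt (by simp)).hasFDerivAt
  have h4 := ((hη.fderiv_right (m := ∞) (by simp)).differentiableAt (by simp)).hasFDerivAt
  have h5 := ((contDiffAt_tangentCoframe (g := g) hφ hz).differentiableAt (by simp)).hasFDerivAt
  have h6 := h5.clm_apply (hasFDerivAt_const Y z)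
  have h7 := (h1.clm_apply (hasFDerivAt_const Y.1 z)).prodMk
    ((h4.clm_apply (hasFDerivAt_const Y z)).add
      ((h2.clm_apply (hasFDerivAt_const Y.1 z)).smul (h3.const_mul Complex.I)))
  have h8 := DFunLike.congr_fun (h6.unique h7) X
  simp only [ContinuousLinearMap.prod_apply] at h8
  simp at h8
  rw [h8]
  ext1 <;> simp
  ring

/-- The bilinear form on `ℂ × ℂ` which models the neutral metric. -/
def modelMetric : ℂ × ℂ →L[ℝ] ℂ × ℂ →L[ℝ] ℝ :=
  ((innerSL ℝ).bilinearComp (ContinuousLinearMap.fst ℝ ℂ ℂ)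
      ((Complex.I • (1 : ℂ →L[ℝ] ℂ)).comp (ContinuousLinearMap.snd ℝ ℂ ℂ)))
    + ((innerSL ℝ).bilinearComp ((Complex.I • (1 : ℂ →L[ℝ] ℂ)).comp (ContinuousLinearMap.snd ℝ ℂ ℂ))
      (ContinuousLinearMap.fst ℝ ℂ ℂ))

lemma modelMetric_apply (a b : ℂ × ℂ) : modelMetric a b = -(modelForm a b).im := by
  simp only [modelMetric, add_apply, ContinuousLinearMap.bilinearComp_apply, innerSL_apply_apply,
    Complex.inner, modelForm]
  simp
  ring

/-- The first component is the first structure equation. In the second, antisymmetrizing leaves iη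
dω(X, Y), and the curvature entry of `tangentConnection` is exactly what cancels it. -/
lemma tangentCoframe_torsion (hφ : φ ∈ IsManifold.maximalAtlas (𝓡 2) ∞ S)
    (hz : z.1 ∈ φ.target) (X Y : Plane × Plane) :
    fderiv ℝ (tangentCoframe g φ) z X Y + tangentConnection g φ z X (tangentCoframe g φ z Y) =
      fderiv ℝ (tangentCoframe g φ) z Y X
        + tangentConnection g φ z Y (tangentCoframe g φ z X) := by
  have hs : fderiv ℝ (fderiv ℝ (fiberCoordinate g φ)) z X Y =
      fderiv ℝ (fderiv ℝ (fiberCoordinate g φ)) z Y X :=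
    (contDiffAt_fiberCoordinate hφ hz).isSymmSndFDerivAt minSmoothness_two_le_infty X Y
  have h1 := coframe_structure (g := g) hφ hz X.1 Y.1
  have h2 := fderiv_connectionForm_sub (g := g) hφ hz X.1 Y.1
  rw [fderiv_tangentCoframe hφ hz, fderiv_tangentCoframe hφ hz]
  refine Prod.ext h1 ?_
  simp only [tangentConnection, Prod.snd_add, tangentCoframe_snd', tangentCoframe_fst, hs]
  have h3 : (((fderiv ℝ (connectionForm g φ) z.1 X.1 Y.1 : ℝ) : ℂ)
      - (fderiv ℝ (connectionForm g φ) z.1 Y.1 X.1 : ℝ)) =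
      (structureCurvature g φ z.1 *
        (coframe g φ z.1 Y.1 * (starRingEnd ℂ) (coframe g φ z.1 X.1)).im : ℝ) := by
    rw [← h2]; push_cast; ring
  generalize ((fderiv ℝ (connectionForm g φ) z.1 X.1 Y.1 : ℝ) : ℂ) = w1 at *
  generalize ((fderiv ℝ (connectionForm g φ) z.1 Y.1 X.1 : ℝ) : ℂ) = w2 at *
  generalize coframe g φ z.1 X.1 = ζ1 at *
  generalize coframe g φ z.1 Y.1 = ζ2 at *
  generalize fiberCoordinate g φ z = η at *
  have h4 : Complex.I * (ζ2 * (starRingEnd ℂ) ζ1).im * η =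
      (ζ1 * (starRingEnd ℂ) η).re * ζ2 - (ζ2 * (starRingEnd ℂ) η).re * ζ1 := by
    apply Complex.ext <;> simp <;> ring
  push_cast at h3 ⊢
  linear_combination Complex.I * η * h3 + (structureCurvature g φ z.1 : ℂ) * h4

/-- The Levi-Civita connection of the neutral metric in the coframe `tangentCoframe`. -/
lemma tangentCoframe_christoffel (hφ : φ ∈ IsManifold.maximalAtlas (𝓡 2) ∞ S)
    (hz : z.1 ∈ φ.target) (X Y : Plane × Plane) :
    tangentCoframe g φ z (christoffel planeProdBasis (neutralMetric g φ) z X Y) =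
      fderiv ℝ (tangentCoframe g φ) z X Y
        + tangentConnection g φ z X (tangentCoframe g φ z Y) := by
  refine coframe_christoffel planeProdBasis
    ((contDiffAt_tangentCoframe hφ hz).differentiableAt (by simp)) modelMetric ?_ ?_ ?_
    (tangentCoframe_injective hφ hz) (tangentCoframe_surjective hφ hz) _ ?_ ?_ X Y
  · intro a a'
    simp [modelMetric_apply, modelForm]
    ring
  · filter_upwards [(φ.open_target.preimage continuous_fst).mem_nhds hz] with y hy u v
    rw [neutralMetric_eq hφ hy, modelMetric_apply]
  · intro a ha
    -- Up to sign, these two test vectors pair with a to |a.1|² and |a.2|².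
    have h1 := ha (0, a.1 * Complex.I)
    have h2 := ha (a.2 * Complex.I, 0)
    simp [modelMetric_apply, modelForm] at h1 h2
    refine Prod.ext (Complex.ext ?_ ?_) (Complex.ext ?_ ?_) <;> simp <;> nlinarith
  -- Skewness uses that the diagonal entries are equal and imaginary and that the off-diagonal entry
  -- is real.
  · intro u a a'
    simp [modelMetric_apply, modelForm, tangentConnection]
    ring
  · exact fun X Y => tangentCoframe_torsion hφ hz X Y

lemma coframe_isInvertible (hφ : φ ∈ IsManifold.maximalAtlas (𝓡 2) ∞ S) (hx : x ∈ φ.target) :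
    (coframe g φ x).IsInvertible :=
  ⟨(LinearEquiv.ofBijective (coframe g φ x).toLinearMap
    ⟨coframe_injective hφ hx, coframe_surjective hφ hx⟩).toContinuousLinearEquiv, by ext; rfl⟩

lemma contDiffAt_coframe_inverse (hφ : φ ∈ IsManifold.maximalAtlas (𝓡 2) ∞ S)
    (hx : x ∈ φ.target) : ContDiffAt ℝ ∞ (fun y => (coframe g φ y).inverse) x := by
  obtain ⟨e, he⟩ := coframe_isInvertible (g := g) hφ hx
  have h := contDiffAt_map_inverse (𝕜 := ℝ) (n := ∞) e
  rw [he] at h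
  exact h.comp x (contDiffAt_coframe hφ hx)

/-- The curvature tensor of the surface in the unitary coframe. -/
lemma coframe_curvatureTensor (hφ : φ ∈ IsManifold.maximalAtlas (𝓡 2) ∞ S) (hx : x ∈ φ.target)
    (u v w : Plane) : coframe g φ x (curvatureTensor planeBasis (metricIn g φ) x u v w) =
      Complex.I * (structureCurvature g φ x
        * (coframe g φ x v * (starRingEnd ℂ) (coframe g φ x u)).im : ℝ) * coframe g φ x w := by
  have hζ := contDiffAt_coframe (g := g) hφ hx
  have hω := contDiffAt_connectionForm (g := g) hφ hx
  have h1 := (hζ.differentiableAt (by simp)).hasFDerivAt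
  have h2 := (hω.differentiableAt (by simp)).hasFDerivAt
  have h3 := ((hζ.fderiv_right (m := ∞) (by simp)).differentiableAt (by simp)).hasFDerivAt
  have hU := φ.open_target.mem_nhds hx
  -- Differentiability of the Christoffel symbols is obtained from their coframe expression by
  -- inverting the coframe, without differentiating the inverse Gram matrix.
  have hΓd : ∀ v w : Plane, DifferentiableAt ℝ (fun y => connectionIn g φ y v w) x := by
    intro v w
    have e1 : ContDiffAt ℝ ∞ (fun y => (coframe g φ y).inverse (fderiv ℝ (coframe g φ) y v w
        + connectionForm g φ y v • (Complex.I * coframe g φ y w))) x := by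
      refine (contDiffAt_coframe_inverse hφ hx).clm_apply ?_
      exact (((hζ.fderiv_right (m := ∞) (by simp)).clm_apply contDiffAt_const).clm_apply
        contDiffAt_const).add ((hω.clm_apply contDiffAt_const).smul
          (contDiffAt_const.mul (hζ.clm_apply contDiffAt_const)))
    refine (e1.differentiableAt (by simp)).congr_of_eventuallyEq ?_
    filter_upwards [hU] with y hy
    apply coframe_injective hφ hy
    rw [(coframe_isInvertible hφ hy).self_apply_inverse, coframe_connectionIn hφ hy]
    simp
    ring
  -- The derivative of ζ(Γ(v, w)) = ∂ᵥζ(w) + iω(v)ζ(w) in the direction u. After antisymmetrizing in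
  -- u and v the second derivatives cancel, as do the terms quadratic in ω, since rotations of the
  -- plane commute; only i dω(u, v)ζ(w) remains.
  have hmain : ∀ u v w : Plane,
      coframe g φ x (fderiv ℝ (fun y => connectionIn g φ y v w) x u)
        + fderiv ℝ (coframe g φ) x u (connectionIn g φ x v w) =
      fderiv ℝ (fderiv ℝ (coframe g φ)) x u v w
        + Complex.I * fderiv ℝ (connectionForm g φ) x u v * coframe g φ x w
        + Complex.I * connectionForm g φ x v * fderiv ℝ (coframe g φ) x u w := by
    intro u v w
    have e1 := h1.clm_apply (hΓd v w).hasFDerivAt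
    have e2 := ((h3.clm_apply (hasFDerivAt_const v x)).clm_apply (hasFDerivAt_const w x)).add
      ((h2.clm_apply (hasFDerivAt_const v x)).smul
        ((h1.clm_apply (hasFDerivAt_const w x)).const_mul Complex.I))
    have e3 := e2.congr_of_eventuallyEq
      (f₁ := fun y => coframe g φ y (connectionIn g φ y v w)) (by
        filter_upwards [hU] with y hy
        rw [coframe_connectionIn hφ hy]
        simp
        ring)
    have e4 := DFunLike.congr_fun (e1.unique e3) u
    simp at e4
    linear_combination e4
  have hs : fderiv ℝ (fderiv ℝ (coframe g φ)) x u v = fderiv ℝ (fderiv ℝ (coframe g φ)) x v u :=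
    hζ.isSymmSndFDerivAt minSmoothness_two_le_infty u v
  have hm1 := hmain u v w
  have hm2 := hmain v u w
  have h6 := fderiv_connectionForm_sub (g := g) hφ hx u v
  rw [← h6]
  change coframe g φ x (fderiv ℝ (fun y => connectionIn g φ y v w) x u
    - fderiv ℝ (fun y => connectionIn g φ y u w) x v
    + connectionIn g φ x u (connectionIn g φ x v w)
    - connectionIn g φ x v (connectionIn g φ x u w)) = _
  simp only [map_add, map_sub, coframe_connectionIn hφ hx]
  rw [hs] at hm1
  push_cast
  linear_combination hm1 - hm2

end TangentCoframe

/-! ### Testing the mean curvature against conormal forms -/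

section MeanCurvature

variable {V : Type*} [NormedAddCommGroup V] [NormedSpace ℝ V]
  {ι : Type*} [Fintype ι] [DecidableEq ι]

/-- A linear form which vanishes on the tangent plane of a minimal surface has vanishing trace on
the covariant Hessian. -/
lemma sum_covariantHessian_eq_zero {b : Module.Basis ι ℝ V} {G : V → V → V → ℝ} {f : Plane → V}
    {x : Plane} (hH : meanCurvature b G f x = 0) (ℓ : V →ₗ[ℝ] ℝ)
    (hℓ : ∀ u, ℓ (fderiv ℝ f x u) = 0) :
    ∑ i, ∑ j, (gramMatrix planeBasis (inducedMetric G f) x)⁻¹ i j *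
      ℓ (covariantHessian b G f x (planeBasis i) (planeBasis j)) = 0 := by
  have h1 : ∀ W, ℓ (normalPart G f x W) = ℓ W := by
    intro W
    simp [normalPart, hℓ]
  have h2 := congrArg ℓ hH
  rw [meanCurvature, map_smul, map_sum, map_zero] at h2
  simp only [map_sum, map_smul, secondFundamentalForm, h1, smul_eq_mul] at h2
  linarith

end MeanCurvature

/-! ### The Lagrangian angle of a minimal Lagrangian surface -/

section Angle

variable {S : Type*} [TopologicalSpace S] [ChartedSpace Plane S] [IsManifold (𝓡 2) ∞ S]

/-- In the chart of the tangent bundle induced by `φ`, the parametrized surface `f` is smooth,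
Lagrangian, non-null and minimal at `x`. -/
structure IsMinimalLagrangianAt (g : SurfaceMetric S) (φ : OpenPartialHomeomorph S Plane)
    (f : Plane → Plane × Plane) (x : Plane) : Prop where
  smooth : ContDiffAt ℝ ∞ f x
  mem_target : (f x).1 ∈ φ.target
  lagrangian : ∀ u v, symplecticForm g φ (f x) (fderiv ℝ f x u) (fderiv ℝ f x v) = 0
  nonNull : ∀ u, (∀ v, inducedMetric (neutralMetric g φ) f x u v = 0) → u = 0
  minimal : meanCurvature planeProdBasis (neutralMetric g φ) f x = 0

/-- The partial derivatives of a parametrized surface, in the coframe `tangentCoframe`. -/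
def frameDeriv (g : SurfaceMetric S) (φ : OpenPartialHomeomorph S Plane)
    (f : Plane → Plane × Plane) (v y : Plane) : ℂ × ℂ :=
  tangentCoframe g φ (f y) (fderiv ℝ f y v)

/-- The complex area form of `ℂ × ℂ`. -/
def complexArea (a b : ℂ × ℂ) : ℂ := a.1 * b.2 - a.2 * b.1

/-- The complex area of a parametrized surface, whose argument is the Lagrangian angle. -/
def surfaceArea (g : SurfaceMetric S) (φ : OpenPartialHomeomorph S Plane)
    (f : Plane → Plane × Plane) (y : Plane) : ℂ :=
  complexArea (frameDeriv g φ f (planeBasis 0) y) (frameDeriv g φ f (planeBasis 1) y)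

variable {g : SurfaceMetric S} {φ : OpenPartialHomeomorph S Plane} {f : Plane → Plane × Plane}
  {x : Plane}

lemma contDiffAt_frameDeriv (hφ : φ ∈ IsManifold.maximalAtlas (𝓡 2) ∞ S)
    (hf : ContDiffAt ℝ ∞ f x) (hx : (f x).1 ∈ φ.target) (v : Plane) :
    ContDiffAt ℝ ∞ (frameDeriv g φ f v) x :=
  ((contDiffAt_tangentCoframe hφ hx).comp x hf).clm_apply
    ((hf.fderiv_right (m := ∞) (by simp)).clm_apply contDiffAt_const)

lemma contDiffAt_surfaceArea (hφ : φ ∈ IsManifold.maximalAtlas (𝓡 2) ∞ S)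
    (hf : ContDiffAt ℝ ∞ f x) (hx : (f x).1 ∈ φ.target) :
    ContDiffAt ℝ ∞ (surfaceArea g φ f) x := by
  have h := fun v => contDiffAt_frameDeriv (g := g) hφ hf hx v
  exact ((h _).fst.mul (h _).snd).sub ((h _).snd.mul (h _).fst)

/-- The product rule applied to Z(f(y))(df(v)): differentiating Z gives precisely the derivative
term of `tangentCoframe_christoffel`. -/
lemma tangentCoframe_covariantHessian (hφ : φ ∈ IsManifold.maximalAtlas (𝓡 2) ∞ S)
    (hf : ContDiffAt ℝ ∞ f x) (hx : (f x).1 ∈ φ.target) (u v : Plane) :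
    tangentCoframe g φ (f x) (covariantHessian planeProdBasis (neutralMetric g φ) f x u v) =
      fderiv ℝ (frameDeriv g φ f v) x u
        + tangentConnection g φ (f x) (fderiv ℝ f x u) (frameDeriv g φ f v x) := by
  have h1 := ((contDiffAt_tangentCoframe (g := g) hφ hx).differentiableAt (by simp)).hasFDerivAt
  have h2 := (hf.differentiableAt (by simp)).hasFDerivAt
  have h3 := ((hf.fderiv_right (m := ∞) (by simp)).differentiableAt (by simp)).hasFDerivAt
  have h4 := h3.clm_apply (hasFDerivAt_const v x)
  have h4' := h4.differentiableAt.hasFDerivAt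
  have h5 := (h1.comp x h2).clm_apply h4'
  have h6 : fderiv ℝ (frameDeriv g φ f v) x = _ := h5.fderiv
  rw [h6, covariantHessian, map_add, tangentCoframe_christoffel hφ hx, frameDeriv]
  simp only [add_apply, ContinuousLinearMap.comp_apply, ContinuousLinearMap.flip_apply,
    Function.comp_apply]
  abel

lemma covariantHessian_comm (hφ : φ ∈ IsManifold.maximalAtlas (𝓡 2) ∞ S)
    (hf : ContDiffAt ℝ ∞ f x) (hx : (f x).1 ∈ φ.target) (u v : Plane) :
    covariantHessian planeProdBasis (neutralMetric g φ) f x u v =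
      covariantHessian planeProdBasis (neutralMetric g φ) f x v u := by
  have h3 := ((hf.fderiv_right (m := ∞) (by simp)).differentiableAt (by simp)).hasFDerivAt
  have h4 : ∀ u v, fderiv ℝ (fun y => fderiv ℝ f y v) x u = fderiv ℝ (fderiv ℝ f) x u v := by
    intro u v
    rw [(h3.clm_apply (hasFDerivAt_const v x)).fderiv]
    simp
  rw [covariantHessian, covariantHessian, h4, h4,
    hf.isSymmSndFDerivAt minSmoothness_two_le_infty u v]
  congr 1
  apply tangentCoframe_injective (g := g) hφ hx
  rw [tangentCoframe_christoffel hφ hx, tangentCoframe_christoffel hφ hx,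
    tangentCoframe_torsion hφ hx]

lemma modelForm_re_comm (a b : ℂ × ℂ) : (modelForm a b).re = -(modelForm b a).re := by
  simp [modelForm]; ring

lemma modelForm_im_comm (a b : ℂ × ℂ) : (modelForm a b).im = (modelForm b a).im := by
  simp [modelForm]; ring

lemma modelForm_tangentConnection (z X : Plane × Plane) (a b : ℂ × ℂ) :
    (modelForm (tangentConnection g φ z X a) b).re
      + (modelForm a (tangentConnection g φ z X b)).re = 0 := by
  simp [modelForm, tangentConnection]
  ring

/-- On the complex determinant a matrix acts by its trace. The curvature entry lies below the
diagonal and drops out, so only the base form ω survives. -/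
lemma complexArea_tangentConnection (z X : Plane × Plane) (a b : ℂ × ℂ) :
    complexArea (tangentConnection g φ z X a) b + complexArea a (tangentConnection g φ z X b) =
      2 * Complex.I * connectionForm g φ z.1 X.1 * complexArea a b := by
  simp [complexArea, tangentConnection]
  ring

lemma IsMinimalLagrangianAt.re_modelForm (hφ : φ ∈ IsManifold.maximalAtlas (𝓡 2) ∞ S)
    (h : IsMinimalLagrangianAt g φ f x) (u v : Plane) :
    (modelForm (frameDeriv g φ f u x) (frameDeriv g φ f v x)).re = 0 := by
  rw [← h.lagrangian u v, symplecticForm_eq hφ h.mem_target]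
  rfl

lemma inducedMetric_eq (hφ : φ ∈ IsManifold.maximalAtlas (𝓡 2) ∞ S) (hx : (f x).1 ∈ φ.target)
    (u v : Plane) : inducedMetric (neutralMetric g φ) f x u v =
      -(modelForm (frameDeriv g φ f u x) (frameDeriv g φ f v x)).im :=
  neutralMetric_eq hφ hx _ _

lemma frameDeriv_eq (v : Plane) : frameDeriv g φ f v x =
    v 0 • frameDeriv g φ f (planeBasis 0) x + v 1 • frameDeriv g φ f (planeBasis 1) x := by
  unfold frameDeriv
  conv_lhs => rw [eq_sum_planeBasis v]
  simp only [map_add, map_smul]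

lemma modelForm_add_left (a a' b : ℂ × ℂ) :
    modelForm (a + a') b = modelForm a b + modelForm a' b := by
  simp [modelForm]; ring

lemma modelForm_smul_left (r : ℝ) (a b : ℂ × ℂ) :
    modelForm (r • a) b = r * modelForm a b := by
  simp [modelForm]; ring

/-- The determinant of the induced metric of a Lagrangian surface. -/
lemma det_induced_eq {a b : ℂ × ℂ} (h : (modelForm a b).re = 0) :
    (modelForm a a).im * (modelForm b b).im - (modelForm a b).im * (modelForm a b).im =
      -Complex.normSq (complexArea a b) := by
  simp [modelForm, complexArea, Complex.normSq_apply] at h ⊢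
  linear_combination (a.2.re * b.1.re + a.2.im * b.1.im - (a.1.re * b.2.re + a.1.im * b.2.im)) * h

/-- On a Lagrangian plane -|Θ|² is the determinant of the induced metric, so Θ = 0 would contradict
non-nullness. -/
lemma IsMinimalLagrangianAt.surfaceArea_ne_zero (hφ : φ ∈ IsManifold.maximalAtlas (𝓡 2) ∞ S)
    (h : IsMinimalLagrangianAt g φ f x) : surfaceArea g φ f x ≠ 0 := by
  intro h0
  have hr := h.re_modelForm hφ (planeBasis 0) (planeBasis 1)
  have hd := det_induced_eq hr
  rw [surfaceArea] at h0
  rw [h0, Complex.normSq_zero, neg_zero] at hd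
  set Z0 := frameDeriv g φ f (planeBasis 0) x
  set Z1 := frameDeriv g φ f (planeBasis 1) x
  have hc := modelForm_im_comm Z1 Z0
  have hind : ∀ u v : Plane, inducedMetric (neutralMetric g φ) f x u v =
      -(u 0 * v 0 * (modelForm Z0 Z0).im + (u 0 * v 1 + u 1 * v 0) * (modelForm Z0 Z1).im
        + u 1 * v 1 * (modelForm Z1 Z1).im) := by
    intro u v
    rw [inducedMetric_eq hφ h.mem_target, frameDeriv_eq u, frameDeriv_eq v, modelForm_add_left,
      modelForm_smul_left, modelForm_smul_left, Complex.add_im, Complex.im_ofReal_mul,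
      Complex.im_ofReal_mul, modelForm_im_comm Z0, modelForm_im_comm Z1, modelForm_add_left,
      modelForm_smul_left, modelForm_smul_left, modelForm_add_left,
      modelForm_smul_left, modelForm_smul_left, Complex.add_im, Complex.im_ofReal_mul,
      Complex.im_ofReal_mul, Complex.add_im, Complex.im_ofReal_mul, Complex.im_ofReal_mul, hc]
    ring
  -- The two vectors are columns of the adjugate of the degenerate Gram matrix up to sign, hence
  -- null directions. Their vanishing kills two coefficients of the metric, which makes ∂₀ itself a
  -- null direction.
  have h1 := h.nonNull !₂[-(modelForm Z0 Z1).im, (modelForm Z0 Z0).im] fun v => by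
    rw [hind]
    simp
    linear_combination v 1 * (-hd)
  have h2 := h.nonNull !₂[-(modelForm Z1 Z1).im, (modelForm Z0 Z1).im] fun v => by
    rw [hind]
    simp
    linear_combination v 0 * hd
  have e1 : (modelForm Z0 Z1).im = 0 := by simpa using congrArg (fun v : Plane => v 1) h2
  have e2 : (modelForm Z0 Z0).im = 0 := by simpa using congrArg (fun v : Plane => v 1) h1
  refine planeBasis_ne_zero 0 (h.nonNull (planeBasis 0) fun v => ?_)
  rw [hind, e1, e2]
  simp

/-- The algebraic identity relating the trace of the second fundamental form of a Lagrangian plane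
to the variation of its complex area. -/
lemma im_complexArea_eq_zero {a b m n : ℂ × ℂ} (h : (modelForm a b).re = 0)
    (htr : (modelForm b b).im * (modelForm m a).re - (modelForm a b).im * (modelForm m b).re
      - (modelForm a b).im * (modelForm n a).re + (modelForm a a).im * (modelForm n b).re = 0) :
    ((complexArea m b + complexArea a n) * (starRingEnd ℂ) (complexArea a b)).im = 0 := by
  -- For arbitrary vectors the two sides differ only by a multiple of Re h(a, b), where h is
  -- `modelForm`.
  have key : (modelForm b b).im * (modelForm m a).re - (modelForm a b).im * (modelForm m b).re
      - (modelForm a b).im * (modelForm n a).re + (modelForm a a).im * (modelForm n b).re =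
      ((complexArea m b + complexArea a n) * (starRingEnd ℂ) (complexArea a b)).im
      - (modelForm a b).re * ((modelForm m b).im - (modelForm n a).im) := by
    simp [modelForm, complexArea]
    ring
  rw [key, h] at htr
  linarith

lemma hasFDerivAt_modelForm_re {p q : Plane → ℂ × ℂ} (hp : DifferentiableAt ℝ p x)
    (hq : DifferentiableAt ℝ q x) (u : Plane) :
    fderiv ℝ (fun y => (modelForm (p y) (q y)).re) x u =
      (modelForm (fderiv ℝ p x u) (q x)).re + (modelForm (p x) (fderiv ℝ q x u)).re := by
  have hp1 := hp.hasFDerivAt.fst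
  have hp2 := hp.hasFDerivAt.snd
  have hq1 : HasFDerivAt (fun y => (starRingEnd ℂ) (q y).1) _ x :=
    Complex.conjCLE.toContinuousLinearMap.hasFDerivAt.comp x hq.hasFDerivAt.fst
  have hq2 : HasFDerivAt (fun y => (starRingEnd ℂ) (q y).2) _ x :=
    Complex.conjCLE.toContinuousLinearMap.hasFDerivAt.comp x hq.hasFDerivAt.snd
  have h : HasFDerivAt (fun y => (modelForm (p y) (q y)).re) _ x :=
    Complex.reCLM.hasFDerivAt.comp x ((hp2.mul hq1).sub (hp1.mul hq2))
  rw [h.fderiv]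
  simp [modelForm]
  ring

/-- The second fundamental form of a Lagrangian surface is totally symmetric. -/
lemma modelForm_covariantHessian_comm (hφ : φ ∈ IsManifold.maximalAtlas (𝓡 2) ∞ S)
    (h : ∀ᶠ y in 𝓝 x, IsMinimalLagrangianAt g φ f y) (u v w : Plane) :
    (modelForm (tangentCoframe g φ (f x)
        (covariantHessian planeProdBasis (neutralMetric g φ) f x u v)) (frameDeriv g φ f w x)).re =
    (modelForm (tangentCoframe g φ (f x)
        (covariantHessian planeProdBasis (neutralMetric g φ) f x u w))
          (frameDeriv g φ f v x)).re := by
  have hx := h.self_of_nhds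
  have hd := fun v => (contDiffAt_frameDeriv (g := g) hφ hx.smooth hx.mem_target v).differentiableAt
    (by simp)
  -- Differentiate the Lagrangian condition on the pair v, w; since Re h is parallel, the plain
  -- derivatives can be completed to covariant ones.
  have h0 : fderiv ℝ (fun y => (modelForm (frameDeriv g φ f v y) (frameDeriv g φ f w y)).re) x u
      = 0 := by
    have : (fun y => (modelForm (frameDeriv g φ f v y) (frameDeriv g φ f w y)).re) =ᶠ[𝓝 x]
        fun _ => 0 := h.mono fun y hy => hy.re_modelForm hφ v w
    rw [this.fderiv_eq]
    simp
  rw [hasFDerivAt_modelForm_re (hd v) (hd w)] at h0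
  have h1 := modelForm_tangentConnection (g := g) (φ := φ) (f x) (fderiv ℝ f x u)
    (frameDeriv g φ f v x) (frameDeriv g φ f w x)
  rw [tangentCoframe_covariantHessian hφ hx.smooth hx.mem_target,
    tangentCoframe_covariantHessian hφ hx.smooth hx.mem_target, modelForm_add_left,
    modelForm_add_left, Complex.add_re, Complex.add_re,
    modelForm_re_comm (fderiv ℝ (frameDeriv g φ f w) x u),
    modelForm_re_comm (tangentConnection g φ (f x) (fderiv ℝ f x u) (frameDeriv g φ f w x))]
  linarith

lemma fderiv_surfaceArea (hφ : φ ∈ IsManifold.maximalAtlas (𝓡 2) ∞ S)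
    (hf : ContDiffAt ℝ ∞ f x) (hx : (f x).1 ∈ φ.target) (u : Plane) :
    fderiv ℝ (surfaceArea g φ f) x u =
      complexArea (fderiv ℝ (frameDeriv g φ f (planeBasis 0)) x u)
          (frameDeriv g φ f (planeBasis 1) x)
        + complexArea (frameDeriv g φ f (planeBasis 0) x)
          (fderiv ℝ (frameDeriv g φ f (planeBasis 1)) x u) := by
  have hd := fun v => ((contDiffAt_frameDeriv (g := g) hφ hf hx v).differentiableAt
    (by simp)).hasFDerivAt
  have h : HasFDerivAt (surfaceArea g φ f) _ x :=
    ((hd (planeBasis 0)).fst.mul (hd (planeBasis 1)).snd).sub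
      ((hd (planeBasis 0)).snd.mul (hd (planeBasis 1)).fst)
  rw [h.fderiv]
  simp [complexArea]
  ring

/-- On a minimal Lagrangian surface the derivative of the Lagrangian angle is given by the
connection form. -/
theorem im_fderiv_surfaceArea (hφ : φ ∈ IsManifold.maximalAtlas (𝓡 2) ∞ S)
    (h : ∀ᶠ y in 𝓝 x, IsMinimalLagrangianAt g φ f y) (u : Plane) :
    (fderiv ℝ (surfaceArea g φ f) x u * (starRingEnd ℂ) (surfaceArea g φ f x)).im =
      -2 * connectionForm g φ (f x).1 (fderiv ℝ f x u).1
        * Complex.normSq (surfaceArea g φ f x) := by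
  have hx := h.self_of_nhds
  suffices hk : ∀ k : Fin 2, (fderiv ℝ (surfaceArea g φ f) x (planeBasis k)
      * (starRingEnd ℂ) (surfaceArea g φ f x)).im =
      -2 * connectionForm g φ (f x).1 (fderiv ℝ f x (planeBasis k)).1
        * Complex.normSq (surfaceArea g φ f x) by
    rw [eq_sum_planeBasis u]
    simp only [map_add, map_smul, Prod.fst_add, Prod.smul_fst, add_mul, Complex.add_im,
      smul_mul_assoc, Complex.smul_im, hk, smul_eq_mul]
    ring
  intro k
  -- N is the covariant Hessian and Z the coordinate frame, both read in the coframe.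
  set N : Fin 2 → Fin 2 → ℂ × ℂ := fun i j => tangentCoframe g φ (f x)
    (covariantHessian planeProdBasis (neutralMetric g φ) f x (planeBasis i) (planeBasis j)) with hN
  set Z : Fin 2 → ℂ × ℂ := fun i => frameDeriv g φ f (planeBasis i) x with hZ
  have hNs : ∀ i j, N i j = N j i := fun i j => by
    simp only [hN, covariantHessian_comm hφ hx.smooth hx.mem_target (planeBasis i) (planeBasis j)]
  have hC : ∀ i j l, (modelForm (N i j) (Z l)).re = (modelForm (N i l) (Z j)).re := fun i j l =>
    modelForm_covariantHessian_comm hφ h _ _ _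
  have hr : (modelForm (Z 0) (Z 1)).re = 0 := hx.re_modelForm hφ _ _
  have hdet := det_induced_eq hr
  have hΘ : complexArea (Z 0) (Z 1) ≠ 0 := hx.surfaceArea_ne_zero hφ
  have hgram : gramMatrix planeBasis (inducedMetric (neutralMetric g φ) f) x =
      Matrix.of ![![-(modelForm (Z 0) (Z 0)).im, -(modelForm (Z 0) (Z 1)).im],
        ![-(modelForm (Z 0) (Z 1)).im, -(modelForm (Z 1) (Z 1)).im]] := by
    ext i j
    rw [gramMatrix, Matrix.of_apply, inducedMetric_eq hφ hx.mem_target]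
    fin_cases i <;> fin_cases j
    · rfl
    · rfl
    · exact congrArg _ (modelForm_im_comm _ _)
    · rfl
  -- The form Ω(·, ∂ₖF) vanishes on the tangent plane because the surface is Lagrangian, so it can
  -- be tested against the mean curvature.
  let ℓ : Plane × Plane →ₗ[ℝ] ℝ :=
    { toFun := fun Y => (modelForm (tangentCoframe g φ (f x) Y) (Z k)).re
      map_add' := fun Y Y' => by rw [map_add, modelForm_add_left, Complex.add_re]
      map_smul' := fun r Y => by
        rw [map_smul, modelForm_smul_left, Complex.re_ofReal_mul]; rfl }
  have hsum := sum_covariantHessian_eq_zero hx.minimal ℓ fun u => hx.re_modelForm hφ _ _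
  -- Total symmetry moves k into the Hessian, so that the trace involves the covariant derivatives
  -- of the frame in the fixed direction ∂ₖ.
  have hℓ : ∀ i j, ℓ (covariantHessian planeProdBasis (neutralMetric g φ) f x
      (planeBasis i) (planeBasis j)) = (modelForm (N k i) (Z j)).re := fun i j => by
    rw [hNs k i, ← hC]
    rfl
  simp only [hℓ, hgram] at hsum
  -- The inverse Gram matrix is the adjugate times this nonzero scalar, which can be cancelled from
  -- a vanishing trace.
  have hD : Ring.inverse (Matrix.det (Matrix.of
      ![![-(modelForm (Z 0) (Z 0)).im, -(modelForm (Z 0) (Z 1)).im],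
        ![-(modelForm (Z 0) (Z 1)).im, -(modelForm (Z 1) (Z 1)).im]])) ≠ 0 := by
    rw [Ring.inverse_eq_inv']
    refine inv_ne_zero ?_
    rw [Matrix.det_fin_two]
    simp only [Matrix.of_apply, Matrix.cons_val_zero, Matrix.cons_val_one, neg_mul_neg]
    rw [hdet, neg_ne_zero]
    exact fun h0 => hΘ (Complex.normSq_eq_zero.1 h0)
  rw [Matrix.inv_def, Matrix.adjugate_fin_two] at hsum
  simp only [Fin.sum_univ_two, Matrix.smul_apply, smul_eq_mul, Matrix.of_apply,
    Matrix.cons_val_zero, Matrix.cons_val_one, mul_assoc, ← mul_add, mul_eq_zero, hD,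
    false_or] at hsum
  have hfin := im_complexArea_eq_zero (m := N k 0) (n := N k 1) hr (by linarith)
  have hNk : ∀ j, N k j = fderiv ℝ (frameDeriv g φ f (planeBasis j)) x (planeBasis k)
      + tangentConnection g φ (f x) (fderiv ℝ f x (planeBasis k)) (Z j) := fun j =>
    tangentCoframe_covariantHessian hφ hx.smooth hx.mem_target _ _
  have hadd : ∀ a a' b : ℂ × ℂ, complexArea (a + a') b = complexArea a b + complexArea a' b :=
    fun a a' b => by simp [complexArea]; ring
  have hadd' : ∀ a b b' : ℂ × ℂ, complexArea a (b + b') = complexArea a b + complexArea a b' :=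
    fun a a' b => by simp [complexArea]; ring
  have hder := fderiv_surfaceArea (g := g) hφ hx.smooth hx.mem_target (planeBasis k)
  have hA := complexArea_tangentConnection (g := g) (φ := φ) (f x) (fderiv ℝ f x (planeBasis k))
    (Z 0) (Z 1)
  -- The covariant variation of the complex area is ∂ₖΘ plus the trace 2iω times Θ.
  have hsplit : complexArea (N k 0) (Z 1) + complexArea (Z 0) (N k 1) =
      fderiv ℝ (surfaceArea g φ f) x (planeBasis k)
        + 2 * Complex.I * connectionForm g φ (f x).1 (fderiv ℝ f x (planeBasis k)).1
          * complexArea (Z 0) (Z 1) := by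
    rw [hder, ← hA, hNk, hNk, hadd, hadd']
    ring
  rw [hsplit, add_mul, Complex.add_im] at hfin
  have hlast : ∀ (r : ℝ) (c : ℂ), (2 * Complex.I * r * c * (starRingEnd ℂ) c).im =
      2 * r * Complex.normSq c := fun r c => by
    simp [Complex.normSq_apply]; ring
  rw [hlast] at hfin
  change (_ * (starRingEnd ℂ) (complexArea (Z 0) (Z 1))).im = _ *
    Complex.normSq (complexArea (Z 0) (Z 1))
  linarith

end Angle

/-! ### Vanishing of the curvature where the projection has rank two -/

section Flatness

variable {S : Type*} [TopologicalSpace S] [ChartedSpace Plane S] [IsManifold (𝓡 2) ∞ S]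
  {g : SurfaceMetric S} {φ : OpenPartialHomeomorph S Plane} {f : Plane → Plane × Plane}
  {x : Plane}

/-- The form dΘ/Θ is closed. Its imaginary part plays the role of d(arg Θ), so no branch of the
argument has to be chosen. -/
lemma fderiv_logDeriv_comm {Θ : Plane → ℂ} (hΘ : ContDiffAt ℝ ∞ Θ x) (h0 : Θ x ≠ 0)
    (u v : Plane) : fderiv ℝ (fun y => fderiv ℝ Θ y v / Θ y) x u =
      fderiv ℝ (fun y => fderiv ℝ Θ y u / Θ y) x v := by
  have h1 := (hΘ.differentiableAt (by simp)).hasFDerivAt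
  have h2 := ((hΘ.fderiv_right (m := ∞) (by simp)).differentiableAt (by simp)).hasFDerivAt
  have h3 : ∀ u v, fderiv ℝ (fun y => fderiv ℝ Θ y v / Θ y) x u =
      fderiv ℝ (fderiv ℝ Θ) x u v / Θ x - fderiv ℝ Θ x u * fderiv ℝ Θ x v / Θ x ^ 2 := by
    intro u v
    have h4 : DifferentiableAt ℝ (fun y => fderiv ℝ Θ y v / Θ y) x := by
      simp_rw [div_eq_mul_inv]
      exact (h2.differentiableAt.clm_apply (differentiableAt_const v)).mul
        (h1.differentiableAt.inv h0)
    have h5 := (h4.hasFDerivAt.mul h1).congr_of_eventuallyEq (f₁ := fun y => fderiv ℝ Θ y v) (by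
      filter_upwards [hΘ.continuousAt.eventually_ne h0] with y hy
      simp [hy])
    have h6 := DFunLike.congr_fun ((h2.clm_apply (hasFDerivAt_const v x)).unique h5) u
    simp at h6
    rw [h6]
    field_simp
    ring
  rw [h3, h3, hΘ.isSymmSndFDerivAt minSmoothness_two_le_infty u v]
  ring

/-- The surface is flat below the points where a minimal Lagrangian surface is transverse to the
fibers. -/
theorem structureCurvature_eq_zero (hφ : φ ∈ IsManifold.maximalAtlas (𝓡 2) ∞ S)
    (h : ∀ᶠ y in 𝓝 x, IsMinimalLagrangianAt g φ f y) {u v : Plane}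
    (huv : (coframe g φ (f x).1 (fderiv ℝ f x v).1
      * (starRingEnd ℂ) (coframe g φ (f x).1 (fderiv ℝ f x u).1)).im ≠ 0) :
    structureCurvature g φ (f x).1 = 0 := by
  have hx := h.self_of_nhds
  have hΘ := contDiffAt_surfaceArea (g := g) hφ hx.smooth hx.mem_target
  have hΘ0 := hx.surfaceArea_ne_zero hφ
  have h1 := hΘ.differentiableAt (by simp)
  have h2 := (hΘ.fderiv_right (m := ∞) (by simp)).differentiableAt (by simp)
  have hf := (hx.smooth.differentiableAt (by simp)).hasFDerivAt
  have hf2 := ((hx.smooth.fderiv_right (m := ∞) (by simp)).differentiableAt (by simp)).hasFDerivAt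
  have hω := ((contDiffAt_connectionForm (g := g) hφ hx.mem_target).differentiableAt
    (by simp)).hasFDerivAt
  -- Derivative of Im(dΘ/Θ) = -2 f*ω. Its antisymmetrization vanishes on the left, and on the right
  -- it leaves -2 dω on the projected vectors.
  have key : ∀ u v : Plane,
      (fderiv ℝ (fun y => fderiv ℝ (surfaceArea g φ f) y v / surfaceArea g φ f y) x u).im =
      -2 * (fderiv ℝ (connectionForm g φ) (f x).1 (fderiv ℝ f x u).1 (fderiv ℝ f x v).1
        + connectionForm g φ (f x).1 (fderiv ℝ (fderiv ℝ f) x u v).1) := by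
    intro u v
    have e1 : DifferentiableAt ℝ
        (fun y => fderiv ℝ (surfaceArea g φ f) y v / surfaceArea g φ f y) x := by
      simp_rw [div_eq_mul_inv]
      exact (h2.clm_apply (differentiableAt_const v)).mul (h1.inv hΘ0)
    have e2 : HasFDerivAt
        (fun y => (fderiv ℝ (surfaceArea g φ f) y v / surfaceArea g φ f y).im) _ x :=
      Complex.imCLM.hasFDerivAt.comp x e1.hasFDerivAt
    have hωf : HasFDerivAt (fun y => connectionForm g φ (f y).1) _ x :=
      HasFDerivAt.comp (g := connectionForm g φ) x hω hf.fst
    have e3 := (hωf.clm_apply (hf2.clm_apply (hasFDerivAt_const v x)).fst).const_mul (-2)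
    have e4 := e3.congr_of_eventuallyEq
      (f₁ := fun y => (fderiv ℝ (surfaceArea g φ f) y v / surfaceArea g φ f y).im) (by
        -- The angle formula at y needs the surface to be minimal Lagrangian on a whole
        -- neighbourhood of y.
        filter_upwards [h.eventually_nhds] with y hy
        have hy0 := hy.self_of_nhds.surfaceArea_ne_zero hφ
        have hy1 := im_fderiv_surfaceArea hφ hy v
        have hn : Complex.normSq (surfaceArea g φ f y) ≠ 0 := by
          rwa [ne_eq, Complex.normSq_eq_zero]
        rw [div_eq_mul_inv, Complex.inv_def, ← mul_assoc, Complex.im_mul_ofReal, hy1]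
        field_simp)
    have e5 := DFunLike.congr_fun (e2.unique e4) u
    simp only [ContinuousLinearMap.comp_apply, Complex.imCLM_apply, smul_apply, add_apply,
      ContinuousLinearMap.flip_apply, ContinuousLinearMap.coe_fst', smul_eq_mul,
      zero_apply, map_zero, zero_add] at e5
    rw [e5]
    ring
  have k1 := key u v
  have k2 := key v u
  rw [fderiv_logDeriv_comm hΘ hΘ0 u v] at k1
  rw [hx.smooth.isSymmSndFDerivAt minSmoothness_two_le_infty u v] at k1
  have h6 := fderiv_connectionForm_sub (g := g) hφ hx.mem_target (fderiv ℝ f x u).1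
    (fderiv ℝ f x v).1
  have h7 : structureCurvature g φ (f x).1 * _ = 0 := h6.symm.trans (by linarith)
  exact (mul_eq_zero.1 h7).resolve_right huv

lemma exists_smul_add_smul_eq_zero {z w : ℂ} (h : (w * (starRingEnd ℂ) z).im = 0) :
    ∃ u : Plane, u ≠ 0 ∧ (u 0 : ℂ) * z + u 1 * w = 0 := by
  by_cases hz : z = 0
  · exact ⟨planeBasis 0, planeBasis_ne_zero 0, by simp [hz]⟩
  -- When w z̄ is real, (w z̄)z = |z|²w is a real linear relation between z and w.
  · refine ⟨!₂[(w * (starRingEnd ℂ) z).re, -Complex.normSq z], fun h0 => hz ?_, ?_⟩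
    · simpa using congrArg (fun v : Plane => v 1) h0
    · have h1 : (((w * (starRingEnd ℂ) z).re : ℝ) : ℂ) = w * (starRingEnd ℂ) z := by
        apply Complex.ext
        · simp
        · rw [h]; simp
      change (((w * (starRingEnd ℂ) z).re : ℝ) : ℂ) * z
        + ((-Complex.normSq z : ℝ) : ℂ) * w = 0
      rw [h1, Complex.ofReal_neg, ← Complex.mul_conj]
      ring

/-- If the projected area were zero, two projected vectors would be real dependent, against
injectivity of the projection on tangent vectors. So `structureCurvature_eq_zero` applies. -/
lemma curvatureTensor_eq_zero (hφ : φ ∈ IsManifold.maximalAtlas (𝓡 2) ∞ S)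
    (h : ∀ᶠ y in 𝓝 x, IsMinimalLagrangianAt g φ f y)
    (hinj : ∀ u, (fderiv ℝ f x u).1 = 0 → u = 0) (u v w : Plane) :
    curvatureTensor planeBasis (metricIn g φ) (f x).1 u v w = 0 := by
  have hx := h.self_of_nhds
  have h1 : structureCurvature g φ (f x).1 = 0 := by
    refine structureCurvature_eq_zero hφ h (u := planeBasis 0) (v := planeBasis 1) fun h0 => ?_
    obtain ⟨a, ha, ha'⟩ := exists_smul_add_smul_eq_zero h0
    refine ha (hinj a (coframe_eq_zero hφ hx.mem_target (?_ : coframe g φ (f x).1 _ = 0)))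
    rw [← ha', eq_sum_planeBasis a]
    simp
  apply coframe_eq_zero hφ hx.mem_target
  rw [coframe_curvatureTensor hφ hx.mem_target, h1]
  simp

end Flatness

/-! ### Rank of the projection to the base, and flatness at rank two -/

section Rank

variable {S : Type*} [TopologicalSpace S] [ChartedSpace Plane S] [IsManifold (𝓡 2) ∞ S]
  {g : SurfaceMetric S} {o : OrientedAtlas S} {φ : OpenPartialHomeomorph S Plane}
  {M : Type*} [TopologicalSpace M] [ChartedSpace Plane M] [IsManifold (𝓡 2) ∞ M]
  {F : M → TangentBundle (𝓡 2) S} {ψ : OpenPartialHomeomorph M Plane} {q : M}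

/-- The projection of the surface to the base, in the charts `ψ` and `φ`. -/
def baseExpr (F : M → TangentBundle (𝓡 2) S) (ψ : OpenPartialHomeomorph M Plane)
    (φ : OpenPartialHomeomorph S Plane) (x : Plane) : Plane :=
  φ (F (ψ.symm x)).proj

lemma contDiffAt_baseExpr (hF : ContMDiff (𝓡 2) (𝓡 2).tangent ∞ F)
    (hφ : φ ∈ IsManifold.maximalAtlas (𝓡 2) ∞ S) (hψ : ψ ∈ IsManifold.maximalAtlas (𝓡 2) ∞ M)
    {x : Plane} (hx : x ∈ ψ.target) (hx' : (F (ψ.symm x)).proj ∈ φ.source) :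
    ContDiffAt ℝ ∞ (baseExpr F ψ φ) x :=
  (contDiffAt_localExpr hF hφ hψ hx hx').fst

lemma fderiv_localExpr_fst (hF : ContMDiff (𝓡 2) (𝓡 2).tangent ∞ F)
    (hφ : φ ∈ IsManifold.maximalAtlas (𝓡 2) ∞ S) (hψ : ψ ∈ IsManifold.maximalAtlas (𝓡 2) ∞ M)
    {x : Plane} (hx : x ∈ ψ.target) (hx' : (F (ψ.symm x)).proj ∈ φ.source) (u : Plane) :
    (fderiv ℝ (localExpr F ψ φ) x u).1 = fderiv ℝ (baseExpr F ψ φ) x u := by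
  have h := ((contDiffAt_localExpr hF hφ hψ hx hx').differentiableAt (by simp)).hasFDerivAt.fst
  have h' : fderiv ℝ (baseExpr F ψ φ) x = _ := h.fderiv
  rw [h']
  rfl

lemma finrank_range_comp {A B C D : Type*} [AddCommGroup A] [Module ℝ A] [AddCommGroup B]
    [Module ℝ B] [AddCommGroup C] [Module ℝ C] [AddCommGroup D] [Module ℝ D]
    (a : A →ₗ[ℝ] B) (t : B →ₗ[ℝ] C) (d : C →ₗ[ℝ] D) (ha : Function.Bijective a)
    (hd : Function.Bijective d) : Module.finrank ℝ (LinearMap.range (d ∘ₗ t ∘ₗ a)) =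
      Module.finrank ℝ (LinearMap.range t) := by
  rw [LinearMap.range_comp, LinearMap.range_comp_of_range_eq_top _ (LinearMap.range_eq_top.2 ha.2)]
  exact LinearEquiv.finrank_map_eq (LinearEquiv.ofBijective d hd) _

lemma projectionRank_eq (hF : ContMDiff (𝓡 2) (𝓡 2).tangent ∞ F)
    (hφ : φ ∈ IsManifold.maximalAtlas (𝓡 2) ∞ S) (hψ : ψ ∈ IsManifold.maximalAtlas (𝓡 2) ∞ M)
    (hq : q ∈ ψ.source) (hq' : (F q).proj ∈ φ.source) : projectionRank F q =
      Module.finrank ℝ (LinearMap.range (fderiv ℝ (baseExpr F ψ φ) (ψ q)).toLinearMap) := by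
  have h1 : MDifferentiableAt (𝓡 2) (𝓡 2) (fun q' => (F q').proj) q :=
    ((Bundle.contMDiff_proj _).comp hF).mdifferentiableAt (n := ∞) (by simp)
  have h2 := (mdifferentiable_of_mem_maximalAtlas hφ).mdifferentiableAt hq'
  have hψt : ψ q ∈ ψ.target := ψ.map_source hq
  have h3 := (mdifferentiable_of_mem_maximalAtlas hψ).mdifferentiableAt_symm hψt
  have hinv := ψ.left_inv hq
  have h4 : HasMFDerivAt (𝓡 2) (𝓡 2) ψ.symm (ψ q) (mfderiv (𝓡 2) (𝓡 2) ψ.symm (ψ q)) :=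
    h3.hasMFDerivAt
  -- Stated at ψ⁻¹(ψ(q)) rather than q so that it composes with the derivative of ψ⁻¹.
  have h5 : HasMFDerivAt (𝓡 2) (𝓡 2) (φ ∘ fun q' => (F q').proj) (ψ.symm (ψ q))
      ((mfderiv (𝓡 2) (𝓡 2) φ (F q).proj : Plane →L[ℝ] Plane).comp
      (mfderiv (𝓡 2) (𝓡 2) (fun q' => (F q').proj) q : Plane →L[ℝ] Plane)) := by
    rw [hinv]
    exact HasMFDerivAt.comp q h2.hasMFDerivAt h1.hasMFDerivAt
  have h6 : HasMFDerivAt 𝓘(ℝ, Plane) 𝓘(ℝ, Plane) (baseExpr F ψ φ) (ψ q)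
      (((mfderiv (𝓡 2) (𝓡 2) φ (F q).proj : Plane →L[ℝ] Plane).comp
      (mfderiv (𝓡 2) (𝓡 2) (fun q' => (F q').proj) q : Plane →L[ℝ] Plane)).comp
      (mfderiv (𝓡 2) (𝓡 2) ψ.symm (ψ q) : Plane →L[ℝ] Plane)) :=
    HasMFDerivAt.comp (g := φ ∘ fun q' => (F q').proj) (ψ q) h5 h4
  have hfd : ∀ A : Plane →L[ℝ] Plane, HasMFDerivAt 𝓘(ℝ, Plane) 𝓘(ℝ, Plane) (baseExpr F ψ φ) (ψ q) A →
      fderiv ℝ (baseExpr F ψ φ) (ψ q) = A := fun A h => HasFDerivAt.fderiv (HasMFDerivAt.hasFDerivAt h)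
  have h7 := hfd _ h6
  rw [h7]
  have ha := (mdifferentiable_of_mem_maximalAtlas hψ).symm.mfderiv_bijective
    (x := ψ q) (by simpa using hψt)
  have hd := (mdifferentiable_of_mem_maximalAtlas hφ).mfderiv_bijective hq'
  exact (finrank_range_comp
    (mfderiv (𝓡 2) (𝓡 2) ψ.symm (ψ q) : Plane →L[ℝ] Plane).toLinearMap
    (mfderiv (𝓡 2) (𝓡 2) (fun q' => (F q').proj) q : Plane →L[ℝ] Plane).toLinearMap
    (mfderiv (𝓡 2) (𝓡 2) φ (F q).proj : Plane →L[ℝ] Plane).toLinearMap ha hd).symm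

lemma det_ne_zero_iff_finrank (T : Plane →L[ℝ] Plane) :
    T.det ≠ 0 ↔ Module.finrank ℝ (LinearMap.range T.toLinearMap) = 2 := by
  have h : T.det = LinearMap.det T.toLinearMap := rfl
  rw [h, ne_eq, LinearMap.det_eq_zero_iff_ker_ne_bot, not_not]
  constructor
  · intro hk
    rw [LinearMap.finrank_range_of_inj (LinearMap.ker_eq_bot.1 hk)]
    simp
  · intro hr
    rw [LinearMap.ker_eq_bot_iff_range_eq_top]
    exact Submodule.eq_top_of_finrank_eq (by rw [hr]; simp)

lemma injective_of_det_ne_zero {T : Plane →L[ℝ] Plane} (h : T.det ≠ 0) {u : Plane}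
    (hu : T u = 0) : u = 0 := by
  have h' : LinearMap.det T.toLinearMap ≠ 0 := h
  rw [ne_eq, LinearMap.det_eq_zero_iff_ker_ne_bot, not_not] at h'
  exact LinearMap.ker_eq_bot'.1 h' u hu

lemma projectionRank_eq_two_iff (hF : ContMDiff (𝓡 2) (𝓡 2).tangent ∞ F)
    (hφ : φ ∈ IsManifold.maximalAtlas (𝓡 2) ∞ S) (hψ : ψ ∈ IsManifold.maximalAtlas (𝓡 2) ∞ M)
    (hq : q ∈ ψ.source) (hq' : (F q).proj ∈ φ.source) :
    projectionRank F q = 2 ↔ (fderiv ℝ (baseExpr F ψ φ) (ψ q)).det ≠ 0 := by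
  rw [det_ne_zero_iff_finrank, projectionRank_eq hF hφ hψ hq hq']

lemma continuous_proj_comp (hF : ContMDiff (𝓡 2) (𝓡 2).tangent ∞ F) :
    Continuous fun q => (F q).proj :=
  (FiberBundle.continuous_proj Plane (fun p : S => TangentSpace (𝓡 2) p)).comp hF.continuous

lemma chart_mem (q : M) : chartAt Plane q ∈ IsManifold.maximalAtlas (𝓡 2) ∞ M :=
  IsManifold.chart_mem_maximalAtlas q

/-- Passes from the global hypotheses, formulated at ψ(q) for q in M, to a pointwise condition on an
open set of coordinates that can be differentiated. -/
lemma eventually_isMinimalLagrangianAt (hF : IsSmoothImmersion F) (hnull : IsNonNull g o F)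
    (hlag : IsLagrangian g o F) (hmin : IsMinimal g o F)
    (hψ : ψ ∈ IsManifold.maximalAtlas (𝓡 2) ∞ M) (hφ : φ ∈ o.charts)
    {x : Plane} (hx : x ∈ ψ.target) (hx' : (F (ψ.symm x)).proj ∈ φ.source) :
    ∀ᶠ y in 𝓝 x, IsMinimalLagrangianAt g φ (localExpr F ψ φ) y := by
  have h1 : ∀ᶠ y in 𝓝 x, (F (ψ.symm y)).proj ∈ φ.source :=
    ((continuous_proj_comp hF.smooth).continuousAt.comp (ψ.continuousAt_symm hx)).eventually
      (φ.open_source.mem_nhds hx')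
  filter_upwards [h1, ψ.open_target.mem_nhds hx] with y hy hyt
  have hs := ψ.map_target hyt
  have hr := ψ.right_inv hyt
  refine ⟨contDiffAt_localExpr hF.smooth (o.smooth hφ) hψ hyt hy, φ.map_source hy, ?_, ?_, ?_⟩
  · have := hlag ψ hψ φ hφ _ hs hy
    rwa [hr] at this
  · have := hnull ψ hψ φ hφ _ hs hy
    rwa [hr] at this
  · have := hmin ψ hψ φ hφ _ hs hy
    rwa [hr] at this

lemma isFlatAt_of_projectionRank (hF : IsSmoothImmersion F) (hnull : IsNonNull g o F)
    (hlag : IsLagrangian g o F) (hmin : IsMinimal g o F) (hq : projectionRank F q = 2) :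
    IsFlatAt g o (F q).proj := by
  intro φ hφ hp u v w
  have hψ := chart_mem q
  have hs := mem_chart_source Plane q
  have ht := mem_chart_target Plane q
  have hi := (chartAt Plane q).left_inv hs
  have hp' : (F ((chartAt Plane q).symm (chartAt Plane q q))).proj ∈ φ.source := by rwa [hi]
  have h := eventually_isMinimalLagrangianAt hF hnull hlag hmin hψ hφ ht hp'
  have hd := (projectionRank_eq_two_iff hF.smooth (o.smooth hφ) hψ hs hp).1 hq
  have h1 := curvatureTensor_eq_zero (o.smooth hφ) h (fun u hu => injective_of_det_ne_zero hd (by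
    rwa [← fderiv_localExpr_fst hF.smooth (o.smooth hφ) hψ ht hp'])) u v w
  have h2 : (localExpr F (chartAt Plane q) φ (chartAt Plane q q)).1 = φ (F q).proj :=
    congrArg (fun q' => φ (F q').proj) hi
  rwa [h2] at h1

/-- Maximal rank is an open condition: the determinant of the projection in charts is continuous. -/
lemma eventually_projectionRank_eq_two (hF : ContMDiff (𝓡 2) (𝓡 2).tangent ∞ F)
    (o : OrientedAtlas S) (hq : projectionRank F q = 2) :
    ∀ᶠ q' in 𝓝 q, projectionRank F q' = 2 := by
  obtain ⟨φ, hφ, hp⟩ := o.cover (F q).proj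
  have hψ := chart_mem q
  have hs := mem_chart_source Plane q
  have ht := mem_chart_target Plane q
  have hi := (chartAt Plane q).left_inv hs
  have hp' : (F ((chartAt Plane q).symm (chartAt Plane q q))).proj ∈ φ.source := by rwa [hi]
  have hd := (projectionRank_eq_two_iff hF (o.smooth hφ) hψ hs hp).1 hq
  have hc : ContinuousAt (fun q' => (fderiv ℝ (baseExpr F (chartAt Plane q) φ)
      (chartAt Plane q q')).det) q := by
    have h1 : ContDiffAt ℝ ∞ (fderiv ℝ (baseExpr F (chartAt Plane q) φ)) (chartAt Plane q q) :=
      (contDiffAt_baseExpr hF (o.smooth hφ) hψ ht hp').fderiv_right (by simp)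
    exact ContinuousLinearMap.continuous_det.continuousAt.comp
      (ContinuousAt.comp (f := chartAt Plane q) h1.continuousAt
        ((chartAt Plane q).continuousAt hs))
  filter_upwards [hc.eventually_ne hd, (chartAt Plane q).open_source.mem_nhds hs,
    (continuous_proj_comp hF).continuousAt.eventually (φ.open_source.mem_nhds hp)]
    with q' h1 h2 h3
  exact (projectionRank_eq_two_iff hF (o.smooth hφ) hψ h2 h3).2 h1

/-- Flatness holds below every point near q, and p is a local diffeomorphism at q, so these points
fill a neighbourhood of p(q). -/
lemma isFlatNear_of_projectionRank (hF : IsSmoothImmersion F) (hnull : IsNonNull g o F)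
    (hlag : IsLagrangian g o F) (hmin : IsMinimal g o F) (hq : projectionRank F q = 2) :
    IsFlatNear g o (F q).proj := by
  have hflat : ∀ᶠ q' in 𝓝 q, IsFlatAt g o (F q').proj :=
    (eventually_projectionRank_eq_two hF.smooth o hq).mono fun q' hq' =>
      isFlatAt_of_projectionRank hF hnull hlag hmin hq'
  obtain ⟨φ, hφ, hp⟩ := o.cover (F q).proj
  set ψ := chartAt Plane q with hψdef
  have hψ : ψ ∈ IsManifold.maximalAtlas (𝓡 2) ∞ M := chart_mem q
  have hs : q ∈ ψ.source := mem_chart_source Plane q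
  have ht : ψ q ∈ ψ.target := mem_chart_target Plane q
  have hi : ψ.symm (ψ q) = q := ψ.left_inv hs
  have hp' : (F (ψ.symm (ψ q))).proj ∈ φ.source := by rwa [hi]
  have hd := (projectionRank_eq_two_iff hF.smooth (o.smooth hφ) hψ hs hp).1 hq
  have hst := (contDiffAt_baseExpr hF.smooth (o.smooth hφ) hψ ht hp').hasStrictFDerivAt (by simp)
  have hker : LinearMap.ker (fderiv ℝ (baseExpr F ψ φ) (ψ q)).toLinearMap = ⊥ :=
    LinearMap.ker_eq_bot'.2 fun u hu => injective_of_det_ne_zero hd hu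
  -- Openness at the point: the projection maps the neighbourhood filter onto that of the image.
  have hmap := hst.map_nhds_eq_of_surj (LinearMap.ker_eq_bot_iff_range_eq_top.1 hker)
  have hbase : baseExpr F ψ φ (ψ q) = φ (F q).proj := congrArg (fun q' => φ (F q').proj) hi
  rw [hbase] at hmap
  have h1 : ∀ᶠ y in 𝓝 (φ (F q).proj), IsFlatAt g o (φ.symm y) := by
    rw [← hmap, eventually_map]
    have hsymm : Tendsto ψ.symm (𝓝 (ψ q)) (𝓝 q) := by
      have := ψ.continuousAt_symm ht
      rwa [ContinuousAt, hi] at this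
    filter_upwards [hsymm.eventually hflat, hsymm.eventually
      ((continuous_proj_comp hF.smooth).continuousAt.eventually (φ.open_source.mem_nhds hp))]
      with x hx1 hx2
    rw [baseExpr, φ.left_inv hx2]
    exact hx1
  filter_upwards [(φ.continuousAt hp).eventually h1, φ.open_source.mem_nhds hp] with p' h2 h3
  rwa [φ.left_inv h3] at h2

end Rank

/-! ### The geodesic equation for the base curve of an affine normal bundle -/

section Geodesic

variable {S : Type*} [TopologicalSpace S] [ChartedSpace Plane S] [IsManifold (𝓡 2) ∞ S]
  {g : SurfaceMetric S} {o : OrientedAtlas S} {φ : OpenPartialHomeomorph S Plane}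
  {M : Type*} [TopologicalSpace M] [ChartedSpace Plane M] [IsManifold (𝓡 2) ∞ M]
  {F : M → TangentBundle (𝓡 2) S} {ψ : OpenPartialHomeomorph M Plane} {x : Plane}

lemma contDiffAt_chart_comp (hφ : φ ∈ IsManifold.maximalAtlas (𝓡 2) ∞ S) {γ : ℝ → S} {J : Set ℝ}
    (hJ : IsOpen J) (hγ : ContMDiffOn 𝓘(ℝ, ℝ) (𝓡 2) ∞ γ J) {s : ℝ} (hs : s ∈ J)
    (hs' : γ s ∈ φ.source) : ContDiffAt ℝ ∞ (φ ∘ γ) s :=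
  (ContMDiffAt.comp s (contMDiffAt_of_mem_maximalAtlas hφ hs')
    (hγ.contMDiffAt (hJ.mem_nhds hs))).contDiffAt

lemma mfderiv_velocity (hφ : φ ∈ IsManifold.maximalAtlas (𝓡 2) ∞ S) {γ : ℝ → S} {s : ℝ}
    (hγ : MDifferentiableAt 𝓘(ℝ, ℝ) (𝓡 2) γ s) (hs' : γ s ∈ φ.source) :
    mfderiv (𝓡 2) (𝓡 2) φ (γ s) (velocity γ s) = deriv (φ ∘ γ) s := by
  have h1 := (mdifferentiable_of_mem_maximalAtlas hφ).mdifferentiableAt hs'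
  have h2 := mfderiv_comp s h1 hγ
  have h3 : mfderiv 𝓘(ℝ, ℝ) 𝓘(ℝ, Plane) (φ ∘ γ) s (1 : ℝ) = deriv (φ ∘ γ) s := by
    have h4 : mfderiv 𝓘(ℝ, ℝ) 𝓘(ℝ, Plane) (φ ∘ γ) s = fderiv ℝ (φ ∘ γ) s := mfderiv_eq_fderiv
    exact (DFunLike.congr_fun h4 (1 : ℝ)).trans
      (fderiv_apply_one_eq_deriv (𝕜 := ℝ) (F := Plane) (f := φ ∘ γ) (x := s))
  exact (DFunLike.congr_fun h2 (1 : ℝ)).symm.trans h3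

lemma tangentCoframe_vertical (hφ : φ ∈ IsManifold.maximalAtlas (𝓡 2) ∞ S) {z : Plane × Plane}
    (hz : z.1 ∈ φ.target) (v : Plane) : tangentCoframe g φ z (0, v) = (0, coframe g φ z.1 v) := by
  refine Prod.ext ?_ ?_
  · simp [tangentCoframe_fst]
  · rw [tangentCoframe_snd', fderiv_fiberCoordinate hφ hz]
    simp

/-- Along the direction ∂₁ the first coordinate is fixed and f is affine, so no regularity of c, b
or m is needed; in particular the normal field need not be known to be continuous. -/
lemma fderiv_planeBasis_one_of_affine {f : Plane → Plane × Plane} {c : ℝ → Plane}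
    {b m : ℝ → Plane} (hf : DifferentiableAt ℝ f x)
    (h : ∀ᶠ y in 𝓝 x, f y = (c (y 0), b (y 0) + y 1 • m (y 0))) :
    fderiv ℝ f x (planeBasis 1) = (0, m (x 0)) := by
  have h1 := hf.hasFDerivAt.hasLineDerivAt (planeBasis 1)
  have h2 : HasLineDerivAt ℝ f (0, m (x 0)) x (planeBasis 1) := by
    unfold HasLineDerivAt
    have h3 : HasDerivAt (fun t : ℝ => (c (x 0), b (x 0) + (x 1 + t) • m (x 0)))
        (0, m (x 0)) 0 := by
      refine (hasDerivAt_const _ _).prodMk ?_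
      have := (((hasDerivAt_id (0 : ℝ)).const_add (x 1)).smul_const (m (x 0))).const_add (b (x 0))
      simpa using this
    refine h3.congr_of_eventuallyEq ?_
    have h4 : Tendsto (fun t : ℝ => x + t • (planeBasis 1 : Plane)) (𝓝 0) (𝓝 x) := by
      have : Continuous fun t : ℝ => x + t • (planeBasis 1 : Plane) := by fun_prop
      simpa using this.tendsto 0
    filter_upwards [h4.eventually h] with t ht
    rw [ht]
    simp
  exact h1.unique h2

lemma hasFDerivAt_coord (i : Fin 2) (x : Plane) :
    HasFDerivAt (fun y : Plane => y i) (EuclideanSpace.proj (𝕜 := ℝ) i : Plane →L[ℝ] ℝ) x :=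
  (EuclideanSpace.proj (𝕜 := ℝ) i : Plane →L[ℝ] ℝ).hasFDerivAt

lemma contDiffAt_deriv {E : Type*} [NormedAddCommGroup E] [NormedSpace ℝ E] {c : ℝ → E} {s : ℝ}
    (hc : ContDiffAt ℝ ∞ c s) : ContDiffAt ℝ ∞ (deriv c) s := by
  have h1 : deriv c = fun t => fderiv ℝ c t 1 := funext fun t => fderiv_apply_one_eq_deriv.symm
  rw [h1]
  exact (hc.fderiv_right (m := ∞) (by simp)).clm_apply contDiffAt_const

lemma hasFDerivAt_comp_coord {E : Type*} [NormedAddCommGroup E] [NormedSpace ℝ E] {c : ℝ → E}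
    {c' : E} {i : Fin 2} (hc : HasDerivAt c c' (x i)) :
    HasFDerivAt (fun y : Plane => c (y i))
      ((EuclideanSpace.proj (𝕜 := ℝ) i : Plane →L[ℝ] ℝ).smulRight c') x :=
  (hc.hasFDerivAt.comp x (hasFDerivAt_coord i x)).congr_fderiv (by ext; simp)

/-- The base curve of a minimal affine normal bundle is a geodesic, in the chart `φ`. -/
lemma geodesic_of_affine (hφ : φ ∈ IsManifold.maximalAtlas (𝓡 2) ∞ S)
    {f : Plane → Plane × Plane} {c b m : ℝ → Plane}
    (hmin : ∀ᶠ y in 𝓝 x, IsMinimalLagrangianAt g φ f y)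
    (hc : ∀ᶠ y in 𝓝 x, ContDiffAt ℝ ∞ c (y 0))
    (h : ∀ᶠ y in 𝓝 x, f y = (c (y 0), b (y 0) + y 1 • m (y 0)))
    (hunit : ∀ᶠ y in 𝓝 x, metricIn g φ (c (y 0)) (deriv c (y 0)) (deriv c (y 0)) = 1)
    (hm : ∀ᶠ y in 𝓝 x, metricIn g φ (c (y 0)) (m (y 0)) (m (y 0)) = 1)
    (hperp : ∀ᶠ y in 𝓝 x, metricIn g φ (c (y 0)) (m (y 0)) (deriv c (y 0)) = 0) :
    deriv (deriv c) (x 0) + connectionIn g φ (c (x 0)) (deriv c (x 0)) (deriv c (x 0)) = 0 := by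
  have hx := hmin.self_of_nhds
  have hcx : c (x 0) ∈ φ.target := by
    have := hx.mem_target
    rwa [h.self_of_nhds] at this
  have hc1 := (hc.self_of_nhds.differentiableAt (by simp)).hasDerivAt
  have hc2 := ((contDiffAt_deriv hc.self_of_nhds).differentiableAt (by simp)).hasDerivAt
  set ξ : Plane → ℂ := fun y => coframe g φ (c (y 0)) (deriv c (y 0)) with hξ
  set ν : Plane → ℂ := fun y => coframe g φ (c (y 0)) (m (y 0)) with hν
  -- As ∂₁F is vertical, Θ = ξν with ξ = ζ(c') and ν = ζ(m). Orthonormality gives ν = ±iξ with a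
  -- sign possibly depending on the point; squaring removes it: Θ² = -ξ⁴.
  have hsq : ∀ᶠ y in 𝓝 x, ξ y * (starRingEnd ℂ) (ξ y) = 1 ∧
      surfaceArea g φ f y * surfaceArea g φ f y = -(ξ y * ξ y) * (ξ y * ξ y) ∧
      surfaceArea g φ f y * (starRingEnd ℂ) (surfaceArea g φ f y) = 1 ∧
      (fderiv ℝ f y (planeBasis 0)).1 = deriv c (y 0) := by
    filter_upwards [hmin, hc, h.eventually_nhds, hunit, hm, hperp] with y h1 h2 h3 h4 h5 h6
    have hcy : c (y 0) ∈ φ.target := by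
      have := h1.mem_target
      rwa [h3.self_of_nhds] at this
    rw [metricIn_eq_coframe hφ hcy] at h4 h5 h6
    have hf := h1.smooth.differentiableAt (by simp)
    have e1 := fderiv_planeBasis_one_of_affine hf h3
    have e2 : (fderiv ℝ f y (planeBasis 0)).1 = deriv c (y 0) := by
      have h7 := (hasFDerivAt_comp_coord
        (h2.differentiableAt (by simp)).hasDerivAt).congr_of_eventuallyEq
        (f₁ := fun y => (f y).1) (h3.mono fun y' h' => congrArg Prod.fst h')
      have h8 := DFunLike.congr_fun (hf.hasFDerivAt.fst.unique h7) (planeBasis 0)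
      simpa using h8
    have e3 : surfaceArea g φ f y = ξ y * ν y := by
      simp only [surfaceArea, complexArea, frameDeriv, e1, tangentCoframe_vertical hφ h1.mem_target,
        tangentCoframe_fst, e2]
      rw [h3.self_of_nhds]
      simp [hξ, hν]
    have c1 : ξ y * (starRingEnd ℂ) (ξ y) = 1 := by
      apply Complex.ext <;> simp [hξ]
      · linarith
      · ring
    have c2 : ν y * (starRingEnd ℂ) (ν y) = 1 := by
      apply Complex.ext <;> simp [hν]
      · linarith
      · ring
    have c3 : ξ y * (starRingEnd ℂ) (ν y) + ν y * (starRingEnd ℂ) (ξ y) = 0 := by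
      apply Complex.ext <;> simp [hξ, hν]
      · linarith
      · ring
    refine ⟨c1, ?_, ?_, e2⟩
    · rw [e3]
      linear_combination (ξ y * ξ y * ξ y * ν y) * c3 - (ξ y * ξ y * ξ y * ξ y) * c2
        - (ξ y * ξ y * ν y * ν y) * c1
    · rw [e3, map_mul]
      linear_combination ν y * (starRingEnd ℂ) (ν y) * c1 + c2
  obtain ⟨q1, q2, q3, q4⟩ := hsq.self_of_nhds
  have hζ := ((contDiffAt_coframe (g := g) hφ hcx).differentiableAt (by simp)).hasFDerivAt
  set D := fderiv ℝ (coframe g φ) (c (x 0)) (deriv c (x 0)) (deriv c (x 0))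
    + coframe g φ (c (x 0)) (deriv (deriv c) (x 0)) with hD
  have hξ1 : HasDerivAt (fun s => coframe g φ (c s) (deriv c s)) D (x 0) :=
    HasDerivAt.clm_apply (hζ.comp_hasDerivAt (x 0) hc1) hc2
  have hξ2 : HasFDerivAt ξ _ x := hasFDerivAt_comp_coord hξ1
  have hΘ := ((contDiffAt_surfaceArea (g := g) hφ hx.smooth
    hx.mem_target).differentiableAt (by simp)).hasFDerivAt
  have r1 := (hΘ.mul hΘ).unique ((((hξ2.mul hξ2).neg.mul (hξ2.mul hξ2)).congr_of_eventuallyEq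
    (hsq.mono fun y hy => hy.2.1)))
  have r2 := DFunLike.congr_fun r1 (planeBasis 0)
  have hξc : HasFDerivAt (fun y => (starRingEnd ℂ) (ξ y)) _ x :=
    Complex.conjCLE.toContinuousLinearMap.hasFDerivAt.comp x hξ2
  have r3 := DFunLike.congr_fun ((hξ2.mul hξc).unique ((hasFDerivAt_const (1 : ℂ) x)
    |>.congr_of_eventuallyEq (hsq.mono fun y hy => hy.1))) (planeBasis 0)
  have r4 := im_fderiv_surfaceArea hφ hmin (planeBasis 0)
  rw [q4] at r4
  have hp0 : (EuclideanSpace.proj (𝕜 := ℝ) 0 : Plane →L[ℝ] ℝ) (planeBasis 0) = 1 := by simp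
  simp only [add_apply, smul_apply, neg_apply, ContinuousLinearMap.smulRight_apply,
    hp0, one_smul, smul_eq_mul, Pi.mul_apply,
    Pi.neg_apply, ContinuousLinearMap.comp_apply, ContinuousLinearEquiv.coe_coe,
    Complex.conjCLE_apply, zero_apply] at r2 r3
  rw [h.self_of_nhds] at r4
  have hΘn : Complex.normSq (surfaceArea g φ f x) = 1 := by
    rw [Complex.mul_conj] at q3
    exact mod_cast q3
  rw [hΘn, mul_one] at r4
  set T := fderiv ℝ (surfaceArea g φ f) x (planeBasis 0)
  set Θ := surfaceArea g φ f x
  have q2' := congrArg (starRingEnd ℂ) q2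
  simp only [map_mul, map_neg] at q2'
  -- Differentiating Θ² = -ξ⁴ gives ΘT = -2ξ³D; it is divided by Θ² using |Θ| = |ξ| = 1.
  have hT : T * (starRingEnd ℂ) Θ = 2 * ((starRingEnd ℂ) (ξ x) * D) := by
    have t1 : Θ * T = -2 * (ξ x * ξ x * ξ x * D) := by linear_combination r2 / 2
    have t2 : T * (starRingEnd ℂ) Θ = Θ * T * ((starRingEnd ℂ) Θ * (starRingEnd ℂ) Θ) := by
      linear_combination -T * (starRingEnd ℂ) Θ * q3
    rw [t2, t1, q2']
    generalize (starRingEnd ℂ) (ξ x) = X' at *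
    generalize ξ x = X at *
    linear_combination 2 * X' * D * ((X * X') ^ 2 + X * X' + 1) * q1
  rw [hT] at r4
  -- The real part vanishes because |ξ| = 1 along the curve; the imaginary part is the angle
  -- formula. Together D = -iω(c')ξ, which is ∇c' = 0 in the coframe.
  have t3 : (starRingEnd ℂ) (ξ x) * D =
      ((-connectionForm g φ (c (x 0)) (deriv c (x 0)) : ℝ) : ℂ) * Complex.I := by
    have t4 := congrArg Complex.re r3
    apply Complex.ext
    · simp at t4 ⊢
      linarith
    · simp at r4 ⊢
      linarith
  have t5 : D = -(Complex.I * connectionForm g φ (c (x 0)) (deriv c (x 0)) * ξ x) := by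
    push_cast at t3
    linear_combination ξ x * t3 - D * q1
  apply coframe_eq_zero hφ hcx
  rw [map_add, coframe_connectionIn hφ hcx]
  linear_combination t5

end Geodesic

/-! ### From the normal form to geodesics; the inverse function theorem on squares -/

section NormalForm

variable {S : Type*} [TopologicalSpace S] [ChartedSpace Plane S] [IsManifold (𝓡 2) ∞ S]
  {g : SurfaceMetric S} {o : OrientedAtlas S} {φ : OpenPartialHomeomorph S Plane}
  {M : Type*} [TopologicalSpace M] [ChartedSpace Plane M] [IsManifold (𝓡 2) ∞ M]
  {F : M → TangentBundle (𝓡 2) S} {ψ : OpenPartialHomeomorph M Plane}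

/-- The base curve of a minimal affine normal bundle is a geodesic. -/
lemma isUnitSpeedGeodesicOn_of_normalForm (hF : IsSmoothImmersion F) (hnull : IsNonNull g o F)
    (hlag : IsLagrangian g o F) (hmin : IsMinimal g o F)
    (hψ : ψ ∈ IsManifold.maximalAtlas (𝓡 2) ∞ M) {J : Set ℝ} (hJ : IsOpen J) {γ : ℝ → S}
    {a : ℝ → ℝ} {n : (s : ℝ) → TangentSpace (𝓡 2) (γ s)}
    (hγ : ContMDiffOn 𝓘(ℝ, ℝ) (𝓡 2) ∞ γ J)
    (hunit : ∀ s ∈ J, g.inner (γ s) (velocity γ s) (velocity γ s) = 1)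
    (hn : ∀ s ∈ J, g.inner (γ s) (n s) (n s) = 1 ∧ g.inner (γ s) (n s) (velocity γ s) = 0)
    (hform : ∀ x ∈ ψ.target, x 0 ∈ J ∧
      F (ψ.symm x) = ⟨γ (x 0), a (x 0) • velocity γ (x 0) + x 1 • n (x 0)⟩)
    (hsurj : ∀ s ∈ J, ∃ x ∈ ψ.target, x 0 = s) : IsUnitSpeedGeodesicOn g o γ J := by
  refine ⟨hγ, hunit, fun s hs φ hφ hsφ => ?_⟩
  -- The geodesic equation at the parameter s is read off at a point of the surface lying over it.
  obtain ⟨x, hx, rfl⟩ := hsurj s hs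
  have hφ' := o.smooth hφ
  have hproj : (F (ψ.symm x)).proj ∈ φ.source := by
    rw [(hform x hx).2]
    exact hsφ
  have hco : ContinuousAt (fun y : Plane => y 0) x :=
    (EuclideanSpace.proj (𝕜 := ℝ) (0 : Fin 2) : Plane →L[ℝ] ℝ).continuous.continuousAt
  have hJe : ∀ᶠ y : Plane in 𝓝 x, y 0 ∈ J := hco.eventually (hJ.mem_nhds hs)
  have hγe : ∀ᶠ y : Plane in 𝓝 x, γ (y 0) ∈ φ.source :=
    (ContinuousAt.comp (f := fun y : Plane => y 0) (g := γ) (x := x)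
      (hγ.continuousOn.continuousAt (hJ.mem_nhds hs)) hco).eventually (φ.open_source.mem_nhds hsφ)
  have hvel : ∀ s ∈ J, γ s ∈ φ.source →
      mfderiv (𝓡 2) (𝓡 2) φ (γ s) (velocity γ s) = deriv (φ ∘ γ) s := fun s hs hs' =>
    mfderiv_velocity hφ' ((hγ.contMDiffAt (hJ.mem_nhds hs)).mdifferentiableAt (by simp)) hs'
  refine geodesic_of_affine (φ := φ) (f := localExpr F ψ φ) (c := φ ∘ γ)
    (b := fun s => a s • deriv (φ ∘ γ) s)
    (m := fun s => mfderiv (𝓡 2) (𝓡 2) φ (γ s) (n s)) hφ'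
    (eventually_isMinimalLagrangianAt hF hnull hlag hmin hψ hφ hx hproj) ?_ ?_ ?_ ?_ ?_
  · filter_upwards [hJe, hγe] with y h1 h2
    exact contDiffAt_chart_comp hφ' hJ hγ h1 h2
  · filter_upwards [hJe, hγe, ψ.open_target.mem_nhds hx] with y h1 h2 h3
    rw [localExpr, (hform y h3).2, ← hvel _ h1 h2]
    refine Prod.ext rfl ?_
    change mfderiv (𝓡 2) (𝓡 2) φ (γ (y 0)) (a (y 0) • velocity γ (y 0) + y 1 • n (y 0)) = _
    rw [map_add, map_smul, map_smul]
    rfl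
  · filter_upwards [hJe, hγe] with y h1 h2
    rw [← hvel _ h1 h2]
    exact (metricIn_mfderiv hφ' h2 _ _).trans (hunit _ h1)
  · filter_upwards [hJe, hγe] with y h1 h2
    exact (metricIn_mfderiv hφ' h2 _ _).trans (hn _ h1).1
  · filter_upwards [hJe, hγe] with y h1 h2
    rw [← hvel _ h1 h2]
    exact (metricIn_mfderiv hφ' h2 _ _).trans (hn _ h1).2

/-- The open square with center `a` and half-side `ε`. -/
def box (a : Plane) (ε : ℝ) : Set Plane := {y | y 0 ∈ Ioo (a 0 - ε) (a 0 + ε) ∧ y 1 ∈ Ioo (a 1 - ε) (a 1 + ε)}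

lemma isOpen_box (a : Plane) (ε : ℝ) : IsOpen (box a ε) := by
  have h : ∀ i : Fin 2, Continuous fun y : Plane => y i := fun i =>
    (EuclideanSpace.proj (𝕜 := ℝ) i : Plane →L[ℝ] ℝ).continuous
  exact (isOpen_Ioo.preimage (h 0)).inter (isOpen_Ioo.preimage (h 1))

lemma exists_box_subset {a : Plane} {U : Set Plane} (hU : U ∈ 𝓝 a) : ∃ ε > 0, box a ε ⊆ U := by
  obtain ⟨r, hr, hrU⟩ := Metric.mem_nhds_iff.1 hU
  refine ⟨r / 2, by positivity, fun y hy => hrU ?_⟩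
  have h0 : |(y - a) 0| < r / 2 := by
    rw [PiLp.sub_apply, abs_lt]; constructor <;> linarith [hy.1.1, hy.1.2]
  have h1 : |(y - a) 1| < r / 2 := by
    rw [PiLp.sub_apply, abs_lt]; constructor <;> linarith [hy.2.1, hy.2.2]
  have hb : ∀ i : Fin 2, ‖(planeBasis i : Plane)‖ = 1 := fun i => by simp [planeBasis]
  rw [mem_ball_iff_norm, eq_sum_planeBasis (y - a)]
  calc _ ≤ ‖(y - a) 0 • (planeBasis 0 : Plane)‖ + ‖(y - a) 1 • (planeBasis 1 : Plane)‖ :=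
        norm_add_le _ _
    _ < r := by
        rw [norm_smul, norm_smul, hb, hb, Real.norm_eq_abs, Real.norm_eq_abs]
        linarith

lemma mem_box_self {a : Plane} {ε : ℝ} (hε : 0 < ε) : a ∈ box a ε :=
  ⟨⟨by linarith, by linarith⟩, ⟨by linarith, by linarith⟩⟩

/-- The inverse function theorem in the plane, with a square as the target. -/
lemma exists_box_chart {χ : Plane → Plane} {U : Set Plane} (hU : IsOpen U)
    (hχ : ContDiffOn ℝ ∞ χ U) {x : Plane} (hx : x ∈ U) (hinj : ∀ u, fderiv ℝ χ x u = 0 → u = 0) :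
    ∃ e : OpenPartialHomeomorph Plane Plane, x ∈ e.source ∧ e.source ⊆ U ∧ (∀ y, e y = χ y) ∧
      (∃ ε > 0, e.target = box (χ x) ε) ∧ ContDiffOn ℝ ∞ e e.source ∧
      ContDiffOn ℝ ∞ e.symm e.target := by
  have hequiv : ∀ {T : Plane →L[ℝ] Plane}, T.det ≠ 0 →
      ∃ L : Plane ≃L[ℝ] Plane, (L : Plane →L[ℝ] Plane) = T := fun {T} hT =>
    ⟨(LinearEquiv.ofInjectiveEndo T.toLinearMap (LinearMap.ker_eq_bot.1
      (LinearMap.ker_eq_bot'.2 fun u hu => injective_of_det_ne_zero hT hu))).toContinuousLinearEquiv,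
      by ext; rfl⟩
  have hdet : (fderiv ℝ χ x).det ≠ 0 := by
    have h : (fderiv ℝ χ x).det = LinearMap.det (fderiv ℝ χ x).toLinearMap := rfl
    rw [h, ne_eq, LinearMap.det_eq_zero_iff_ker_ne_bot, not_not]
    exact LinearMap.ker_eq_bot'.2 hinj
  have hat : ∀ y ∈ U, ContDiffAt ℝ ∞ χ y := fun y hy => hχ.contDiffAt (hU.mem_nhds hy)
  obtain ⟨L, hL⟩ := hequiv hdet
  have hd : HasFDerivAt χ (L : Plane →L[ℝ] Plane) x := by
    rw [hL]
    exact ((hat x hx).differentiableAt (by simp)).hasFDerivAt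
  set e₀ := (hat x hx).toOpenPartialHomeomorph χ hd (by simp)
  have hx₀ : x ∈ e₀.source := (hat x hx).mem_toOpenPartialHomeomorph_source hd (by simp)
  have hcont : ContinuousOn (fun y => (fderiv ℝ χ y).det) U :=
    ContinuousLinearMap.continuous_det.comp_continuousOn (hχ.continuousOn_fderiv_of_isOpen hU (by simp))
  -- Restricting to the points with invertible derivative makes the inverse smooth on the whole
  -- target, not only at the centre.
  set W := U ∩ (fun y => (fderiv ℝ χ y).det) ⁻¹' {0}ᶜ
  have hW : IsOpen W := hcont.isOpen_inter_preimage hU isOpen_compl_singleton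
  have hxW : x ∈ W := ⟨hx, hdet⟩
  set e₁ := e₀.restrOpen W hW
  have hx₁ : x ∈ e₁.source := by
    rw [OpenPartialHomeomorph.restrOpen_source]; exact ⟨hx₀, hxW⟩
  obtain ⟨ε, hε, hbox⟩ := exists_box_subset (e₁.open_target.mem_nhds (e₁.map_source hx₁))
  have hxe : e₁ x = χ x := rfl
  rw [hxe] at hbox
  -- Restricting the inverse makes the target exactly a square, so that coordinate lines in it are
  -- connected.
  set e := (e₁.symm.restrOpen (box (χ x) ε) (isOpen_box _ _)).symm
  have htarget : e.target = box (χ x) ε := by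
    change e₁.symm.source ∩ box (χ x) ε = _
    exact inter_eq_right.2 hbox
  have hsource : e.source ⊆ W := by
    intro y hy
    have h1 : y ∈ e₁.source := (show y ∈ e₁.source ∩ e₁ ⁻¹' box (χ x) ε from hy).1
    rw [OpenPartialHomeomorph.restrOpen_source] at h1
    exact h1.2
  have hcoe : ∀ y, e y = χ y := fun y => rfl
  have hxs : x ∈ e.source :=
    (show x ∈ e₁.source ∩ e₁ ⁻¹' box (χ x) ε from ⟨hx₁, mem_box_self hε⟩)
  refine ⟨e, hxs, fun y hy => (hsource hy).1, hcoe, ⟨ε, hε, htarget⟩, ?_, ?_⟩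
  · exact hχ.mono fun y hy => (hsource hy).1
  · intro y hy
    have h1 := hsource (e.map_target hy)
    obtain ⟨L', hL'⟩ := hequiv h1.2
    refine (e.contDiffAt_symm (f₀' := L') hy ?_ (hat _ h1.1)).contDiffWithinAt
    rw [hL']
    exact ((hat _ h1.1).differentiableAt (by simp)).hasFDerivAt

lemma trans_mem_maximalAtlas (hψ : ψ ∈ IsManifold.maximalAtlas (𝓡 2) ∞ M)
    {e : OpenPartialHomeomorph Plane Plane} (he : ContDiffOn ℝ ∞ e e.source)
    (he' : ContDiffOn ℝ ∞ e.symm e.target) :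
    ψ.trans e ∈ IsManifold.maximalAtlas (𝓡 2) ∞ M := by
  refine (ψ.trans e).mem_maximalAtlas_of_contMDiffOn ?_ ?_
  · exact he.contMDiffOn.comp ((contMDiffOn_of_mem_maximalAtlas hψ).mono
      fun y hy => (ψ.trans_source e ▸ hy : y ∈ ψ.source ∩ ψ ⁻¹' e.source).1)
      fun y hy => (ψ.trans_source e ▸ hy : y ∈ ψ.source ∩ ψ ⁻¹' e.source).2
  · exact (contMDiffOn_symm_of_mem_maximalAtlas hψ).comp (he'.contMDiffOn.mono
      fun y hy => (ψ.trans_target e ▸ hy : y ∈ e.target ∩ e.symm ⁻¹' ψ.target).1)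
      fun y hy => (ψ.trans_target e ▸ hy : y ∈ e.target ∩ e.symm ⁻¹' ψ.target).2

lemma trans_target_of_subset {e : OpenPartialHomeomorph Plane Plane} (h : e.source ⊆ ψ.target) :
    (ψ.trans e).target = e.target := by
  rw [ψ.trans_target e]
  exact inter_eq_left.2 fun y hy => h (e.map_target hy)

end NormalForm

/-! ### Maps of rank one between planes -/

section Straightening

lemma exists_ne_zero_of_det_eq_zero {T : Plane →L[ℝ] Plane} (h : T.det = 0) :
    ∃ u, u ≠ 0 ∧ T u = 0 := by
  have h' : LinearMap.det T.toLinearMap = 0 := h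
  rw [LinearMap.det_eq_zero_iff_ker_ne_bot] at h'
  obtain ⟨u, hu, hu0⟩ := (Submodule.ne_bot_iff _).1 h'
  exact ⟨u, hu0, hu⟩

lemma contDiff_cons {t : ℝ} : ContDiff ℝ ∞ fun s : ℝ => (!₂[s, t] : Plane) := by
  rw [contDiff_euclidean]
  intro i
  fin_cases i
  · exact contDiff_id
  · exact contDiff_const

lemma hasDerivAt_cons_one (s t : ℝ) :
    HasDerivAt (fun t : ℝ => (!₂[s, t] : Plane)) (planeBasis 1) t := by
  have h : (fun t : ℝ => (!₂[s, t] : Plane)) = fun t => s • planeBasis 0 + t • planeBasis 1 := by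
    funext t
    conv_lhs => rw [eq_sum_planeBasis !₂[s, t]]
    simp
  rw [h]
  simpa using ((hasDerivAt_id t).smul_const (planeBasis 1 : Plane)).const_add
    (s • (planeBasis 0 : Plane))

/-- A function on a square whose second partial derivative vanishes depends on the first
coordinate only. -/
lemma eq_of_fderiv_planeBasis_one_eq_zero {E : Type*} [NormedAddCommGroup E] [NormedSpace ℝ E]
    {P : Plane → E} {a : Plane} {ε : ℝ} (hP : ∀ y ∈ box a ε, DifferentiableAt ℝ P y)
    (h0 : ∀ y ∈ box a ε, fderiv ℝ P y (planeBasis 1) = 0) {y : Plane} (hy : y ∈ box a ε) :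
    P y = P !₂[y 0, a 1] := by
  have hε : 0 < ε := by linarith [hy.1.1, hy.1.2]
  have hbox : ∀ t ∈ Ioo (a 1 - ε) (a 1 + ε), (!₂[y 0, t] : Plane) ∈ box a ε := fun t ht =>
    ⟨hy.1, ht⟩
  have hd : ∀ t ∈ Ioo (a 1 - ε) (a 1 + ε), HasDerivAt (fun t => P !₂[y 0, t]) 0 t := by
    intro t ht
    have h1 := (hP _ (hbox t ht)).hasFDerivAt.comp_hasDerivAt t (hasDerivAt_cons_one (y 0) t)
    rwa [h0 _ (hbox t ht)] at h1
  have h1 := isOpen_Ioo.is_const_of_deriv_eq_zero isPreconnected_Ioo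
    (fun t ht => (hd t ht).differentiableAt.differentiableWithinAt) (fun t ht => (hd t ht).deriv)
    hy.2 (show a 1 ∈ Ioo (a 1 - ε) (a 1 + ε) from ⟨by linarith, by linarith⟩)
  have h2 : (!₂[y 0, y 1] : Plane) = y := by ext i; fin_cases i <;> rfl
  rw [h2] at h1
  exact h1

/-- A map of rank one between planes is, in suitable coordinates, a curve. -/
lemma exists_straightening {p : Plane → Plane} {U : Set Plane} (hU : IsOpen U)
    (hp : ContDiffOn ℝ ∞ p U) {x : Plane} (hx : x ∈ U) (h0 : fderiv ℝ p x ≠ 0)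
    (hdet : ∀ y ∈ U, (fderiv ℝ p y).det = 0) :
    ∃ e : OpenPartialHomeomorph Plane Plane, x ∈ e.source ∧ e.source ⊆ U ∧
      ContDiffOn ℝ ∞ e e.source ∧ ContDiffOn ℝ ∞ e.symm e.target ∧
      ∃ ε > 0, e.target = box (e x) ε ∧ ∃ (i : Fin 2) (c : ℝ → Plane),
        ContDiffOn ℝ ∞ c (Ioo (e x 0 - ε) (e x 0 + ε)) ∧
        (∀ s ∈ Ioo (e x 0 - ε) (e x 0 + ε), c s i = s) ∧
        ∀ y ∈ e.target, p (e.symm y) = c (y 0) := by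
  obtain ⟨v, hv⟩ : ∃ v, fderiv ℝ p x v ≠ 0 := by
    by_contra! h
    exact h0 (ContinuousLinearMap.ext h)
  obtain ⟨i, hi⟩ : ∃ i : Fin 2, fderiv ℝ p x v i ≠ 0 := by
    by_contra! h
    exact hv (PiLp.ext h)
  -- The first coordinate is a component of p that varies along v; the second is a linear form whose
  -- kernel is spanned by v. Their differentials at x are independent.
  set χ : Plane → Plane := fun y => !₂[p y i, v 0 * y 1 - v 1 * y 0] with hχ
  have hpc : ∀ {y}, y ∈ U → ContDiffAt ℝ ∞ p y := fun hy => hp.contDiffAt (hU.mem_nhds hy)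
  have hχs : ContDiffOn ℝ ∞ χ U := by
    rw [contDiffOn_euclidean]
    intro k
    have hcoord : ∀ j : Fin 2, ContDiff ℝ ∞ fun y : Plane => y j := fun j =>
      (EuclideanSpace.proj (𝕜 := ℝ) j : Plane →L[ℝ] ℝ).contDiff
    fin_cases k
    · exact (hcoord i).comp_contDiffOn hp
    · exact ((contDiff_const.mul (hcoord 1)).sub (contDiff_const.mul (hcoord 0))).contDiffOn
  have hχd := ((hχs.contDiffAt (hU.mem_nhds hx)).differentiableAt (by simp)).hasFDerivAt
  have hinj : ∀ u, fderiv ℝ χ x u = 0 → u = 0 := by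
    intro u hu
    have e0 : fderiv ℝ p x u i = 0 := by
      have h1 := (hasFDerivAt_coord 0 (χ x)).comp x hχd
      have h2 := (hasFDerivAt_coord i (p x)).comp x
        ((hpc hx).differentiableAt (by simp)).hasFDerivAt
      have h3 := DFunLike.congr_fun (h1.unique h2) u
      simp only [ContinuousLinearMap.comp_apply, hu, map_zero] at h3
      exact h3.symm
    have e1 : v 0 * u 1 - v 1 * u 0 = 0 := by
      have h1 := (hasFDerivAt_coord 1 (χ x)).comp x hχd
      have h2 := ((hasFDerivAt_coord 1 x).const_mul (v 0)).sub
        ((hasFDerivAt_coord 0 x).const_mul (v 1))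
      have h3 := DFunLike.congr_fun (h1.unique h2) u
      simp only [ContinuousLinearMap.comp_apply, hu, map_zero] at h3
      exact h3.symm
    have e2 : v 0 • u = u 0 • v := by
      ext k; fin_cases k <;> simp <;> linarith
    have e3 : v 1 • u = u 1 • v := by
      ext k; fin_cases k <;> simp <;> linarith
    have e4 : ∀ k : Fin 2, v k • u = u k • v → u k = 0 := by
      intro k hk
      have h1 := congrArg (fun w => fderiv ℝ p x w i) hk
      simp only [map_smul, PiLp.smul_apply, e0, smul_eq_mul, mul_zero] at h1
      exact (mul_eq_zero.1 h1.symm).resolve_right hi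
    ext k; fin_cases k
    · exact e4 0 e2
    · exact e4 1 e3
  obtain ⟨e, hxe, heU, heχ, ⟨ε, hε, htar⟩, hes, hes'⟩ := exists_box_chart hU hχs hx hinj
  rw [← heχ] at htar
  set P : Plane → Plane := fun y => p (e.symm y) with hP
  have hsd : ∀ y ∈ e.target, ContDiffAt ℝ ∞ e.symm y := fun y hy =>
    hes'.contDiffAt (e.open_target.mem_nhds hy)
  have hPs : ∀ y ∈ e.target, ContDiffAt ℝ ∞ P y := fun y hy =>
    (hpc (heU (e.map_target hy))).comp y (hsd y hy)
  have hPi : ∀ y ∈ e.target, P y i = y 0 := by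
    intro y hy
    have h1 := e.right_inv hy
    rw [heχ] at h1
    exact congrArg (fun w : Plane => w 0) h1
  -- The differential of P has a nonzero kernel vector u. Since the i-th component of P is y 0, the
  -- first coordinate of u vanishes, so u is a multiple of ∂₁.
  have hP1 : ∀ y ∈ e.target, fderiv ℝ P y (planeBasis 1) = 0 := by
    intro y hy
    have hy' := heU (e.map_target hy)
    have h1 : fderiv ℝ P y = (fderiv ℝ p (e.symm y)).comp (fderiv ℝ e.symm y) :=
      fderiv_comp y ((hpc hy').differentiableAt (by simp)) ((hsd y hy).differentiableAt (by simp))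
    have h2 : (fderiv ℝ P y).det = 0 := by
      rw [h1]
      change LinearMap.det ((fderiv ℝ p (e.symm y)).toLinearMap ∘ₗ
        (fderiv ℝ e.symm y).toLinearMap) = 0
      rw [LinearMap.det_comp]
      have h3 : LinearMap.det (fderiv ℝ p (e.symm y)).toLinearMap = 0 := hdet _ hy'
      rw [h3, zero_mul]
    obtain ⟨u, hu, hu0⟩ := exists_ne_zero_of_det_eq_zero h2
    have h4 : ∀ w, fderiv ℝ P y w i = w 0 := by
      intro w
      have h5 := (hasFDerivAt_coord i (P y)).comp y ((hPs y hy).differentiableAt (by simp)).hasFDerivAt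
      have h6 := (hasFDerivAt_coord 0 y).congr_of_eventuallyEq (f₁ := fun y => P y i) (by
        filter_upwards [e.open_target.mem_nhds hy] with y' hy'
        exact hPi y' hy')
      exact DFunLike.congr_fun (h5.unique h6) w
    have h7 : u 0 = 0 := by rw [← h4, hu0]; rfl
    have h8 : u = u 1 • planeBasis 1 := by
      conv_lhs => rw [eq_sum_planeBasis u, h7, zero_smul, zero_add]
    rw [h8, map_smul] at hu0
    refine (smul_eq_zero.1 hu0).resolve_left fun h9 => hu ?_
    rw [h8, h9, zero_smul]
  refine ⟨e, hxe, heU, hes, hes', ε, hε, htar, i, fun s => P !₂[s, e x 1], ?_, ?_, ?_⟩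
  · intro s hs
    have hmem : (!₂[s, e x 1] : Plane) ∈ e.target := by
      rw [htar]; exact ⟨hs, by simpa using hε⟩
    exact ((hPs _ hmem).comp s contDiff_cons.contDiffAt).contDiffWithinAt
  · intro s hs
    have hmem : (!₂[s, e x 1] : Plane) ∈ e.target := by
      rw [htar]; exact ⟨hs, by simpa using hε⟩
    exact hPi _ hmem
  · intro y hy
    rw [htar] at hy hP1 hPs
    exact eq_of_fderiv_planeBasis_one_eq_zero (fun y hy => (hPs y hy).differentiableAt (by simp))
      hP1 hy

end Straightening

/-! ### Normal coordinates on a Lagrangian surface over a regular curve -/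

section NormalFormExistence

variable {S : Type*} [TopologicalSpace S] [ChartedSpace Plane S] [IsManifold (𝓡 2) ∞ S]
  {g : SurfaceMetric S} {o : OrientedAtlas S} {φ : OpenPartialHomeomorph S Plane}
  {M : Type*} [TopologicalSpace M] [ChartedSpace Plane M] [IsManifold (𝓡 2) ∞ M]
  {F : M → TangentBundle (𝓡 2) S} {ψ : OpenPartialHomeomorph M Plane} {q : M}

/-- Recovers a vector from its coordinates, in order to turn the local normal form into an identity
in the tangent bundle. -/
lemma eq_of_tangentChart (hφ : φ ∈ IsManifold.maximalAtlas (𝓡 2) ∞ S)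
    {z : TangentBundle (𝓡 2) S} (hz : z.proj ∈ φ.source) {x v : Plane}
    (h : tangentChart φ z = (x, v)) :
    z = ⟨φ.symm x, mfderiv (𝓡 2) (𝓡 2) φ.symm x v⟩ := by
  obtain ⟨p, w⟩ := z
  obtain rfl : φ p = x := congrArg Prod.fst h
  obtain rfl : mfderiv (𝓡 2) (𝓡 2) φ p w = v := congrArg Prod.snd h
  have h1 := DFunLike.congr_fun ((mdifferentiable_of_mem_maximalAtlas hφ).symm_comp_deriv hz) w
  have key : ∀ (p' : S) (w' : Plane), p' = p → w' = w →
      (⟨p, w⟩ : TangentBundle (𝓡 2) S) = ⟨p', w'⟩ := by rintro _ _ rfl rfl; rfl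
  exact key _ _ (φ.left_inv hz) h1

lemma exists_primitive {l : ℝ → ℝ} {t r : ℝ} (hl : ContDiffOn ℝ ∞ l (Ioo (t - r) (t + r))) :
    ∃ σ : ℝ → ℝ, ContDiffOn ℝ ∞ σ (Ioo (t - r) (t + r)) ∧
      ∀ s ∈ Ioo (t - r) (t + r), HasDerivAt σ (l s) s := by
  have hd : ∀ s ∈ Ioo (t - r) (t + r), HasDerivAt (fun s => ∫ x in t..s, l x) (l s) s := by
    intro s hs
    have ht : t ∈ Ioo (t - r) (t + r) := ⟨by linarith [hs.1, hs.2], by linarith [hs.1, hs.2]⟩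
    refine intervalIntegral.integral_hasDerivAt_right ?_
      (hl.continuousOn.stronglyMeasurableAtFilter isOpen_Ioo s hs)
      (hl.continuousOn.continuousAt (isOpen_Ioo.mem_nhds hs))
    exact (hl.continuousOn.mono (ordConnected_Ioo.uIcc_subset ht hs)).intervalIntegrable
  refine ⟨_, ?_, hd⟩
  rw [contDiffOn_infty_iff_deriv_of_isOpen isOpen_Ioo]
  exact ⟨fun s hs => (hd s hs).differentiableAt.differentiableWithinAt,
    hl.congr fun s hs => (hd s hs).deriv⟩

/-- The base point does not vary along ∂₁, so ∂₁F is vertical with fiber component ∂₁η. The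
Lagrangian condition makes it normal to the curve, and Θ ≠ 0 makes it nonzero. -/
lemma frameDeriv_planeBasis_one (hφ : φ ∈ IsManifold.maximalAtlas (𝓡 2) ∞ S)
    {f : Plane → Plane × Plane} {y : Plane} {c : ℝ → Plane} (hy : IsMinimalLagrangianAt g φ f y)
    (hc : DifferentiableAt ℝ c (y 0)) (hf : ∀ᶠ y' in 𝓝 y, (f y').1 = c (y' 0)) :
    (coframe g φ (c (y 0)) (deriv c (y 0)) * (starRingEnd ℂ)
      (fderiv ℝ (fun y => fiberCoordinate g φ (f y)) y (planeBasis 1))).re = 0 ∧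
    fderiv ℝ (fun y => fiberCoordinate g φ (f y)) y (planeBasis 1) ≠ 0 := by
  have hfd := hy.smooth.differentiableAt (by simp)
  have h1 := hfd.hasFDerivAt.fst.unique
    ((hasFDerivAt_comp_coord hc.hasDerivAt).congr_of_eventuallyEq hf)
  have h2 : (fderiv ℝ f y (planeBasis 0)).1 = deriv c (y 0) := by
    simpa using DFunLike.congr_fun h1 (planeBasis 0)
  have h3 : (fderiv ℝ f y (planeBasis 1)).1 = 0 := by
    simpa using DFunLike.congr_fun h1 (planeBasis 1)
  have h4 : fderiv ℝ (fun y => fiberCoordinate g φ (f y)) y (planeBasis 1) =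
      fderiv ℝ (fiberCoordinate g φ) (f y) (fderiv ℝ f y (planeBasis 1)) := by
    have h5 := ((contDiffAt_fiberCoordinate (g := g) hφ hy.mem_target).differentiableAt
      (by simp)).hasFDerivAt.comp y hfd.hasFDerivAt
    exact DFunLike.congr_fun h5.fderiv (planeBasis 1)
  have h6 : frameDeriv g φ f (planeBasis 1) y =
      (0, fderiv ℝ (fun y => fiberCoordinate g φ (f y)) y (planeBasis 1)) := by
    refine Prod.ext ?_ ?_
    · rw [frameDeriv, tangentCoframe_fst, h3, map_zero]
    · rw [frameDeriv, tangentCoframe_snd', h3, h4]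
      simp
  have h7 : (frameDeriv g φ f (planeBasis 0) y).1 = coframe g φ (c (y 0)) (deriv c (y 0)) := by
    rw [frameDeriv, tangentCoframe_fst, h2, hf.self_of_nhds]
  constructor
  · have h8 := hy.re_modelForm hφ (planeBasis 0) (planeBasis 1)
    rw [h6, modelForm, h7] at h8
    simp at h8 ⊢
    linarith
  · intro h0
    refine hy.surfaceArea_ne_zero hφ ?_
    rw [surfaceArea, h6, h0]
    simp [complexArea]

/-- Normal coordinates `(s, t)` on a Lagrangian surface over a regular curve: `s` is the arc length
of the curve and `t` the normal component of the vector. -/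
lemma exists_normal_coordinates (hφ : φ ∈ IsManifold.maximalAtlas (𝓡 2) ∞ S)
    {f : Plane → Plane × Plane} {a : Plane} {ε : ℝ} (hε : 0 < ε)
    (hf : ∀ y ∈ box a ε, IsMinimalLagrangianAt g φ f y) {c : ℝ → Plane}
    (hc : ContDiffOn ℝ ∞ c (Ioo (a 0 - ε) (a 0 + ε)))
    (hc' : ∀ s ∈ Ioo (a 0 - ε) (a 0 + ε), deriv c s ≠ 0)
    (hbase : ∀ y ∈ box a ε, (f y).1 = c (y 0)) :
    ∃ E : OpenPartialHomeomorph Plane Plane, a ∈ E.source ∧ E.source ⊆ box a ε ∧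
      ContDiffOn ℝ ∞ E E.source ∧ ContDiffOn ℝ ∞ E.symm E.target ∧
      ∃ δ > 0, E.target = box (E a) δ ∧ ∃ (C : ℝ → Plane) (α : ℝ → ℝ),
        ContDiffOn ℝ ∞ C (Ioo (E a 0 - δ) (E a 0 + δ)) ∧
        ContDiffOn ℝ ∞ α (Ioo (E a 0 - δ) (E a 0 + δ)) ∧
        (∀ s ∈ Ioo (E a 0 - δ) (E a 0 + δ), C s ∈ φ.target ∧
          ‖coframe g φ (C s) (deriv C s)‖ = 1) ∧
        ∀ y ∈ E.target, (f (E.symm y)).1 = C (y 0) ∧ fiberCoordinate g φ (f (E.symm y)) =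
          (α (y 0) + y 1 * Complex.I) * coframe g φ (C (y 0)) (deriv C (y 0)) := by
  set J := Ioo (a 0 - ε) (a 0 + ε) with hJ
  have hJo : IsOpen J := isOpen_Ioo
  have hBo : IsOpen (box a ε) := isOpen_box a ε
  have haB : a ∈ box a ε := mem_box_self hε
  have hmem : ∀ s ∈ J, (!₂[s, a 1] : Plane) ∈ box a ε := fun s hs => ⟨hs, by simpa using hε⟩
  have hct : ∀ s ∈ J, c s ∈ φ.target := fun s hs => by
    have := (hf _ (hmem s hs)).mem_target
    rwa [hbase _ (hmem s hs)] at this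
  have hcs : ∀ s ∈ J, ContDiffAt ℝ ∞ c s := fun s hs => hc.contDiffAt (hJo.mem_nhds hs)
  set ξ : ℝ → ℂ := fun s => coframe g φ (c s) (deriv c s) with hξ
  have hξ0 : ∀ s ∈ J, ξ s ≠ 0 := fun s hs h0 => hc' s hs (coframe_eq_zero hφ (hct s hs) h0)
  have hξs : ∀ s ∈ J, ContDiffAt ℝ ∞ ξ s := fun s hs =>
    ((contDiffAt_coframe hφ (hct s hs)).comp s (hcs s hs)).clm_apply (contDiffAt_deriv (hcs s hs))
  have hls : ∀ s ∈ J, ContDiffAt ℝ ∞ (fun s => ‖ξ s‖) s := fun s hs =>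
    (hξs s hs).norm ℝ (hξ0 s hs)
  -- σ is the arc length of the base curve, an antiderivative of its speed |ξ|.
  obtain ⟨σ, hσs, hσd⟩ := exists_primitive (t := a 0) (r := ε) fun s hs =>
    (hls s hs).contDiffWithinAt
  -- The unit tangent of the curve, as a complex number.
  set e : ℝ → ℂ := fun s => ((‖ξ s‖⁻¹ : ℝ) : ℂ) * ξ s with he
  have hes : ∀ s ∈ J, ContDiffAt ℝ ∞ e s := fun s hs =>
    (Complex.ofRealCLM.contDiff.contDiffAt.comp s
      ((hls s hs).inv (norm_ne_zero_iff.2 (hξ0 s hs)))).mul (hξs s hs)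
  have hen : ∀ s ∈ J, ‖e s‖ = 1 := fun s hs => by
    simp only [he]
    rw [norm_mul, Complex.norm_real, norm_inv, norm_norm,
      inv_mul_cancel₀ (norm_ne_zero_iff.2 (hξ0 s hs))]
  have hee : ∀ s ∈ J, e s * (starRingEnd ℂ) (e s) = 1 := fun s hs => by
    rw [Complex.mul_conj, Complex.normSq_eq_norm_sq, hen s hs]; simp
  set η : Plane → ℂ := fun y => fiberCoordinate g φ (f y) with hη
  have hηs : ∀ y ∈ box a ε, ContDiffAt ℝ ∞ η y := fun y hy =>
    (contDiffAt_fiberCoordinate hφ (hf y hy).mem_target).comp y (hf y hy).smooth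
  have hη1 : ∀ y ∈ box a ε, ((starRingEnd ℂ) (e (y 0)) * fderiv ℝ η y (planeBasis 1)).re = 0 ∧
      ((starRingEnd ℂ) (e (y 0)) * fderiv ℝ η y (planeBasis 1)).im ≠ 0 := by
    intro y hy
    obtain ⟨h1, h2⟩ := frameDeriv_planeBasis_one hφ (hf y hy)
      ((hcs _ hy.1).differentiableAt (by simp))
      (Filter.Eventually.mono (hBo.eventually_mem hy) hbase)
    have h3 : ((starRingEnd ℂ) (e (y 0)) * fderiv ℝ η y (planeBasis 1)).re = 0 := by
      simp only [he, map_mul, Complex.conj_ofReal, mul_assoc, Complex.re_ofReal_mul]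
      refine mul_eq_zero_of_right _ ?_
      rw [← h1]
      simp [hξ, hη]
    refine ⟨h3, fun h4 => h2 ?_⟩
    have h5 : (starRingEnd ℂ) (e (y 0)) * fderiv ℝ η y (planeBasis 1) = 0 := Complex.ext h3 h4
    linear_combination e (y 0) * h5 - fderiv ℝ η y (planeBasis 1) * hee _ hy.1
  -- The fiber vector in the frame (e, ie): Re τ is its tangential and Im τ its normal component.
  set τ : Plane → ℂ := fun y => (starRingEnd ℂ) (e (y 0)) * η y with hτ
  have hec : ∀ s ∈ J, ContDiffAt ℝ ∞ (fun s => (starRingEnd ℂ) (e s)) s := fun s hs =>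
    Complex.conjCLE.contDiff.contDiffAt.comp s (hes s hs)
  have hcoord : ∀ y : Plane, ContDiffAt ℝ ∞ (fun y : Plane => y 0) y := fun y =>
    (EuclideanSpace.proj (𝕜 := ℝ) (0 : Fin 2) : Plane →L[ℝ] ℝ).contDiff.contDiffAt
  have hτs : ∀ y ∈ box a ε, ContDiffAt ℝ ∞ τ y := fun y hy =>
    (ContDiffAt.comp y (hec _ hy.1) (hcoord y)).mul (hηs y hy)
  have hτ1 : ∀ y ∈ box a ε, fderiv ℝ τ y (planeBasis 1) =
      (starRingEnd ℂ) (e (y 0)) * fderiv ℝ η y (planeBasis 1) := by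
    intro y hy
    have h1 := (hasFDerivAt_comp_coord ((hec _ hy.1).differentiableAt
      (by simp)).hasDerivAt).mul ((hηs y hy).differentiableAt (by simp)).hasFDerivAt
    have h2 : fderiv ℝ τ y = _ := h1.fderiv
    rw [h2]
    simp
  have hre : ∀ y ∈ box a ε, HasFDerivAt (fun y => (τ y).re)
      (Complex.reCLM.comp (fderiv ℝ τ y)) y := fun y hy =>
    Complex.reCLM.hasFDerivAt.comp y ((hτs y hy).differentiableAt (by simp)).hasFDerivAt
  have him : ∀ y ∈ box a ε, HasFDerivAt (fun y => (τ y).im)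
      (Complex.imCLM.comp (fderiv ℝ τ y)) y := fun y hy =>
    Complex.imCLM.hasFDerivAt.comp y ((hτs y hy).differentiableAt (by simp)).hasFDerivAt
  -- The derivative of τ along ∂₁ is imaginary, so the tangential component depends only on the
  -- position on the curve.
  have hα : ∀ y ∈ box a ε, (τ y).re = (τ !₂[y 0, a 1]).re := fun y hy =>
    eq_of_fderiv_planeBasis_one_eq_zero (P := fun y => (τ y).re)
      (fun y hy => (hre y hy).differentiableAt) (fun y hy => by
        rw [(hre y hy).fderiv, ContinuousLinearMap.comp_apply, hτ1 y hy]
        exact (hη1 y hy).1) hy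
  set χ : Plane → Plane := fun y => !₂[σ (y 0), (τ y).im] with hχ
  have hχs : ContDiffOn ℝ ∞ χ (box a ε) := by
    rw [contDiffOn_euclidean]
    intro k
    fin_cases k
    · exact fun y hy => ((hσs.contDiffAt (hJo.mem_nhds hy.1)).comp (f := fun y : Plane => y 0) y
        (hcoord y)).contDiffWithinAt
    · exact fun y hy => (Complex.imCLM.contDiff.contDiffAt.comp y (hτs y hy)).contDiffWithinAt
  have hχd := ((hχs.contDiffAt (hBo.mem_nhds haB)).differentiableAt (by simp)).hasFDerivAt
  have haJ : a 0 ∈ J := haB.1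
  have hinj : ∀ u, fderiv ℝ χ a u = 0 → u = 0 := by
    intro u hu
    have e0 : u 0 = 0 := by
      have h1 := (hasFDerivAt_coord 0 (χ a)).comp a hχd
      have h2 := hasFDerivAt_comp_coord (i := 0) (x := a) (hσd (a 0) haJ)
      have h3 := DFunLike.congr_fun (h1.unique h2) u
      simp only [ContinuousLinearMap.comp_apply, hu, map_zero] at h3
      have h4 : u 0 * ‖ξ (a 0)‖ = 0 := h3.symm
      exact (mul_eq_zero.1 h4).resolve_right (norm_ne_zero_iff.2 (hξ0 _ haJ))
    have e1 : u 1 = 0 := by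
      have h1 := (hasFDerivAt_coord 1 (χ a)).comp a hχd
      have h3 := DFunLike.congr_fun (h1.unique (him a haB)) u
      have hu' : u = u 1 • planeBasis 1 := by
        conv_lhs => rw [eq_sum_planeBasis u, e0, zero_smul, zero_add]
      simp only [ContinuousLinearMap.comp_apply, hu, map_zero] at h3
      rw [hu', map_smul, hτ1 a haB, map_smul, smul_eq_mul] at h3
      exact (mul_eq_zero.1 h3.symm).resolve_right (hη1 a haB).2
    ext k; fin_cases k
    · exact e0
    · exact e1
  obtain ⟨E, haE, hEB, hEχ, ⟨δ, hδ, htar⟩, hEs, hEs'⟩ := exists_box_chart hBo hχs haB hinj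
  rw [← hEχ] at htar
  set J' := Ioo (E a 0 - δ) (E a 0 + δ) with hJ'
  have hmem' : ∀ s ∈ J', (!₂[s, E a 1] : Plane) ∈ E.target := fun s hs => by
    rw [htar]; exact ⟨hs, by simpa using hδ⟩
  -- The inverse of the arc length σ, read off from the inverse of the chart E.
  set ρ : ℝ → ℝ := fun s => E.symm !₂[s, E a 1] 0 with hρ
  have hρs : ∀ s ∈ J', ContDiffAt ℝ ∞ ρ s := fun s hs =>
    (hcoord _).comp s ((hEs'.contDiffAt (E.open_target.mem_nhds (hmem' s hs))).comp s
      contDiff_cons.contDiffAt)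
  have hρJ : ∀ s ∈ J', ρ s ∈ J := fun s hs => (hEB (E.map_target (hmem' s hs))).1
  have hEinv : ∀ y ∈ E.target, σ (E.symm y 0) = y 0 ∧ (τ (E.symm y)).im = y 1 := by
    intro y hy
    have h1 := E.right_inv hy
    rw [hEχ] at h1
    exact ⟨congrArg (fun w : Plane => w 0) h1, congrArg (fun w : Plane => w 1) h1⟩
  have hσρ : ∀ s ∈ J', σ (ρ s) = s := fun s hs => (hEinv _ (hmem' s hs)).1
  have hσinj : InjOn σ J := by
    refine StrictMonoOn.injOn (strictMonoOn_of_deriv_pos (convex_Ioo _ _) hσs.continuousOn ?_)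
    intro s hs
    rw [interior_Ioo] at hs
    rw [(hσd s hs).deriv]
    exact norm_pos_iff.2 (hξ0 s hs)
  have hρ' : ∀ s ∈ J', HasDerivAt ρ (‖ξ (ρ s)‖⁻¹) s := by
    intro s hs
    have h1 := ((hρs s hs).differentiableAt (by simp)).hasDerivAt
    have h2 := (hσd _ (hρJ s hs)).comp s h1
    have h3 := (hasDerivAt_id s).congr_of_eventuallyEq (f₁ := σ ∘ ρ) (by
      filter_upwards [isOpen_Ioo.mem_nhds hs] with s' hs'
      exact hσρ s' hs')
    have h4 := h2.unique h3
    rwa [eq_inv_of_mul_eq_one_right h4] at h1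
  have hC : ∀ s ∈ J', HasDerivAt (fun s => c (ρ s)) (‖ξ (ρ s)‖⁻¹ • deriv c (ρ s)) s := fun s hs =>
    HasDerivAt.scomp s ((hcs _ (hρJ s hs)).differentiableAt (by simp)).hasDerivAt (hρ' s hs)
  have hCe : ∀ s ∈ J', coframe g φ (c (ρ s)) (deriv (fun s => c (ρ s)) s) = e (ρ s) := by
    intro s hs
    rw [(hC s hs).deriv, map_smul]
    simp [he, hξ]
  -- Injectivity of σ shows that the old first coordinate is a function of the arc length alone on
  -- the whole square.
  have hyρ : ∀ y ∈ E.target, y 0 ∈ J' ∧ E.symm y 0 = ρ (y 0) := by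
    intro y hy
    have hy0 : y 0 ∈ J' := by rw [htar] at hy; exact hy.1
    refine ⟨hy0, hσinj (hEB (E.map_target hy)).1 (hρJ _ hy0) ?_⟩
    rw [(hEinv y hy).1, hσρ _ hy0]
  refine ⟨E, haE, hEB, hEs, hEs', δ, hδ, htar, fun s => c (ρ s), fun s => (τ !₂[ρ s, a 1]).re,
    ?_, ?_, ?_, ?_⟩
  · exact fun s hs => ((hcs _ (hρJ s hs)).comp s (hρs s hs)).contDiffWithinAt
  · exact fun s hs => (Complex.reCLM.contDiff.contDiffAt.comp s
      (ContDiffAt.comp s (hτs _ (hmem _ (hρJ s hs)))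
        (contDiff_cons.contDiffAt.comp s (hρs s hs)))).contDiffWithinAt
  · intro s hs
    refine ⟨hct _ (hρJ s hs), ?_⟩
    rw [hCe s hs, hen _ (hρJ s hs)]
  · intro y hy
    obtain ⟨hy0, hy1⟩ := hyρ y hy
    have hyB := hEB (E.map_target hy)
    refine ⟨by rw [hbase _ hyB, hy1], ?_⟩
    rw [hCe _ hy0]
    have h1 : τ (E.symm y) = (((τ !₂[ρ (y 0), a 1]).re : ℝ) : ℂ) + y 1 * Complex.I := by
      rw [← hy1, ← hα _ hyB, ← (hEinv y hy).2]
      exact (Complex.re_add_im _).symm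
    rw [← h1]
    have h2 := hee _ (hρJ _ hy0)
    change η (E.symm y) = (starRingEnd ℂ) (e (E.symm y 0)) * η (E.symm y) * e (ρ (y 0))
    rw [hy1]
    linear_combination -η (E.symm y) * h2

/-- A minimal Lagrangian surface over a regular curve is an affine normal bundle over a geodesic. -/
lemma isAffineNormalBundleNear_of_curve (hF : IsSmoothImmersion F) (hnull : IsNonNull g o F)
    (hlag : IsLagrangian g o F) (hmin : IsMinimal g o F) (hφ : φ ∈ o.charts)
    (hψ : ψ ∈ IsManifold.maximalAtlas (𝓡 2) ∞ M) (hq : q ∈ ψ.source) {ε : ℝ} (hε : 0 < ε)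
    (htar : ψ.target = box (ψ q) ε) (hproj : ∀ y ∈ ψ.target, (F (ψ.symm y)).proj ∈ φ.source)
    {c : ℝ → Plane} (hc : ContDiffOn ℝ ∞ c (Ioo (ψ q 0 - ε) (ψ q 0 + ε)))
    (hc' : ∀ s ∈ Ioo (ψ q 0 - ε) (ψ q 0 + ε), deriv c s ≠ 0)
    (hbase : ∀ y ∈ ψ.target, baseExpr F ψ φ y = c (y 0)) :
    IsAffineNormalBundleNear g o F q := by
  have hφ' := o.smooth hφ
  obtain ⟨E, haE, hEB, hEs, hEs', δ, hδ, hEt, C, α, hCs, hαs, hCu, hform⟩ :=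
    exists_normal_coordinates (g := g) (f := localExpr F ψ φ) hφ' hε (fun y hy =>
      (eventually_isMinimalLagrangianAt hF hnull hlag hmin hψ hφ (htar ▸ hy)
        (hproj y (htar ▸ hy))).self_of_nhds) hc hc' (fun y hy => hbase y (htar ▸ hy))
  rw [← htar] at hEB
  set J := Ioo (E (ψ q) 0 - δ) (E (ψ q) 0 + δ) with hJ
  have hJo : IsOpen J := isOpen_Ioo
  have hχ := trans_mem_maximalAtlas hψ hEs hEs'
  have hχt := trans_target_of_subset hEB
  have hχq : q ∈ (ψ.trans E).source := by
    rw [ψ.trans_source E]; exact ⟨hq, haE⟩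
  have hsymm := contMDiffOn_symm_of_mem_maximalAtlas hφ'
  set γ : ℝ → S := fun s => φ.symm (C s) with hγ
  have hγs : ContMDiffOn 𝓘(ℝ, ℝ) (𝓡 2) ∞ γ J :=
    hsymm.comp hCs.contMDiffOn fun s hs => (hCu s hs).1
  -- The unit normal is the rotated velocity, defined through the coframe as the vector with ζ(N) =
  -- iζ(C').
  set N : ℝ → Plane := fun s =>
    (coframe g φ (C s)).inverse (Complex.I * coframe g φ (C s) (deriv C s)) with hN
  let n : (s : ℝ) → TangentSpace (𝓡 2) (γ s) := fun s => mfderiv (𝓡 2) (𝓡 2) φ.symm (C s) (N s)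
  have hNc : ∀ s ∈ J, coframe g φ (C s) (N s) = Complex.I * coframe g φ (C s) (deriv C s) :=
    fun s hs => (coframe_isInvertible hφ' (hCu s hs).1).self_apply_inverse _
  have hvel : ∀ s ∈ J, velocity γ s = mfderiv (𝓡 2) (𝓡 2) φ.symm (C s) (deriv C s) := by
    intro s hs
    have h1 : MDifferentiableAt (𝓡 2) (𝓡 2) φ.symm (C s) :=
      (mdifferentiable_of_mem_maximalAtlas hφ').mdifferentiableAt_symm (hCu s hs).1
    have h2 : HasMFDerivAt 𝓘(ℝ, ℝ) (𝓡 2) C s (fderiv ℝ C s) :=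
      (((hCs.contDiffAt (hJo.mem_nhds hs)).differentiableAt (by simp)).hasFDerivAt).hasMFDerivAt
    have h3 := (HasMFDerivAt.comp s h1.hasMFDerivAt h2).mfderiv
    have h4 := DFunLike.congr_fun h3 (1 : ℝ)
    have h5 : fderiv ℝ C s (1 : ℝ) = deriv C s := fderiv_apply_one_eq_deriv
    exact h4.trans (congrArg (mfderiv (𝓡 2) (𝓡 2) φ.symm (C s)) h5)
  have hnorm : ∀ s ∈ J, (coframe g φ (C s) (deriv C s)).re * (coframe g φ (C s) (deriv C s)).re
      + (coframe g φ (C s) (deriv C s)).im * (coframe g φ (C s) (deriv C s)).im = 1 := by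
    intro s hs
    rw [← Complex.normSq_apply, Complex.normSq_eq_norm_sq, (hCu s hs).2, one_pow]
  have hunit : ∀ s ∈ J, g.inner (γ s) (velocity γ s) (velocity γ s) = 1 := by
    intro s hs
    rw [hvel s hs]
    exact (metricIn_eq_coframe hφ' (hCu s hs).1 (deriv C s) (deriv C s)).trans (hnorm s hs)
  have hn : ∀ s ∈ J, g.inner (γ s) (n s) (n s) = 1 ∧ g.inner (γ s) (n s) (velocity γ s) = 0 := by
    intro s hs
    constructor
    · refine (metricIn_eq_coframe hφ' (hCu s hs).1 (N s) (N s)).trans ?_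
      rw [hNc s hs, ← hnorm s hs]
      simp
      ring
    · rw [hvel s hs]
      refine (metricIn_eq_coframe hφ' (hCu s hs).1 (N s) (deriv C s)).trans ?_
      rw [hNc s hs]
      simp
      ring
  have hnf : ∀ x ∈ (ψ.trans E).target, x 0 ∈ J ∧ F ((ψ.trans E).symm x) =
      ⟨γ (x 0), α (x 0) • velocity γ (x 0) + x 1 • n (x 0)⟩ := by
    intro x hx
    rw [hχt] at hx
    have hx0 : x 0 ∈ J := by rw [hEt] at hx; exact hx.1
    have hxψ := hEB (E.map_target hx)
    refine ⟨hx0, ?_⟩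
    obtain ⟨h1, h2⟩ := hform x hx
    have hCt := (hCu _ hx0).1
    have h3 : (localExpr F ψ φ (E.symm x)).2 = α (x 0) • deriv C (x 0) + x 1 • N (x 0) := by
      apply coframe_injective (g := g) hφ' hCt
      rw [fiberCoordinate, h1] at h2
      rw [h2, map_add, map_smul, map_smul, hNc _ hx0]
      simp
      ring
    have h4 := eq_of_tangentChart hφ' (hproj _ hxψ)
      (Prod.ext h1 h3 : localExpr F ψ φ (E.symm x) = (_, _))
    rw [hvel _ hx0]
    have hlin : ∀ (L : Plane →L[ℝ] Plane) (r t : ℝ) (u v : Plane),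
        L (r • u + t • v) = r • L u + t • L v := fun L r t u v => by
      rw [map_add, map_smul, map_smul]
    exact h4.trans (congrArg (fun w => (⟨φ.symm (C (x 0)), w⟩ : TangentBundle (𝓡 2) S))
      (hlin (mfderiv (𝓡 2) (𝓡 2) φ.symm (C (x 0))) _ _ _ _))
  refine ⟨ψ.trans E, hχ, hχq, _, _, γ, α, n,
    isUnitSpeedGeodesicOn_of_normalForm hF hnull hlag hmin hχ hJo hγs hunit hn hnf ?_,
    hαs, hn, hnf⟩
  intro s hs
  refine ⟨!₂[s, E (ψ q) 1], ?_, rfl⟩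
  rw [hχt, hEt]
  exact ⟨hs, by simpa using hδ⟩

end NormalFormExistence

/-! ### The case where the projection has rank one -/

section Dichotomy

variable {S : Type*} [TopologicalSpace S] [ChartedSpace Plane S] [IsManifold (𝓡 2) ∞ S]
  {g : SurfaceMetric S} {o : OrientedAtlas S} {φ : OpenPartialHomeomorph S Plane}
  {M : Type*} [TopologicalSpace M] [ChartedSpace Plane M] [IsManifold (𝓡 2) ∞ M]
  {F : M → TangentBundle (𝓡 2) S} {ψ : OpenPartialHomeomorph M Plane} {q : M}

/-- Shows that the curve found by straightening, which has one component equal to its parameter, is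
regular. -/
lemma deriv_ne_zero_of_coord_eq {c : ℝ → Plane} {i : Fin 2} {s : ℝ}
    (hc : DifferentiableAt ℝ c s) (h : ∀ᶠ s' in 𝓝 s, c s' i = s') : deriv c s ≠ 0 := by
  intro h0
  have h1 : HasDerivAt c 0 s := h0 ▸ hc.hasDerivAt
  have h2 := (hasFDerivAt_coord i (c s)).comp_hasDerivAt s h1
  have h3 : HasDerivAt (fun s => c s i) 1 s := (hasDerivAt_id s).congr_of_eventuallyEq h
  exact zero_ne_one ((map_zero _).symm.trans (h2.unique h3))

/-- At rank 0 the tangent plane would be vertical, where the complex area Θ vanishes. -/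
lemma IsMinimalLagrangianAt.fderiv_baseExpr_ne_zero (hF : ContMDiff (𝓡 2) (𝓡 2).tangent ∞ F)
    (hφ : φ ∈ IsManifold.maximalAtlas (𝓡 2) ∞ S) (hψ : ψ ∈ IsManifold.maximalAtlas (𝓡 2) ∞ M)
    {x : Plane} (hx : x ∈ ψ.target) (hx' : (F (ψ.symm x)).proj ∈ φ.source)
    (h : IsMinimalLagrangianAt g φ (localExpr F ψ φ) x) : fderiv ℝ (baseExpr F ψ φ) x ≠ 0 := by
  intro h0
  have h1 : ∀ v, (frameDeriv g φ (localExpr F ψ φ) v x).1 = 0 := fun v => by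
    rw [frameDeriv, tangentCoframe_fst, fderiv_localExpr_fst hF hφ hψ hx hx', h0]
    simp
  refine h.surfaceArea_ne_zero hφ ?_
  rw [surfaceArea, complexArea, h1, h1]
  simp

/-- Where the projection to the base is nowhere a local diffeomorphism, a minimal Lagrangian
surface is an affine normal bundle over a geodesic. -/
theorem isAffineNormalBundleNear_of_projectionRank (hF : IsSmoothImmersion F)
    (hnull : IsNonNull g o F) (hlag : IsLagrangian g o F) (hmin : IsMinimal g o F)
    (hq : ∀ᶠ q' in 𝓝 q, projectionRank F q' ≠ 2) : IsAffineNormalBundleNear g o F q := by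
  obtain ⟨φ, hφ, hp⟩ := o.cover (F q).proj
  have hφ' := o.smooth hφ
  set ψ := chartAt Plane q with hψdef
  have hψ : ψ ∈ IsManifold.maximalAtlas (𝓡 2) ∞ M := chart_mem q
  have hs : q ∈ ψ.source := mem_chart_source Plane q
  have ht : ψ q ∈ ψ.target := ψ.map_source hs
  have hev : ∀ᶠ q' in 𝓝 q, (F q').proj ∈ φ.source ∧ projectionRank F q' ≠ 2 :=
    ((continuous_proj_comp hF.smooth).continuousAt.eventually (φ.open_source.mem_nhds hp)).and hq
  obtain ⟨W, hW, hWo, hqW⟩ := eventually_nhds_iff.1 hev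
  set U := ψ.target ∩ ψ.symm ⁻¹' W with hU
  have hUo : IsOpen U := ψ.isOpen_inter_preimage_symm hWo
  have hqU : ψ q ∈ U := ⟨ht, by rwa [mem_preimage, ψ.left_inv hs]⟩
  have hUp : ∀ y ∈ U, (F (ψ.symm y)).proj ∈ φ.source := fun y hy => (hW _ hy.2).1
  obtain ⟨e, hqe, heU, hes, hes', ε, hε, het, i, c, hc, hci, hec⟩ :=
    exists_straightening (p := baseExpr F ψ φ) hUo
      (fun y hy => (contDiffAt_baseExpr hF.smooth hφ' hψ hy.1 (hUp y hy)).contDiffWithinAt) hqU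
      ((eventually_isMinimalLagrangianAt hF hnull hlag hmin hψ hφ ht
        (hUp _ hqU)).self_of_nhds.fderiv_baseExpr_ne_zero hF.smooth hφ' hψ ht (hUp _ hqU))
      -- Rank different from 2 is needed on the whole open set, in the form of a vanishing
      -- determinant at every point.
      (fun y hy => by
        have h := projectionRank_eq_two_iff hF.smooth hφ' hψ (ψ.map_target hy.1) (hUp y hy)
        rw [ψ.right_inv hy.1] at h
        exact not_not.1 fun h0 => (hW _ hy.2).2 (h.2 h0))
  have htar : (ψ.trans e).target = e.target := trans_target_of_subset fun y hy => (heU hy).1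
  refine isAffineNormalBundleNear_of_curve hF hnull hlag hmin hφ (ψ := ψ.trans e)
    (trans_mem_maximalAtlas hψ hes hes') (by rw [ψ.trans_source e]; exact ⟨hs, hqe⟩) hε
    (htar.trans het) ?_ hc ?_ ?_
  · intro y hy
    exact hUp _ (heU (e.map_target (htar ▸ hy)))
  · intro s hs
    refine deriv_ne_zero_of_coord_eq (i := i)
      ((hc.contDiffAt (isOpen_Ioo.mem_nhds hs)).differentiableAt (by simp)) ?_
    filter_upwards [isOpen_Ioo.mem_nhds hs] with s' hs'
    exact hci s' hs'
  · intro y hy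
    exact hec y (htar ▸ hy)

end Dichotomy

end TangentSurface
end

theorem mainTheorem1 {S : Type*} [TopologicalSpace S] [ChartedSpace TangentSurface.Plane S]
    [IsManifold (𝓡 2) ∞ S] (g : TangentSurface.SurfaceMetric S)
    (o : TangentSurface.OrientedAtlas S)
    {M : Type*} [TopologicalSpace M] [ChartedSpace TangentSurface.Plane M]
    [IsManifold (𝓡 2) ∞ M] (F : M → TangentBundle (𝓡 2) S)
    (hF : TangentSurface.IsSmoothImmersion F)
    (hnull : TangentSurface.IsNonNull g o F)
    (hlag : TangentSurface.IsLagrangian g o F)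
    (hmin : TangentSurface.IsMinimal g o F) :
    (∀ q : M, TangentSurface.IsAffineNormalBundleNear g o F q ∨
      (F q).proj ∈ closure {p : S | TangentSurface.IsFlatNear g o p}) ∧
    ((∃ r : ℕ, ∀ q : M, TangentSurface.projectionRank F q = r) →
      (∀ q : M, TangentSurface.IsAffineNormalBundleNear g o F q) ∨
      (∀ q : M, TangentSurface.IsFlatNear g o (F q).proj)) := by
  refine ⟨fun q => ?_, ?_⟩
  · by_cases hq : ∀ᶠ q' in 𝓝 q, TangentSurface.projectionRank F q' ≠ 2
    · exact Or.inl (TangentSurface.isAffineNormalBundleNear_of_projectionRank hF hnull hlag hmin hq)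
    -- Rank 2 occurs arbitrarily close to q; the projections of such points have flat neighbourhoods
    -- and converge to that of q.
    · have h : ∃ᶠ q' in 𝓝 q, TangentSurface.projectionRank F q' = 2 := hq
      exact Or.inr (mem_closure_of_frequently_of_tendsto
        (h.mono fun q' hq' => TangentSurface.isFlatNear_of_projectionRank hF hnull hlag hmin hq')
        (TangentSurface.continuous_proj_comp hF.smooth).continuousAt)
  · rintro ⟨r, hr⟩
    by_cases h2 : r = 2
    · exact Or.inr fun q =>
        TangentSurface.isFlatNear_of_projectionRank hF hnull hlag hmin ((hr q).trans h2)
    · exact Or.inl fun q =>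
        TangentSurface.isAffineNormalBundleNear_of_projectionRank hF hnull hlag hmin
          (Eventually.of_forall fun q' => (hr q').trans_ne h2)
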